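/- \textbf{Corollary.} Let $\Gamma$ be a (not necessarily finite) triangle-free simplicial graph, and suppose that $\Gamma$ contains an induced cycle of odd length $n \geq 5$. Then the right-angled Artin group $A(\Gamma) = \langle u \in V(\Gamma) \mid uvu^{-1}v^{-1}=1 \text{ for } \{u,v\} \in E(\Gamma) \rangle$ is not a diagram group; that is, there is no semigroup presentation $\mathcal{P}$ and no baseword $w \in \Sigma^+$ such that $A(\Gamma)$ is isomorphic to the diagram group $D(\mathcal{P},w)$. Here a \emph{semigroup presentation} $\mathcal{P} = \langle \Sigma \mid \mathcal{R} \rangle$ consists of an alphabet $\Sigma$ (of arbitrary cardinality) and a set $\mathcal{R}$ of relations $u=v$ between nonempty words $u,v \in \Sigma^+$, such that $v=u$ does not belong to $\mathcal{R}$ whenever $u=v$ does (in particular no relation has the form $u=u$). The \emph{Squier square complex} $S(\mathcal{P})$ has $\Sigma^+$ as its set of vertices; it has an edge $[a,u=v,b]$ from $aub$ to $avb$ for all (possibly empty) words $a,b$ and every relation $u=v$ in $\mathcal{R}$; and it has a square $[a,u=v,b,p=q,c]$, for all (possibly empty) words $a,b,c$ and all relations $u=v$ and $p=q$ in $\mathcal{R}$,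 bounding the $4$-cycle with edges $[a,u=v,bpc]$, $[avb,p=q,c]$, $[a,u=v,bqc]$, $[aub,p=q,c]$. The \emph{diagram group} $D(\mathcal{P},w)$ is the fundamental group $\pi_1(S(\mathcal{P}),w)$. -/

import Mathlib

open CategoryTheory

universe u v

/-- The right-angled Artin group `A(Γ)`: one generator for every vertex of `Γ`, and the relation
`[a, b] = 1` for every edge `{a, b}` of `Γ`. -/
abbrev RightAngledArtinGroup {V : Type u} (Γ : SimpleGraph V) : Type u :=
  PresentedGroup
    {g : FreeGroup V | ∃ a b : V, Γ.Adj a b ∧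
      g = FreeGroup.of a * FreeGroup.of b * (FreeGroup.of a)⁻¹ * (FreeGroup.of b)⁻¹}

/-- A semigroup presentation `⟨Σ | R⟩` over the alphabet `α`: a set of relations `u = v`, recorded
as pairs `(u, v)` of positive (that is, nonempty) words, such that `v = u` is not in `R` whenever
`u = v` is in `R`; in particular, no relation is of the form `u = u`. -/
structure SemigroupPresentation (α : Type v) where
  rels : Set (List α × List α)
  left_ne_nil : ∀ r ∈ rels, r.1 ≠ []
  right_ne_nil : ∀ r ∈ rels, r.2 ≠ []
  not_swap_mem : ∀ r ∈ rels, r.swap ∉ rels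

namespace SemigroupPresentation

/-- The vertices of the Squier square complex `S(P)`: the positive words over the alphabet. -/
structure Vertex {α : Type v} (_P : SemigroupPresentation α) where
  word : List α
  ne_nil : word ≠ []

variable {α : Type v} (P : SemigroupPresentation α)

/-- The edges of `S(P)` oriented from `x` to `y`: an edge `[a, u = v, b]`, where `a` and `b` are
possibly empty words and where `u = v` belongs to `R`, goes from `aub` to `avb`. -/
structure Edge (x y : P.Vertex) where
  left : List α
  rel : P.rels
  right : List α
  source_eq : x.word = left ++ rel.1.1 ++ right
  target_eq : y.word = left ++ rel.1.2 ++ right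

instance : Quiver P.Vertex where
  Hom x y := P.Edge x y

/-- The edge-paths of `S(P)` (in which edges may be crossed in both directions), up to adding and
removing backtracks. -/
abbrev FreePathGroupoid : Type v := Quiver.FreeGroupoid P.Vertex

/-- The class of the path that consists of the single edge `[a, u = v, b]`. -/
def edgePath {x y : P.Vertex} (e : P.Edge x y) :
    (Quiver.FreeGroupoid.of P.Vertex).obj x ⟶ (Quiver.FreeGroupoid.of P.Vertex).obj y :=
  (Quiver.FreeGroupoid.of P.Vertex).map e

/-- The two halves of the boundary of a square. The square `[a, u = v, b, p = q, c]` of `S(P)`,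
where `r` is `u = v` and `s` is `p = q`, has the vertices `aubpc`, `avbpc`, `aubqc`, `avbqc` and
the edges `[a, u = v, bpc]`, `[avb, p = q, c]`, `[aub, p = q, c]`, `[a, u = v, bqc]`. -/
inductive SquareRel : HomRel P.FreePathGroupoid
  | square (a b c : List α) (r s : P.rels) (x y z t : P.Vertex)
      (hx : x.word = a ++ r.1.1 ++ b ++ s.1.1 ++ c)
      (hy : y.word = a ++ r.1.2 ++ b ++ s.1.1 ++ c)
      (hz : z.word = a ++ r.1.1 ++ b ++ s.1.2 ++ c)
      (ht : t.word = a ++ r.1.2 ++ b ++ s.1.2 ++ c) :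
      SquareRel
        (P.edgePath (x := x) (y := y)
            ⟨a, r, b ++ s.1.1 ++ c, by simp [hx], by simp [hy]⟩ ≫
          P.edgePath (x := y) (y := t)
            ⟨a ++ r.1.2 ++ b, s, c, by simp [hy], by simp [ht]⟩)
        (P.edgePath (x := x) (y := z)
            ⟨a ++ r.1.1 ++ b, s, c, by simp [hx], by simp [hz]⟩ ≫
          P.edgePath (x := z) (y := t)
            ⟨a, r, b ++ s.1.2 ++ c, by simp [hz], by simp [ht]⟩)

/-- The fundamental groupoid of the square complex `S(P)`: edge-paths between words, up to adding
and removing backtracks and flipping squares. -/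
abbrev SquierGroupoid : Type v := CategoryTheory.Quotient P.SquareRel

/-- The vertex `w` of `S(P)`, as an object of the fundamental groupoid. -/
def basepoint (w : P.Vertex) : P.SquierGroupoid :=
  ⟨(Quiver.FreeGroupoid.of P.Vertex).obj w⟩

/-- The diagram group `D(P, w)`: the fundamental group of `S(P)` based at `w`, that is, the
homotopy classes of closed edge-paths at `w` with concatenation as product. -/
abbrev DiagramGroup (w : P.Vertex) : Type v := P.basepoint w ⟶ P.basepoint w

end SemigroupPresentation

/-- A group is a diagram group if it is isomorphic to `D(P, w)` for some semigroup presentation `P`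
(over an alphabet of arbitrary cardinality) and some positive baseword `w`. -/
def IsDiagramGroup (H : Type u) [Group H] : Prop :=
  ∃ (α : Type v) (P : SemigroupPresentation α) (w : P.Vertex), Nonempty (H ≃* P.DiagramGroup w)

/-!
Suppose that `A(Γ)` is the diagram group `D(P, w)`. It then acts on the universal cover of the Squier
complex of `P`, which is the 2-skeleton of a CAT(0) cube complex, and on the hyperplanes of this
complex. The proof derives from a few properties of the action on hyperplanes that every induced odd
cycle in `Γ` can be coloured with two colours.

*The complex.* All edges of the Squier complex generate the *path group* `PathGroup P`, in which the
squares are relators. Moving edges to the left across squares and cancelling them gives unique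
normal forms (`SignedEdge.push`, `nf`), because the group acts on the set of normal forms. So
`D(P, w)` can be identified with the subgroup of closed paths at `w` (`diagramGroupEquiv`), and
adding letters on the left or on the right of all words is an injective endomorphism of the path
group (`whisker_injective`).

*Hyperplanes.* A hyperplane is a class of edges `[a, u = v, b]`, where parallel edges differ by a
path `A + u + B`. Its stabilizer is therefore the product of two commuting subgroups, which move
only the subwords to the left or to the right of it (`smul_eq_self_iff`). Two hyperplanes that cross
are ordered from left to right (`Precedes`), and these subgroups are monotone in this order. The
height of an element with respect to a hyperplane counts crossings with orientation; an element
*skewers* a hyperplane if its powers pass from one side to the other one. Two facts are crucial.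
If `s` and `s'` commute, `s` fixes `J` and skewers `K`, and `s'` fixes `K` and skewers `J`, then `J`
and `K` cross (`Hyperplane.precedes_or_precedes`, by an area argument). Every `g ≠ 1` skewers a
hyperplane `J` such that all elements of `leftStab J` commute with `g`
(`Hyperplane.exists_leftmost`): in a shortest conjugate of `g` inside a shortest subword, the edges
at the left end of a word are never crossed back.

*Right-angled Artin groups.* Let `J` be such a leftmost hyperplane for a vertex `a` of the cycle, and
let `b` and `d` be its two neighbours. Centralizers in `A(Γ)` are known well enough, by a homomorphism
to a semidirect product (`exists_eq_zpow_mul_of_commute`) and by homomorphisms to the Heisenberg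
group (`expSum_mul_eq_of_commute`), to conclude that powers of `b` and `d` fix `J`, and that both of
them act only on the left of `J` or both of them only on the right
(`exists_zpow_mem_left_or_right`). Leftmost hyperplanes of adjacent vertices cannot be of the same
kind, since they would have to cross. Thus the two kinds are the colours of a proper colouring of the
cycle, whose length is therefore even.
-/

namespace SemigroupPresentation

/-! ### Normal forms of edge-paths -/

/-- An edge `[a, u = v, b]` of the Squier complex together with a direction in which it is crossed:
from `aub` to `avb` if `dir = true`, and from `avb` to `aub` if `dir = false`. -/
@[ext]
structure SignedEdge {α : Type v} (P : SemigroupPresentation α) where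
  left : List α
  rel : P.rels
  dir : Bool
  right : List α

namespace SignedEdge

variable {α : Type v} {P : SemigroupPresentation α}

/-- The side of the relation that is replaced when the edge is crossed. -/
def src (e : P.SignedEdge) : List α := cond e.dir e.rel.1.1 e.rel.1.2

/-- The side of the relation that is inserted when the edge is crossed. -/
def tgt (e : P.SignedEdge) : List α := cond e.dir e.rel.1.2 e.rel.1.1

/-- The same edge, crossed in the other direction. -/
def inv (e : P.SignedEdge) : P.SignedEdge := ⟨e.left, e.rel, !e.dir, e.right⟩

/-- The edge `x + e + y`, which applies the same relation between longer words. -/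
def whisker (x y : List α) (e : P.SignedEdge) : P.SignedEdge :=
  ⟨x ++ e.left, e.rel, e.dir, e.right ++ y⟩

@[simp] lemma inv_left (e : P.SignedEdge) : e.inv.left = e.left := rfl
@[simp] lemma inv_rel (e : P.SignedEdge) : e.inv.rel = e.rel := rfl
@[simp] lemma inv_dir (e : P.SignedEdge) : e.inv.dir = !e.dir := rfl
@[simp] lemma inv_right (e : P.SignedEdge) : e.inv.right = e.right := rfl
@[simp] lemma inv_src (e : P.SignedEdge) : e.inv.src = e.tgt := by
  rcases e with ⟨l, r, _ | _, m⟩ <;> rfl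
@[simp] lemma inv_tgt (e : P.SignedEdge) : e.inv.tgt = e.src := by
  rcases e with ⟨l, r, _ | _, m⟩ <;> rfl
@[simp] lemma inv_inv (e : P.SignedEdge) : e.inv.inv = e := by
  rcases e with ⟨l, r, _ | _, m⟩ <;> rfl

@[simp] lemma whisker_left (x y : List α) (e : P.SignedEdge) :
    (e.whisker x y).left = x ++ e.left := rfl
@[simp] lemma whisker_rel (x y : List α) (e : P.SignedEdge) : (e.whisker x y).rel = e.rel := rfl
@[simp] lemma whisker_dir (x y : List α) (e : P.SignedEdge) : (e.whisker x y).dir = e.dir := rfl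
@[simp] lemma whisker_right (x y : List α) (e : P.SignedEdge) :
    (e.whisker x y).right = e.right ++ y := rfl
@[simp] lemma whisker_src (x y : List α) (e : P.SignedEdge) : (e.whisker x y).src = e.src := rfl
@[simp] lemma whisker_tgt (x y : List α) (e : P.SignedEdge) : (e.whisker x y).tgt = e.tgt := rfl

lemma src_ne_nil (e : P.SignedEdge) : e.src ≠ [] := by
  rcases e with ⟨l, r, _ | _, m⟩
  · exact P.right_ne_nil _ r.2
  · exact P.left_ne_nil _ r.2

lemma tgt_ne_nil (e : P.SignedEdge) : e.tgt ≠ [] := by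
  rw [← inv_src]; exact src_ne_nil _

lemma src_length_pos (e : P.SignedEdge) : 0 < e.src.length :=
  List.length_pos_iff.2 e.src_ne_nil

lemma tgt_length_pos (e : P.SignedEdge) : 0 < e.tgt.length :=
  List.length_pos_iff.2 e.tgt_ne_nil

/-- In the path that crosses `e` and then `f`, the edge `f` applies its relation to the left of
`e`, and `k` is the word between the two subwords. The two edges then span a square. -/
def LeftOf (e f : P.SignedEdge) (k : List α) : Prop :=
  e.left = f.left ++ f.src ++ k ∧ f.right = k ++ e.tgt ++ e.right

/-- The edge opposite to `e` in the square that `e` spans with an edge `f` on its left. -/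
def slideRight (e f : P.SignedEdge) (k : List α) : P.SignedEdge :=
  ⟨f.left ++ f.tgt ++ k, e.rel, e.dir, e.right⟩

/-- The edge opposite to `f` in the square that `e` spans with an edge `f` on its left. -/
def slideLeft (e f : P.SignedEdge) (k : List α) : P.SignedEdge :=
  ⟨f.left, f.rel, f.dir, k ++ e.src ++ e.right⟩

section slide
variable (e f : P.SignedEdge) (k : List α)
@[simp] lemma slideRight_left : (slideRight e f k).left = f.left ++ f.tgt ++ k := rfl
@[simp] lemma slideRight_rel : (slideRight e f k).rel = e.rel := rfl
@[simp] lemma slideRight_dir : (slideRight e f k).dir = e.dir := rfl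
@[simp] lemma slideRight_right : (slideRight e f k).right = e.right := rfl
@[simp] lemma slideRight_src : (slideRight e f k).src = e.src := rfl
@[simp] lemma slideRight_tgt : (slideRight e f k).tgt = e.tgt := rfl
@[simp] lemma slideLeft_left : (slideLeft e f k).left = f.left := rfl
@[simp] lemma slideLeft_rel : (slideLeft e f k).rel = f.rel := rfl
@[simp] lemma slideLeft_dir : (slideLeft e f k).dir = f.dir := rfl
@[simp] lemma slideLeft_right : (slideLeft e f k).right = k ++ e.src ++ e.right := rfl
@[simp] lemma slideLeft_src : (slideLeft e f k).src = f.src := rfl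
@[simp] lemma slideLeft_tgt : (slideLeft e f k).tgt = f.tgt := rfl
end slide

lemma LeftOf.unique {e f : P.SignedEdge} {k k' : List α} (h : LeftOf e f k)
    (h' : LeftOf e f k') : k = k' := by
  have := h.1.symm.trans h'.1
  simpa using this

lemma LeftOf.left_ne {e f : P.SignedEdge} {k : List α} (h : LeftOf e f k) :
    e.left ≠ f.left := by
  intro h'
  have h1 := h.1
  simp [h', f.src_ne_nil] at h1

lemma LeftOf.ne_inv {e f : P.SignedEdge} {k : List α} (h : LeftOf e f k) : e ≠ f.inv := by
  intro h'; exact h.left_ne (by rw [h']; rfl)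

/-- `e` may follow `g` in a normal form: the two edges do not cancel, and `e` is not on the left
of `g`. -/
def Admissible (e g : P.SignedEdge) : Prop := (¬ ∃ k, LeftOf g e k) ∧ g ≠ e.inv

open Classical in
/-- Append an edge to a path in normal form and restore the normal form, by moving the edge to the
left past the edges with which it spans a square and by cancelling it if possible. Paths are stored
with their last edge first. -/
noncomputable def push : List P.SignedEdge → P.SignedEdge → List P.SignedEdge
  | [], f => [f]
  | e :: s, f =>
    if e = f.inv then s
    else if h : ∃ k, LeftOf e f k then slideRight e f h.choose :: push s (slideLeft e f h.choose)
    else f :: e :: s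

@[simp] lemma push_nil (f : P.SignedEdge) : push [] f = [f] := rfl

lemma push_cancel (s : List P.SignedEdge) (f : P.SignedEdge) : push (f.inv :: s) f = s := by
  simp [push]

lemma push_cancel' (s : List P.SignedEdge) (f : P.SignedEdge) : push (f :: s) f.inv = s := by
  simpa using push_cancel s f.inv

lemma push_leftOf {s : List P.SignedEdge} {e f : P.SignedEdge} {k : List α} (h : LeftOf e f k) :
    push (e :: s) f = slideRight e f k :: push s (slideLeft e f k) := by
  have hk : ∃ k, LeftOf e f k := ⟨k, h⟩
  have : hk.choose = k := hk.choose_spec.unique h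
  rw [push, if_neg h.ne_inv, dif_pos hk, this]

lemma push_admissible {s : List P.SignedEdge} {e f : P.SignedEdge} (h : Admissible f e) :
    push (e :: s) f = f :: e :: s := by
  rw [push, if_neg h.2, dif_neg h.1]

/-- The normal forms of paths: every edge is admissible after the preceding one. -/
def Normal (s : List P.SignedEdge) : Prop := s.IsChain Admissible

lemma push_of_normal {s : List P.SignedEdge} {f : P.SignedEdge} (h : Normal (f :: s)) :
    push s f = f :: s := by
  cases s with
  | nil => rfl
  | cons e s => exact push_admissible (List.isChain_cons_cons.1 h).1

lemma trichotomy (e f : P.SignedEdge) : e = f.inv ∨ (∃ k, LeftOf e f k) ∨ Admissible f e := by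
  by_cases h1 : e = f.inv
  · exact Or.inl h1
  by_cases h2 : ∃ k, LeftOf e f k
  · exact Or.inr (Or.inl h2)
  exact Or.inr (Or.inr ⟨h2, h1⟩)

lemma slide_admissible (e f : P.SignedEdge) (k : List α) :
    Admissible (slideRight e f k) (slideLeft e f k) := by
  constructor
  · rintro ⟨j, h, -⟩
    have := congrArg List.length h
    have h1 := f.tgt_length_pos
    simp only [slideLeft_left, slideRight_left, List.length_append] at this
    omega
  · intro h
    have := congrArg SignedEdge.left h
    simp [f.tgt_ne_nil] at this

/-- The key step: an edge which moves to the left past the top of a normal form leaves that top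
edge admissible. -/
lemma normal_cons_push {e f : P.SignedEdge} {k : List α} (h : LeftOf e f k)
    {s : List P.SignedEdge} (hs : Normal (e :: s)) (hp : Normal (push s (slideLeft e f k))) :
    Normal (slideRight e f k :: push s (slideLeft e f k)) := by
  cases s with
  | nil => exact List.isChain_pair.2 (slide_admissible e f k)
  | cons g s =>
    have hge : Admissible e g := (List.isChain_cons_cons.1 hs).1
    rcases trichotomy g (slideLeft e f k) with hg | ⟨k', hg⟩ | hg
    · subst hg
      rw [push_cancel]
      cases s with
      | nil => exact List.isChain_singleton _
      | cons h' s =>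
        have hh : Admissible (slideLeft e f k).inv h' :=
          (List.isChain_cons_cons.1 (List.isChain_cons_cons.1 hs).2).1
        refine List.isChain_cons_cons.2 ⟨?_, (List.isChain_cons_cons.1
          (List.isChain_cons_cons.1 hs).2).2⟩
        constructor
        · rintro ⟨j, hj⟩
          refine hh.1 ⟨k ++ e.src ++ j, ?_, ?_⟩
          · simp [hj.1]
          · have := hj.2
            simp at this
            simp [this]
        · intro hj
          refine hh.1 ⟨k, ?_, ?_⟩
          · simp [hj]
          · simp [hj]
    · rw [push_leftOf hg] at hp ⊢
      refine List.isChain_cons_cons.2 ⟨?_, hp⟩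
      obtain ⟨hg1, hg2⟩ := hg
      constructor
      · rintro ⟨j, hj1, hj2⟩
        simp at hj1 hj2 hg1
        refine hge.1 ⟨j, ?_, hj2.trans (by simp)⟩
        rw [hg1, hj1, h.1]
        simp
      · intro hj
        have hl := congrArg SignedEdge.left hj
        have hr := congrArg SignedEdge.rel hj
        have hd := congrArg SignedEdge.dir hj
        have hm := congrArg SignedEdge.right hj
        simp at hl hr hd hm hg1
        refine hge.2 (SignedEdge.ext ?_ hr hd hm)
        simp [hg1, h.1, hl]
    · rw [push_admissible hg] at hp ⊢
      exact List.isChain_cons_cons.2 ⟨slide_admissible e f k, hp⟩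

lemma Normal.tail {e : P.SignedEdge} {s : List P.SignedEdge} (h : Normal (e :: s)) : Normal s :=
  List.IsChain.tail h

lemma normal_push {s : List P.SignedEdge} (hs : Normal s) (f : P.SignedEdge) :
    Normal (push s f) := by
  induction s generalizing f with
  | nil => exact List.isChain_singleton _
  | cons e s ih =>
    rcases trichotomy e f with h | ⟨k, h⟩ | h
    · subst h; rw [push_cancel]; exact hs.tail
    · rw [push_leftOf h]; exact normal_cons_push h hs (ih hs.tail _)
    · rw [push_admissible h]; exact List.isChain_cons_cons.2 ⟨h, hs⟩

lemma push_push_inv {s : List P.SignedEdge} (hs : Normal s) (f : P.SignedEdge) :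
    push (push s f) f.inv = s := by
  induction s generalizing f with
  | nil => exact push_cancel' [] f
  | cons e s ih =>
    rcases trichotomy e f with h | ⟨k, h⟩ | h
    · subst h; rw [push_cancel]; exact push_of_normal hs
    · rw [push_leftOf h]
      have h' : LeftOf (slideRight e f k) f.inv k := ⟨by simp, by simp [h.2]⟩
      have e1 : slideRight (slideRight e f k) f.inv k = e := by
        ext1 <;> simp [h.1]
      have e2 : slideLeft (slideRight e f k) f.inv k = (slideLeft e f k).inv := by
        ext1 <;> simp
      rw [push_leftOf h', e1, e2, ih hs.tail]
    · rw [push_admissible h, push_cancel']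

lemma push_square {s : List P.SignedEdge} (hs : Normal s) {e f : P.SignedEdge} {k : List α}
    (h : LeftOf e f k) :
    push (push s e) f = push (push s (slideLeft e f k)) (slideRight e f k) := by
  induction s generalizing e f k with
  | nil =>
    rw [push_nil, push_leftOf h, push_nil, push_admissible (slide_admissible e f k)]
  | cons g s ih =>
    rcases trichotomy g e with hg | ⟨j, hg⟩ | hg
    · subst hg
      rw [push_cancel]
      have h1 : LeftOf e.inv (slideLeft e f k) k := ⟨by simp [h.1], by simp⟩
      have e1 : slideRight e.inv (slideLeft e f k) k = (slideRight e f k).inv := by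
        ext1 <;> simp
      have e2 : slideLeft e.inv (slideLeft e f k) k = f := by
        ext1 <;> simp [h.2]
      rw [push_leftOf h1, e1, e2, push_cancel]
    · rw [push_leftOf hg]
      have h1 : LeftOf (slideRight g e j) f (k ++ e.tgt ++ j) :=
        ⟨by simp [h.1], by simp [h.2, hg.2]⟩
      have h2 : LeftOf (slideLeft g e j) (slideLeft (slideRight g e j) f (k ++ e.tgt ++ j)) k :=
        ⟨by simp [h.1], by simp⟩
      have h3 : LeftOf g (slideLeft e f k) (k ++ e.src ++ j) :=
        ⟨by simp [hg.1, h.1], by simp [hg.2]⟩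
      have h4 : LeftOf (slideRight g (slideLeft e f k) (k ++ e.src ++ j)) (slideRight e f k) j :=
        ⟨by simp, by simp [hg.2]⟩
      rw [push_leftOf h1, ih hs.tail h2, push_leftOf h3, push_leftOf h4]
      congr 1
      · ext1 <;> simp
      · congr 1
        · congr 1
          ext1 <;> simp
    · rw [push_admissible hg]
      have hn : Normal (e :: g :: s) := List.isChain_cons_cons.2 ⟨hg, hs⟩
      rw [push_leftOf h]
      exact (push_of_normal (normal_cons_push h hn (normal_push hs _))).symm

end SignedEdge

/-! ### The path group -/

section PathGroup

variable {α : Type v} (P : SemigroupPresentation α)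

/-- The universal group of the fundamental groupoid of the Squier complex: the edges are the
generators, and the boundaries of the squares are the relators. All words are allowed as source and
target of a path, so that paths between different words can be multiplied freely. -/
abbrev PathGroup : Type v :=
  PresentedGroup {g : FreeGroup (List α × P.rels × List α) | ∃ (a b c : List α) (r s : P.rels),
    g = FreeGroup.of (a, r, b ++ s.1.1 ++ c) * FreeGroup.of (a ++ r.1.2 ++ b, s, c) *
      (FreeGroup.of (a, r, b ++ s.1.2 ++ c))⁻¹ * (FreeGroup.of (a ++ r.1.1 ++ b, s, c))⁻¹}

variable {P}

namespace PathGroup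

/-- The element of the path group given by the edge `[a, r, b]`. -/
def edge (a : List α) (r : P.rels) (b : List α) : P.PathGroup := PresentedGroup.of (a, r, b)

lemma edge_square (a b c : List α) (r s : P.rels) :
    edge a r (b ++ s.1.1 ++ c) * edge (a ++ r.1.2 ++ b) s c =
      edge (a ++ r.1.1 ++ b) s c * edge a r (b ++ s.1.2 ++ c) := by
  have h : (PresentedGroup.mk {g : FreeGroup (List α × P.rels × List α) |
      ∃ (a b c : List α) (r s : P.rels),
    g = FreeGroup.of (a, r, b ++ s.1.1 ++ c) * FreeGroup.of (a ++ r.1.2 ++ b, s, c) *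
      (FreeGroup.of (a, r, b ++ s.1.2 ++ c))⁻¹ * (FreeGroup.of (a ++ r.1.1 ++ b, s, c))⁻¹})
      _ = 1 :=
    PresentedGroup.one_of_mem ⟨a, b, c, r, s, rfl⟩
  rw [map_mul, map_mul, map_mul, map_inv, map_inv, mul_inv_eq_one, mul_inv_eq_iff_eq_mul] at h
  exact h

@[elab_as_elim]
lemma induction {p : P.PathGroup → Prop} (g : P.PathGroup) (one : p 1)
    (edge : ∀ a r b, p (edge a r b)) (mul : ∀ x y, p x → p y → p (x * y))
    (inv : ∀ x, p x → p x⁻¹) : p g := by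
  have hg : g ∈ Subgroup.closure (Set.range (PresentedGroup.of (rels :=
      {g : FreeGroup (List α × P.rels × List α) | ∃ (a b c : List α) (r s : P.rels),
    g = FreeGroup.of (a, r, b ++ s.1.1 ++ c) * FreeGroup.of (a ++ r.1.2 ++ b, s, c) *
      (FreeGroup.of (a, r, b ++ s.1.2 ++ c))⁻¹ * (FreeGroup.of (a ++ r.1.1 ++ b, s, c))⁻¹}))) := by
    rw [PresentedGroup.closure_range_of]; trivial
  induction hg using Subgroup.closure_induction with
  | mem x hx => obtain ⟨⟨a, r, b⟩, rfl⟩ := hx; exact edge a r b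
  | one => exact one
  | mul x y _ _ hx hy => exact mul x y hx hy
  | inv x _ hx => exact inv x hx

/-- A homomorphism out of the path group is given by a function on edges that is compatible with
the squares. -/
def lift {G : Type*} [Group G] (f : List α → P.rels → List α → G)
    (hf : ∀ a b c r s, f a r (b ++ s.1.1 ++ c) * f (a ++ r.1.2 ++ b) s c =
      f (a ++ r.1.1 ++ b) s c * f a r (b ++ s.1.2 ++ c)) : P.PathGroup →* G :=
  PresentedGroup.toGroup (f := fun x => f x.1 x.2.1 x.2.2) (by
    rintro g ⟨a, b, c, r, s, rfl⟩
    simp only [map_mul, map_inv, FreeGroup.lift_apply_of]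
    rw [mul_inv_eq_one, mul_inv_eq_iff_eq_mul]
    exact hf a b c r s)

@[simp] lemma lift_edge {G : Type*} [Group G] (f : List α → P.rels → List α → G)
    (hf : ∀ a b c r s, f a r (b ++ s.1.1 ++ c) * f (a ++ r.1.2 ++ b) s c =
      f (a ++ r.1.1 ++ b) s c * f a r (b ++ s.1.2 ++ c)) (a : List α) (r : P.rels) (b : List α) :
    lift f hf (edge a r b) = f a r b :=
  PresentedGroup.toGroup.of _

end PathGroup

open PathGroup SignedEdge

namespace SignedEdge

/-- The element of the path group given by crossing an edge. -/
def val (e : P.SignedEdge) : P.PathGroup :=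
  cond e.dir (edge e.left e.rel e.right) (edge e.left e.rel e.right)⁻¹

@[simp] lemma val_inv (e : P.SignedEdge) : e.inv.val = e.val⁻¹ := by
  rcases e with ⟨l, r, _ | _, m⟩ <;> simp [val]

lemma val_square {e f : P.SignedEdge} {k : List α} (h : LeftOf e f k) :
    e.val * f.val = (slideLeft e f k).val * (slideRight e f k).val := by
  obtain ⟨l, s, d, c⟩ := e
  obtain ⟨a, r, d', m⟩ := f
  obtain ⟨h1, h2⟩ := h
  simp only [src, tgt] at h1 h2
  subst h1 h2
  have key := edge_square a k c r s
  rcases d with _ | _ <;> rcases d' with _ | _ <;>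
    simp only [val, src, tgt, slideLeft, slideRight, cond_true, cond_false]
  · rw [← mul_inv_rev, ← mul_inv_rev, key]
  · rw [inv_mul_eq_iff_eq_mul, ← mul_assoc, eq_mul_inv_iff_mul_eq, key]
  · rw [mul_inv_eq_iff_eq_mul, mul_assoc, eq_inv_mul_iff_mul_eq, key]
  · exact key.symm

/-- The element of the path group given by a path, which is stored with its last edge first. -/
def eval : List P.SignedEdge → P.PathGroup
  | [] => 1
  | e :: s => eval s * e.val

@[simp] lemma eval_nil : eval ([] : List P.SignedEdge) = 1 := rfl
@[simp] lemma eval_cons (e : P.SignedEdge) (s : List P.SignedEdge) :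
    eval (e :: s) = eval s * e.val := rfl

@[simp] lemma eval_append (s t : List P.SignedEdge) : eval (s ++ t) = eval t * eval s := by
  induction s with
  | nil => simp
  | cons e s ih => simp [ih, mul_assoc]

lemma eval_reverse_inv (s : List P.SignedEdge) :
    eval (s.map inv).reverse = (eval s)⁻¹ := by
  induction s with
  | nil => simp
  | cons e s ih => simp [ih]

lemma eval_push (s : List P.SignedEdge) (f : P.SignedEdge) :
    eval (push s f) = eval s * f.val := by
  induction s generalizing f with
  | nil => simp
  | cons e s ih =>
    rcases trichotomy e f with h | ⟨k, h⟩ | h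
    · subst h; rw [push_cancel]; simp
    · rw [push_leftOf h, eval_cons, ih, eval_cons, mul_assoc, mul_assoc, val_square h]
    · rw [push_admissible h]; rfl

/-- Appending the inverse of an edge to the normal forms, as a permutation of all normal forms. -/
noncomputable def pushPerm (f : P.SignedEdge) :
    Equiv.Perm {s : List P.SignedEdge // Normal s} where
  toFun s := ⟨push s.1 f.inv, normal_push s.2 _⟩
  invFun s := ⟨push s.1 f, normal_push s.2 _⟩
  left_inv s := Subtype.ext (by simpa using push_push_inv s.2 f.inv)
  right_inv s := Subtype.ext (push_push_inv s.2 f)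

/-- The action of the path group on the normal forms. -/
noncomputable def normalAction : P.PathGroup →* Equiv.Perm {s : List P.SignedEdge // Normal s} :=
  PathGroup.lift (fun a r b => pushPerm ⟨a, r, true, b⟩) (by
    intro a b c r s
    ext1 ⟨t, ht⟩
    apply Subtype.ext
    have h : LeftOf (inv ⟨a ++ r.1.2 ++ b, s, true, c⟩) (inv ⟨a, r, true, b ++ s.1.1 ++ c⟩) b :=
      ⟨by simp [src], by simp [tgt]⟩
    have := push_square ht h
    simpa [pushPerm, slideLeft, slideRight, inv, src, tgt] using this)

lemma normalAction_val_inv (e : P.SignedEdge) (s : {s : List P.SignedEdge // Normal s}) :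
    (normalAction e.val⁻¹ s).1 = push s.1 e := by
  rcases e with ⟨l, r, _ | _, m⟩
  · simp only [val, cond_false, normalAction, lift_edge, _root_.inv_inv]
    rfl
  · simp only [val, cond_true, map_inv, normalAction, lift_edge]
    rfl

/-- The normal form of an element of the path group. -/
noncomputable def nf (g : P.PathGroup) : List P.SignedEdge :=
  (normalAction g⁻¹ ⟨[], List.IsChain.nil⟩).1

lemma normal_nf (g : P.PathGroup) : Normal (nf g) := (normalAction g⁻¹ ⟨[], List.IsChain.nil⟩).2

@[simp] lemma nf_one : nf (1 : P.PathGroup) = [] := by simp [nf]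

lemma nf_mul_val (g : P.PathGroup) (e : P.SignedEdge) : nf (g * e.val) = push (nf g) e := by
  rw [nf, mul_inv_rev, map_mul, Equiv.Perm.mul_apply, normalAction_val_inv]
  rfl

lemma nf_eval_of_normal {s : List P.SignedEdge} (hs : Normal s) : nf (eval s) = s := by
  induction s with
  | nil => simp
  | cons e s ih => rw [eval_cons, nf_mul_val, ih hs.tail, push_of_normal hs]

lemma exists_eval_eq (g : P.PathGroup) : ∃ s : List P.SignedEdge, eval s = g := by
  induction g using PathGroup.induction with
  | one => exact ⟨[], rfl⟩
  | edge a r b => exact ⟨[⟨a, r, true, b⟩], by simp [val]⟩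
  | mul x y hx hy =>
    obtain ⟨s, rfl⟩ := hx
    obtain ⟨t, rfl⟩ := hy
    exact ⟨t ++ s, by simp⟩
  | inv x hx =>
    obtain ⟨s, rfl⟩ := hx
    exact ⟨_, eval_reverse_inv s⟩

lemma eval_nf_eval (s : List P.SignedEdge) : eval (nf (eval s)) = eval s := by
  induction s with
  | nil => simp
  | cons e s ih => rw [eval_cons, nf_mul_val, eval_push, ih]

@[simp] lemma eval_nf (g : P.PathGroup) : eval (nf g) = g := by
  obtain ⟨s, rfl⟩ := exists_eval_eq g
  exact eval_nf_eval s

lemma push_length_le (s : List P.SignedEdge) (f : P.SignedEdge) :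
    (push s f).length ≤ s.length + 1 := by
  induction s generalizing f with
  | nil => simp
  | cons e s ih =>
    rcases trichotomy e f with h | ⟨k, h⟩ | h
    · subst h; rw [push_cancel]; simp; omega
    · rw [push_leftOf h]; simpa using ih _
    · rw [push_admissible h]; rfl

lemma length_nf_eval_le (s : List P.SignedEdge) : (nf (eval s)).length ≤ s.length := by
  induction s with
  | nil => simp
  | cons e s ih =>
    rw [eval_cons, nf_mul_val]
    exact (push_length_le _ _).trans (by simpa using ih)

/-! ### Paths between words -/

/-- The list `s` of edges, with the last edge first, is a path from the word `a`. -/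
def IsPath (a : List α) : List P.SignedEdge → List α → Prop
  | [], b => a = b
  | e :: s, b => b = e.left ++ e.tgt ++ e.right ∧ IsPath a s (e.left ++ e.src ++ e.right)

lemma IsPath.append {a b c : List α} {s t : List P.SignedEdge} (ht : IsPath a t b)
    (hs : IsPath b s c) : IsPath a (s ++ t) c := by
  induction s generalizing c with
  | nil => cases hs; exact ht
  | cons e s ih => exact ⟨hs.1, ih hs.2⟩

lemma isPath_append_iff {a c : List α} {s t : List P.SignedEdge} :
    IsPath a (s ++ t) c ↔ ∃ b, IsPath a t b ∧ IsPath b s c := by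
  constructor
  · intro h
    induction s generalizing c with
    | nil => exact ⟨c, h, rfl⟩
    | cons e s ih =>
      obtain ⟨b, h1, h2⟩ := ih h.2
      exact ⟨b, h1, h.1, h2⟩
  · rintro ⟨b, h1, h2⟩
    exact h1.append h2

lemma isPath_singleton (e : P.SignedEdge) :
    IsPath (e.left ++ e.src ++ e.right) [e] (e.left ++ e.tgt ++ e.right) :=
  ⟨rfl, rfl⟩

lemma IsPath.inv {a b : List α} {s : List P.SignedEdge} (hs : IsPath a s b) :
    IsPath b (s.map SignedEdge.inv).reverse a := by
  induction s generalizing b with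
  | nil => exact Eq.symm hs
  | cons e s ih =>
    obtain ⟨rfl, h⟩ := hs
    rw [List.map_cons, List.reverse_cons]
    refine IsPath.append ?_ (ih h)
    have := isPath_singleton e.inv
    simpa using this

lemma IsPath.push {a : List α} {s : List P.SignedEdge} {f : P.SignedEdge}
    (hs : IsPath a s (f.left ++ f.src ++ f.right)) :
    IsPath a (push s f) (f.left ++ f.tgt ++ f.right) := by
  induction s generalizing f with
  | nil => exact ⟨rfl, hs⟩
  | cons e s ih =>
    rcases trichotomy e f with h | ⟨k, h⟩ | h
    · subst h; rw [push_cancel]; simpa using hs.2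
    · rw [push_leftOf h]
      refine ⟨by simp [h.2], ?_⟩
      have h1 : IsPath a s ((slideLeft e f k).left ++ (slideLeft e f k).src ++
          (slideLeft e f k).right) := by
        have := hs.2
        simp only [h.1] at this
        simpa using this
      simpa using ih h1
    · rw [push_admissible h]; exact ⟨rfl, hs⟩

lemma IsPath.nf_eval {a b : List α} {s : List P.SignedEdge} (hs : IsPath a s b) :
    IsPath a (nf (eval s)) b := by
  induction s generalizing b with
  | nil => simpa using hs
  | cons e s ih =>
    obtain ⟨rfl, h⟩ := hs
    rw [eval_cons, nf_mul_val]
    exact (ih h).push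

end SignedEdge

/-- The elements of the path group that are represented by paths from `a` to `b`. -/
def Hom (P : SemigroupPresentation α) (a b : List α) : Set P.PathGroup :=
  {g | ∃ s, IsPath a s b ∧ eval s = g}

namespace Hom

lemma isPath_nf {a b : List α} {g : P.PathGroup} (h : g ∈ P.Hom a b) : IsPath a (nf g) b := by
  obtain ⟨s, hs, rfl⟩ := h
  exact hs.nf_eval

lemma one (a : List α) : (1 : P.PathGroup) ∈ P.Hom a a := ⟨[], rfl, rfl⟩

lemma mul {a b c : List α} {g h : P.PathGroup} (hg : g ∈ P.Hom a b) (hh : h ∈ P.Hom b c) :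
    g * h ∈ P.Hom a c := by
  obtain ⟨s, hs, rfl⟩ := hg
  obtain ⟨t, ht, rfl⟩ := hh
  exact ⟨t ++ s, hs.append ht, by simp⟩

lemma inv {a b : List α} {g : P.PathGroup} (hg : g ∈ P.Hom a b) : g⁻¹ ∈ P.Hom b a := by
  obtain ⟨s, hs, rfl⟩ := hg
  exact ⟨_, hs.inv, eval_reverse_inv s⟩

lemma val (e : P.SignedEdge) :
    e.val ∈ P.Hom (e.left ++ e.src ++ e.right) (e.left ++ e.tgt ++ e.right) :=
  ⟨[e], isPath_singleton e, by simp⟩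

lemma eq_of_one {a b : List α} (h : (1 : P.PathGroup) ∈ P.Hom a b) : a = b := by
  have := isPath_nf h
  rwa [nf_one] at this

end Hom

/-- The closed paths at `a`, as a subgroup of the path group. -/
def loops (P : SemigroupPresentation α) (a : List α) : Subgroup P.PathGroup where
  carrier := P.Hom a a
  one_mem' := Hom.one a
  mul_mem' := Hom.mul
  inv_mem' := Hom.inv

lemma mem_loops {a : List α} {g : P.PathGroup} : g ∈ P.loops a ↔ g ∈ P.Hom a a := Iff.rfl

/-! ### Whiskering -/

/-- The endomorphism of the path group that sends a path `A` to the path `x + A + y`, which applies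
the same relations between longer words. -/
def whisker (x y : List α) : P.PathGroup →* P.PathGroup :=
  PathGroup.lift (fun a r b => edge (x ++ a) r (b ++ y)) (by
    intro a b c r s
    have := edge_square (x ++ a) b (c ++ y) r s
    simpa using this)

@[simp] lemma whisker_edge (x y a b : List α) (r : P.rels) :
    whisker x y (edge a r b) = edge (x ++ a) r (b ++ y) := by
  simp [whisker]

@[simp] lemma whisker_val (x y : List α) (e : P.SignedEdge) :
    whisker x y e.val = (e.whisker x y).val := by
  rcases e with ⟨l, r, _ | _, m⟩ <;> simp [val, SignedEdge.whisker]

lemma whisker_eval (x y : List α) (s : List P.SignedEdge) :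
    whisker x y (eval s) = eval (s.map (SignedEdge.whisker x y)) := by
  induction s with
  | nil => simp
  | cons e s ih => simp [ih]

lemma whisker_whisker (x y x' y' : List α) (g : P.PathGroup) :
    whisker x y (whisker x' y' g) = whisker (x ++ x') (y' ++ y) g := by
  induction g using PathGroup.induction with
  | one => simp
  | edge a r b => simp
  | mul g h hg hh => simp [hg, hh]
  | inv g hg => simp [hg]

@[simp] lemma whisker_nil_nil (g : P.PathGroup) : whisker [] [] g = g := by
  induction g using PathGroup.induction with
  | one => simp
  | edge a r b => simp
  | mul g h hg hh => simp [hg, hh]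
  | inv g hg => simp [hg]

lemma Hom.whisker {a b : List α} {g : P.PathGroup} (hg : g ∈ P.Hom a b) (x y : List α) :
    whisker x y g ∈ P.Hom (x ++ a ++ y) (x ++ b ++ y) := by
  obtain ⟨s, hs, rfl⟩ := hg
  refine ⟨_, ?_, (whisker_eval x y s).symm⟩
  induction s generalizing b with
  | nil => cases hs; rfl
  | cons e s ih =>
    obtain ⟨rfl, h⟩ := hs
    refine ⟨by simp, ?_⟩
    simpa using ih h

lemma Hom.whisker_left {a b : List α} {g : P.PathGroup} (hg : g ∈ P.Hom a b) (x : List α) :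
    SemigroupPresentation.whisker x [] g ∈ P.Hom (x ++ a) (x ++ b) := by
  simpa using Hom.whisker hg x []

lemma Hom.whisker_right {a b : List α} {g : P.PathGroup} (hg : g ∈ P.Hom a b) (y : List α) :
    SemigroupPresentation.whisker [] y g ∈ P.Hom (a ++ y) (b ++ y) := by
  simpa using Hom.whisker hg [] y

/-- Paths that are applied to disjoint subwords commute. -/
lemma interchange {a a' b b' : List α} {A B : P.PathGroup} (hA : A ∈ P.Hom a a')
    (hB : B ∈ P.Hom b b') :
    whisker [] b A * whisker a' [] B = whisker a [] B * whisker [] b' A := by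
  obtain ⟨s, hs, rfl⟩ := hA
  obtain ⟨t, ht, rfl⟩ := hB
  induction s generalizing a' with
  | nil => cases hs; simp
  | cons e s ih =>
    obtain ⟨rfl, hs⟩ := hs
    have key : whisker [] b e.val * whisker (e.left ++ e.tgt ++ e.right) [] (eval t) =
        whisker (e.left ++ e.src ++ e.right) [] (eval t) * whisker [] b' e.val := by
      clear ih hs
      induction t generalizing b' with
      | nil => cases ht; simp
      | cons f t ih =>
        obtain ⟨rfl, ht⟩ := ht
        have h : LeftOf (f.whisker (e.left ++ e.src ++ e.right) [])
            (e.whisker [] (f.left ++ f.tgt ++ f.right)) (e.right ++ f.left) :=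
          ⟨by simp, by simp⟩
        have h1 := val_square h
        have e1 : slideLeft (f.whisker (e.left ++ e.src ++ e.right) [])
            (e.whisker [] (f.left ++ f.tgt ++ f.right)) (e.right ++ f.left) =
            e.whisker [] (f.left ++ f.src ++ f.right) := by
          ext1 <;> simp
        have e2 : slideRight (f.whisker (e.left ++ e.src ++ e.right) [])
            (e.whisker [] (f.left ++ f.tgt ++ f.right)) (e.right ++ f.left) =
            f.whisker (e.left ++ e.tgt ++ e.right) [] := by
          ext1 <;> simp
        rw [e1, e2] at h1
        rw [eval_cons, map_mul, ← mul_assoc, ih ht, map_mul, mul_assoc, mul_assoc,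
          whisker_val, whisker_val, whisker_val, whisker_val, h1]
    rw [eval_cons, map_mul, mul_assoc, key, ← mul_assoc, ih hs, mul_assoc, map_mul]

lemma leftOf_whisker_iff {x y : List α} {e f : P.SignedEdge} {k : List α} :
    LeftOf (e.whisker x y) (f.whisker x y) k ↔ LeftOf e f k := by
  unfold LeftOf
  rw [whisker_left, whisker_left, whisker_right, whisker_right, whisker_src, whisker_tgt,
    show x ++ f.left ++ f.src ++ k = x ++ (f.left ++ f.src ++ k) by simp,
    show k ++ e.tgt ++ (e.right ++ y) = k ++ e.tgt ++ e.right ++ y by simp,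
    List.append_cancel_left_eq, List.append_cancel_right_eq]

lemma SignedEdge.Normal.whisker {s : List P.SignedEdge} (hs : Normal s) (x y : List α) :
    Normal (s.map (SignedEdge.whisker x y)) := by
  refine (List.isChain_map _).2 (List.IsChain.imp ?_ hs)
  rintro e g ⟨h1, h2⟩
  refine ⟨fun ⟨k, hk⟩ => h1 ⟨k, leftOf_whisker_iff.1 hk⟩, fun h => h2 ?_⟩
  ext1
  · simpa using congrArg SignedEdge.left h
  · simpa using congrArg SignedEdge.rel h
  · simpa using congrArg SignedEdge.dir h
  · simpa using congrArg SignedEdge.right h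

lemma nf_whisker (x y : List α) (g : P.PathGroup) :
    nf (whisker x y g) = (nf g).map (SignedEdge.whisker x y) := by
  conv_lhs => rw [← eval_nf g]
  rw [whisker_eval, nf_eval_of_normal ((normal_nf g).whisker x y)]

lemma whisker_eq_one {x y : List α} {g : P.PathGroup} (h : whisker x y g = 1) : g = 1 := by
  have := nf_whisker x y g
  rw [h, nf_one, eq_comm, List.map_eq_nil_iff] at this
  rw [← eval_nf g, this, eval_nil]

lemma whisker_injective (x y : List α) :
    Function.Injective (whisker x y : P.PathGroup →* P.PathGroup) :=
  (injective_iff_map_eq_one _).2 fun _ => whisker_eq_one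

/-- The normal form of a path of the form `A + u + B` is the normal form of `A` followed by the
normal form of `B`. -/
lemma nf_whisker_mul_whisker {a a' : List α} {A : P.PathGroup} (hA : A ∈ P.Hom a a')
    (z u : List α) (B : P.PathGroup) :
    nf (whisker [] z A * whisker (a' ++ u) [] B) =
      (nf B).map (SignedEdge.whisker (a' ++ u) []) ++ (nf A).map (SignedEdge.whisker [] z) := by
  conv_lhs => rw [← eval_nf A, ← eval_nf B]
  rw [whisker_eval, whisker_eval, ← eval_append, nf_eval_of_normal]
  refine List.isChain_append.2 ⟨(normal_nf B).whisker _ _, (normal_nf A).whisker _ _, ?_⟩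
  intro e he g hg
  have hA' := Hom.isPath_nf hA
  rw [List.head?_map] at hg
  rw [List.getLast?_map] at he
  cases h : nf A with
  | nil => simp [h] at hg
  | cons g' s =>
    rw [h] at hA' hg
    simp only [List.head?_cons, Option.map_some, Option.mem_some_iff] at hg
    obtain ⟨e', -, rfl⟩ := Option.mem_map.1 he
    subst hg
    obtain ⟨rfl, -⟩ := hA'
    have h1 := g'.tgt_length_pos
    constructor
    · rintro ⟨k, hk, -⟩
      have := congrArg List.length hk
      simp only [whisker_left, whisker_src, List.length_append, List.length_nil] at this
      omega
    · intro h
      have := congrArg (fun e => List.length (SignedEdge.left e)) h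
      simp only [whisker_left, inv_left, List.length_append, List.length_nil] at this
      omega

/-- A path of the form `A + u + B`, where `A` starts at `a`, which can also be written as a path
that does not touch the prefix `a`, has a trivial component `A`. -/
lemma eq_one_of_whisker_mul_whisker {a a' z u : List α} {A B y : P.PathGroup}
    (hA : A ∈ P.Hom a a')
    (h : whisker [] z A * whisker (a' ++ u) [] B = whisker a [] y) : A = 1 := by
  have h1 := congrArg nf h
  rw [nf_whisker_mul_whisker hA, nf_whisker] at h1
  have hA' := Hom.isPath_nf hA
  rcases List.eq_nil_or_concat (nf A) with h2 | ⟨s, e, h2⟩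
  · rw [← eval_nf A, h2, eval_nil]
  · exfalso
    rw [List.concat_eq_append] at h2
    rw [h2, isPath_append_iff] at hA'
    obtain ⟨b, ⟨-, hb⟩, -⟩ := hA'
    have h3 : e.whisker [] z ∈ (nf y).map (SignedEdge.whisker a []) := by
      rw [← h1, h2]; simp
    obtain ⟨e', -, h4⟩ := List.mem_map.1 h3
    have h5 := congrArg (fun e => List.length (SignedEdge.left e)) h4
    have h6 : a = _ := hb
    have h7 := congrArg List.length h6
    have := e.src_length_pos
    simp only [whisker_left, List.length_append, List.length_nil] at h5 h7
    omega

end PathGroup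

/-! ### Hyperplanes -/

section Hyperplane

variable {α : Type v} {P : SemigroupPresentation α}

open PathGroup SignedEdge

/-- The path `A + u + B` from `aub` to `a'ub'`, where `A` is a path from `a` to `a'` and `B` is a
path from `b` to `b'`. -/
def sandwich (a' u b : List α) (A B : P.PathGroup) : P.PathGroup :=
  whisker [] (u ++ b) A * whisker (a' ++ u) [] B

@[simp] lemma sandwich_one (a u b : List α) : sandwich a u b (1 : P.PathGroup) 1 = 1 := by
  simp [sandwich]

lemma sandwich_mul {a' a'' b b' b'' : List α} {A A' B B' : P.PathGroup}
    (hA' : A' ∈ P.Hom a' a'') (hB : B ∈ P.Hom b b') (u : List α) (_ : B' ∈ P.Hom b' b'') :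
    sandwich a' u b A B * sandwich a'' u b' A' B' = sandwich a'' u b (A * A') (B * B') := by
  have h := interchange hA' (Hom.whisker_left hB u)
  simp only [whisker_whisker, List.append_nil] at h
  simp only [sandwich, map_mul, mul_assoc]
  rw [← mul_assoc (whisker (a' ++ u) [] B), ← h, mul_assoc]

lemma sandwich_inv {a a' b b' : List α} {A B : P.PathGroup} (hA : A ∈ P.Hom a a')
    (hB : B ∈ P.Hom b b') (u : List α) :
    (sandwich a' u b A B)⁻¹ = sandwich a u b' A⁻¹ B⁻¹ := by
  rw [inv_eq_iff_mul_eq_one, sandwich_mul (Hom.inv hA) hB u (Hom.inv hB)]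
  simp

variable (P) in
/-- Two edges of the universal cover of the Squier complex, each given by a path `g` to its source
`aub` and by the edge `[a, r, b]`, are parallel if a path of the form `A + u + B` leads from one
source to the other. -/
def parallelSetoid : Setoid (P.PathGroup × List α × P.rels × List α) where
  r p q := p.2.2.1 = q.2.2.1 ∧ ∃ A ∈ P.Hom p.2.1 q.2.1, ∃ B ∈ P.Hom p.2.2.2 q.2.2.2,
    q.1 = p.1 * sandwich q.2.1 p.2.2.1.1.1 p.2.2.2 A B
  iseqv := by
    refine ⟨fun p => ⟨rfl, 1, Hom.one _, 1, Hom.one _, by simp⟩, ?_, ?_⟩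
    · rintro ⟨g, a, r, b⟩ ⟨g', a', r', b'⟩ ⟨h, A, hA, B, hB, h'⟩
      simp only at *
      subst h
      refine ⟨rfl, A⁻¹, Hom.inv hA, B⁻¹, Hom.inv hB, ?_⟩
      rw [← sandwich_inv hA hB, h', mul_inv_cancel_right]
    · rintro ⟨g, a, r, b⟩ ⟨g', a', r', b'⟩ ⟨g'', a'', r'', b''⟩ ⟨h, A, hA, B, hB, h'⟩
        ⟨h2, A2, hA2, B2, hB2, h2'⟩
      simp only at *
      subst h h2
      refine ⟨rfl, A * A2, Hom.mul hA hA2, B * B2, Hom.mul hB hB2, ?_⟩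
      rw [← sandwich_mul hA2 hB _ hB2, h2', h', mul_assoc]

variable (P) in
/-- The hyperplanes of the universal cover of the Squier complex, as classes of parallel edges. -/
def Hyperplane : Type v := Quotient P.parallelSetoid

namespace Hyperplane

/-- The hyperplane that is dual to the edge `[a, r, b]` at the end of the path `g`. -/
def mk (g : P.PathGroup) (a : List α) (r : P.rels) (b : List α) : P.Hyperplane :=
  Quotient.mk P.parallelSetoid (g, a, r, b)

lemma exists_rep (J : P.Hyperplane) : ∃ g a r b, J = mk g a r b := by
  induction J using Quotient.ind with
  | _ p => exact ⟨p.1, p.2.1, p.2.2.1, p.2.2.2, rfl⟩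

lemma mk_eq_mk_iff {g g' : P.PathGroup} {a a' b b' : List α} {r r' : P.rels} :
    mk g a r b = mk g' a' r' b' ↔ r = r' ∧ ∃ A ∈ P.Hom a a', ∃ B ∈ P.Hom b b',
      g' = g * sandwich a' r.1.1 b A B :=
  Quotient.eq (r := P.parallelSetoid)

instance : MulAction P.PathGroup P.Hyperplane where
  smul h := Quotient.map (fun p => (h * p.1, p.2)) (by
    rintro p q ⟨h1, A, hA, B, hB, h2⟩
    exact ⟨h1, A, hA, B, hB, by simp [h2, mul_assoc]⟩)
  one_smul J := by
    induction J using Quotient.ind with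
    | _ p => exact congrArg (Quotient.mk _) (Prod.ext (one_mul _) rfl)
  mul_smul g h J := by
    induction J using Quotient.ind with
    | _ p => exact congrArg (Quotient.mk _) (Prod.ext (mul_assoc _ _ _) rfl)

@[simp] lemma smul_mk (h g : P.PathGroup) (a : List α) (r : P.rels) (b : List α) :
    h • mk g a r b = mk (h * g) a r b := rfl

/-- The elements `h` that fix a hyperplane by moving only the subwords to its left: those of the
form `g (A + ub) g⁻¹` if the hyperplane is dual to the edge `[a, u = v, b]` at the end of `g`. -/
def leftStab (J : P.Hyperplane) : Subgroup P.PathGroup where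
  carrier := {h | ∀ g a r b, J = mk g a r b →
    ∃ A ∈ P.Hom a a, h = g * whisker [] (r.1.1 ++ b) A * g⁻¹}
  one_mem' := fun g a r b _ => ⟨1, Hom.one a, by simp⟩
  mul_mem' := fun {x y} hx hy g a r b h => by
    obtain ⟨A, hA, rfl⟩ := hx g a r b h
    obtain ⟨B, hB, rfl⟩ := hy g a r b h
    exact ⟨A * B, Hom.mul hA hB, by simp [mul_assoc]⟩
  inv_mem' := fun {x} hx g a r b h => by
    obtain ⟨A, hA, rfl⟩ := hx g a r b h
    exact ⟨A⁻¹, Hom.inv hA, by simp [mul_assoc]⟩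

/-- The elements that fix a hyperplane by moving only the subwords to its right. -/
def rightStab (J : P.Hyperplane) : Subgroup P.PathGroup where
  carrier := {h | ∀ g a r b, J = mk g a r b →
    ∃ B ∈ P.Hom b b, h = g * whisker (a ++ r.1.1) [] B * g⁻¹}
  one_mem' := fun g a r b _ => ⟨1, Hom.one b, by simp⟩
  mul_mem' := fun {x y} hx hy g a r b h => by
    obtain ⟨A, hA, rfl⟩ := hx g a r b h
    obtain ⟨B, hB, rfl⟩ := hy g a r b h
    exact ⟨A * B, Hom.mul hA hB, by simp [mul_assoc]⟩
  inv_mem' := fun {x} hx g a r b h => by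
    obtain ⟨A, hA, rfl⟩ := hx g a r b h
    exact ⟨A⁻¹, Hom.inv hA, by simp [mul_assoc]⟩

lemma mem_leftStab_mk {g : P.PathGroup} {a : List α} {r : P.rels} {b : List α}
    {h : P.PathGroup} :
    h ∈ leftStab (mk g a r b) ↔ ∃ A ∈ P.Hom a a, h = g * whisker [] (r.1.1 ++ b) A * g⁻¹ := by
  refine ⟨fun H => H g a r b rfl, ?_⟩
  rintro ⟨A, hA, rfl⟩ g' a' r' b' h
  obtain ⟨rfl, C, hC, B, hB, rfl⟩ := mk_eq_mk_iff.1 h.symm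
  refine ⟨C * A * C⁻¹, Hom.mul (Hom.mul hC hA) (Hom.inv hC), ?_⟩
  have h1 : whisker [] (r'.1.1 ++ b) A = sandwich a r'.1.1 b A 1 := by simp [sandwich]
  have h2 : whisker [] (r'.1.1 ++ b') (C * A * C⁻¹) =
      sandwich a' r'.1.1 b' (C * A * C⁻¹) (B * 1 * B⁻¹) := by simp [sandwich]
  rw [h2, ← sandwich_mul (Hom.inv hC) (Hom.mul hB (Hom.one b)) _ (Hom.inv hB),
    ← sandwich_mul hA hB _ (Hom.one b), ← sandwich_inv hC hB, h1]
  simp [mul_assoc]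

lemma mem_rightStab_mk {g : P.PathGroup} {a : List α} {r : P.rels} {b : List α}
    {h : P.PathGroup} :
    h ∈ rightStab (mk g a r b) ↔ ∃ B ∈ P.Hom b b, h = g * whisker (a ++ r.1.1) [] B * g⁻¹ := by
  refine ⟨fun H => H g a r b rfl, ?_⟩
  rintro ⟨A, hA, rfl⟩ g' a' r' b' h
  obtain ⟨rfl, C, hC, B, hB, rfl⟩ := mk_eq_mk_iff.1 h.symm
  refine ⟨B * A * B⁻¹, Hom.mul (Hom.mul hB hA) (Hom.inv hB), ?_⟩
  have h1 : whisker (a ++ r'.1.1) [] A = sandwich a r'.1.1 b 1 A := by simp [sandwich]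
  have h2 : whisker (a' ++ r'.1.1) [] (B * A * B⁻¹) =
      sandwich a' r'.1.1 b' (C * 1 * C⁻¹) (B * A * B⁻¹) := by simp [sandwich]
  rw [h2, ← sandwich_mul (Hom.inv hC) (Hom.mul hB hA) _ (Hom.inv hB),
    ← sandwich_mul (Hom.one a) hB _ hA, ← sandwich_inv hC hB, h1]
  simp [mul_assoc]

lemma commute_of_mem {J : P.Hyperplane} {l r : P.PathGroup} (hl : l ∈ leftStab J)
    (hr : r ∈ rightStab J) : Commute l r := by
  obtain ⟨g, a, s, b, rfl⟩ := exists_rep J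
  obtain ⟨A, hA, rfl⟩ := mem_leftStab_mk.1 hl
  obtain ⟨B, hB, rfl⟩ := mem_rightStab_mk.1 hr
  have h := interchange hA (Hom.whisker_left hB s.1.1)
  simp only [whisker_whisker, List.append_nil] at h
  change _ * _ = _ * _
  calc _ = g * (whisker [] (s.1.1 ++ b) A * whisker (a ++ s.1.1) [] B) * g⁻¹ := by
        simp [mul_assoc]
    _ = _ := by rw [h]; simp [mul_assoc]

lemma smul_eq_self_iff {J : P.Hyperplane} {h : P.PathGroup} :
    h • J = J ↔ ∃ l ∈ leftStab J, ∃ r ∈ rightStab J, h = l * r := by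
  obtain ⟨g, a, s, b, rfl⟩ := exists_rep J
  rw [smul_mk, eq_comm, mk_eq_mk_iff]
  constructor
  · rintro ⟨-, A, hA, B, hB, h1⟩
    refine ⟨_, mem_leftStab_mk.2 ⟨A, hA, rfl⟩, _, mem_rightStab_mk.2 ⟨B, hB, rfl⟩, ?_⟩
    rw [eq_mul_inv_of_mul_eq h1, sandwich]
    simp [mul_assoc]
  · rintro ⟨l, hl, r, hr, rfl⟩
    obtain ⟨A, hA, rfl⟩ := mem_leftStab_mk.1 hl
    obtain ⟨B, hB, rfl⟩ := mem_rightStab_mk.1 hr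
    exact ⟨rfl, A, hA, B, hB, by simp [sandwich, mul_assoc]⟩

/-- Two hyperplanes cross in a square in which the edge of the first one is on the left. -/
def Precedes (J K : P.Hyperplane) : Prop :=
  ∃ (g : P.PathGroup) (a b c : List α) (r s : P.rels),
    J = mk g a r (b ++ s.1.1 ++ c) ∧ K = mk g (a ++ r.1.1 ++ b) s c

/-- No hyperplane crosses itself. -/
lemma not_precedes_self (J : P.Hyperplane) : ¬ Precedes J J := by
  rintro ⟨g, a, b, c, r, s, h1, h2⟩
  obtain ⟨rfl, A, hA, B, hB, h⟩ := mk_eq_mk_iff.1 (h1.symm.trans h2)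
  have h3 : sandwich (a ++ r.1.1 ++ b) r.1.1 (b ++ r.1.1 ++ c) A B = whisker a [] 1 := by
    rw [map_one]
    simpa using h
  rw [eq_one_of_whisker_mul_whisker hA h3] at hA
  have h4 := Hom.eq_of_one hA
  simp only [List.append_assoc, List.self_eq_append_right, List.append_eq_nil_iff] at h4
  exact P.left_ne_nil _ r.2 h4.1

lemma Precedes.leftStab_le {J K : P.Hyperplane} (h : Precedes J K) :
    leftStab J ≤ leftStab K := by
  obtain ⟨g, a, b, c, r, s, rfl, rfl⟩ := h
  intro x hx
  obtain ⟨A, hA, rfl⟩ := mem_leftStab_mk.1 hx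
  refine mem_leftStab_mk.2 ⟨whisker [] (r.1.1 ++ b) A, ?_, ?_⟩
  · simpa using Hom.whisker_right hA (r.1.1 ++ b)
  · simp [whisker_whisker]

lemma Precedes.rightStab_le {J K : P.Hyperplane} (h : Precedes J K) :
    rightStab K ≤ rightStab J := by
  obtain ⟨g, a, b, c, r, s, rfl, rfl⟩ := h
  intro x hx
  obtain ⟨A, hA, rfl⟩ := mem_rightStab_mk.1 hx
  refine mem_rightStab_mk.2 ⟨whisker (b ++ s.1.1) [] A, ?_, ?_⟩
  · simpa using Hom.whisker_left hA (b ++ s.1.1)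
  · simp [whisker_whisker]

/-- The hyperplane crossed by the edge `e` at the end of the path `g`. -/
def ofEdge (g : P.PathGroup) (e : P.SignedEdge) : P.Hyperplane :=
  mk (cond e.dir g (g * e.val)) e.left e.rel e.right

@[simp] lemma smul_ofEdge (h g : P.PathGroup) (e : P.SignedEdge) :
    h • ofEdge g e = ofEdge (h * g) e := by
  rcases e with ⟨l, r, _ | _, m⟩ <;> simp [ofEdge, mul_assoc]

lemma mk_eq_mk_left {g A : P.PathGroup} {a a' : List α} (hA : A ∈ P.Hom a a') (r : P.rels)
    (b : List α) : mk g a r b = mk (g * whisker [] (r.1.1 ++ b) A) a' r b :=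
  mk_eq_mk_iff.2 ⟨rfl, A, hA, 1, Hom.one b, by simp [sandwich]⟩

lemma mk_eq_mk_right {g B : P.PathGroup} {b b' : List α} (hB : B ∈ P.Hom b b') (r : P.rels)
    (a : List α) : mk g a r b = mk (g * whisker (a ++ r.1.1) [] B) a r b' :=
  mk_eq_mk_iff.2 ⟨rfl, 1, Hom.one a, B, hB, by simp [sandwich]⟩

lemma ofEdge_precedes (g : P.PathGroup) (e : P.SignedEdge) (r : P.rels) (b : List α) :
    Precedes (ofEdge g (e.whisker [] (r.1.1 ++ b))) (mk g (e.left ++ e.src ++ e.right) r b) := by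
  rcases e with ⟨l, s, _ | _, m⟩
  · refine ⟨g * (SignedEdge.whisker [] (r.1.1 ++ b) ⟨l, s, false, m⟩).val, l, m, b, s, r,
      ?_, ?_⟩
    · simp [ofEdge, SignedEdge.whisker]
    · rw [← whisker_val]
      exact mk_eq_mk_left (Hom.val _) r b
  · exact ⟨g, l, m, b, s, r, by simp [ofEdge, SignedEdge.whisker], rfl⟩

lemma precedes_ofEdge (g : P.PathGroup) (e : P.SignedEdge) (r : P.rels) (a : List α) :
    Precedes (mk g a r (e.left ++ e.src ++ e.right)) (ofEdge g (e.whisker (a ++ r.1.1) [])) := by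
  rcases e with ⟨l, s, _ | _, m⟩
  · refine ⟨g * (SignedEdge.whisker (a ++ r.1.1) [] ⟨l, s, false, m⟩).val, a, l, m, r, s,
      ?_, ?_⟩
    · rw [← whisker_val]
      exact mk_eq_mk_right (Hom.val _) r a
    · simp [ofEdge, SignedEdge.whisker]
  · exact ⟨g, a, l, m, r, s, rfl, by simp [ofEdge, SignedEdge.whisker]⟩

end Hyperplane

/-! ### Potentials and heights -/

lemma eval_induction {p : P.PathGroup → Prop} (g : P.PathGroup) (one : p 1)
    (step : ∀ h (e : P.SignedEdge), p h → p (h * e.val)) : p g := by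
  obtain ⟨s, rfl⟩ := exists_eval_eq g
  induction s with
  | nil => exact one
  | cons e s ih => exact step _ _ ih

/-- A weight of the edges of the universal cover which has zero circulation around all squares has
a potential. -/
lemma exists_potential (wt : List α → P.rels → List α → P.PathGroup → ℤ)
    (hwt : ∀ a b c r s h, wt a r (b ++ s.1.1 ++ c) h +
      wt (a ++ r.1.2 ++ b) s c (h * edge a r (b ++ s.1.1 ++ c)) =
      wt (a ++ r.1.1 ++ b) s c h + wt a r (b ++ s.1.2 ++ c) (h * edge (a ++ r.1.1 ++ b) s c)) :
    ∃ F : P.PathGroup → ℤ, F 1 = 0 ∧ ∀ h a r b, F (h * edge a r b) = F h + wt a r b h := by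
  -- The path group acts from the right on the covering `PathGroup × ℤ` defined by the weight.
  let p : List α → P.rels → List α → Equiv.Perm (P.PathGroup × ℤ) := fun a r b =>
    { toFun := fun x => (x.1 * edge a r b, x.2 + wt a r b x.1)
      invFun := fun x => (x.1 * (edge a r b)⁻¹, x.2 - wt a r b (x.1 * (edge a r b)⁻¹))
      left_inv := fun x => by simp
      right_inv := fun x => by simp }
  let φ : P.PathGroup →* (Equiv.Perm (P.PathGroup × ℤ))ᵐᵒᵖ :=
    PathGroup.lift (fun a r b => MulOpposite.op (p a r b)) (by
      intro a b c r s
      rw [← MulOpposite.op_mul, ← MulOpposite.op_mul]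
      congr 1
      ext1 x
      refine Prod.ext ?_ ?_
      · change x.1 * _ * _ = x.1 * _ * _
        rw [mul_assoc, mul_assoc, edge_square]
      · have := hwt a b c r s x.1
        change x.2 + _ + _ = x.2 + _ + _
        rw [add_assoc, add_assoc]
        exact congrArg (x.2 + ·) this)
  have h1 : ∀ g x, ((φ g).unop x).1 = x.1 * g := by
    intro g
    induction g using PathGroup.induction with
    | one => simp
    | edge a r b => intro x; simp [φ, p]
    | mul x y hx hy => intro z; simp [hx, hy, mul_assoc]
    | inv y hy =>
      intro z
      have := hy ((φ y⁻¹).unop z)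
      rw [← Equiv.Perm.mul_apply, ← MulOpposite.unop_mul, ← map_mul] at this
      simp at this
      rw [this, mul_inv_cancel_right, map_inv, MulOpposite.unop_inv]
      rfl
  refine ⟨fun g => ((φ g).unop (1, 0)).2, by simp, fun h a r b => ?_⟩
  have h2 := h1 h (1, 0)
  simp only [map_mul, MulOpposite.unop_mul, Equiv.Perm.mul_apply]
  simp only [one_mul] at h2
  have h3 : φ (edge a r b) = MulOpposite.op (p a r b) := by simp [φ]
  rw [h3]
  change _ + wt a r b _ = _
  rw [h2]

namespace Hyperplane

lemma mk_edge_left (h : P.PathGroup) (a b c : List α) (r s : P.rels) :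
    mk (h * edge a r (b ++ s.1.1 ++ c)) (a ++ r.1.2 ++ b) s c = mk h (a ++ r.1.1 ++ b) s c := by
  have := mk_eq_mk_left (g := h) (Hom.val (⟨a, r, true, b⟩ : P.SignedEdge)) s c
  simpa [val, src, tgt] using this.symm

lemma mk_edge_right (h : P.PathGroup) (a b c : List α) (r s : P.rels) :
    mk (h * edge (a ++ r.1.1 ++ b) s c) a r (b ++ s.1.2 ++ c) = mk h a r (b ++ s.1.1 ++ c) := by
  have := mk_eq_mk_right (g := h) (Hom.val (⟨b, s, true, c⟩ : P.SignedEdge)) r a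
  simpa [val, src, tgt] using this.symm

open Classical in
lemma exists_height (J : P.Hyperplane) : ∃ F : P.PathGroup → ℤ, F 1 = 0 ∧
    ∀ h a r b, F (h * edge a r b) = F h + if mk h a r b = J then 1 else 0 := by
  refine exists_potential (fun a r b h => if mk h a r b = J then 1 else 0) ?_
  intro a b c r s h
  simp only [mk_edge_left, mk_edge_right]
  exact add_comm _ _

/-- The number of times that a path from the base vertex to `g` crosses `J`, counted with
orientations. -/
noncomputable def height (J : P.Hyperplane) : P.PathGroup → ℤ := (exists_height J).choose

@[simp] lemma height_one (J : P.Hyperplane) : height J 1 = 0 := (exists_height J).choose_spec.1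

open Classical in
lemma height_mul_edge (J : P.Hyperplane) (h : P.PathGroup) (a : List α) (r : P.rels)
    (b : List α) : height J (h * edge a r b) = height J h + if mk h a r b = J then 1 else 0 :=
  (exists_height J).choose_spec.2 h a r b

/-- The orientation with which an edge is crossed. -/
def sign (e : P.SignedEdge) : ℤ := cond e.dir 1 (-1)

lemma sign_ne_zero (e : P.SignedEdge) : sign e ≠ 0 := by
  rcases e with ⟨l, r, _ | _, m⟩ <;> simp [sign]

open Classical in
lemma height_mul_val (J : P.Hyperplane) (h : P.PathGroup) (e : P.SignedEdge) :
    height J (h * e.val) = height J h + if ofEdge h e = J then sign e else 0 := by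
  rcases e with ⟨l, r, _ | _, m⟩
  · have := height_mul_edge J (h * (edge l r m)⁻¹) l r m
    rw [inv_mul_cancel_right] at this
    by_cases h' : mk (h * (edge l r m)⁻¹) l r m = J
    · rw [if_pos h'] at this
      rw [if_pos (show ofEdge h ⟨l, r, false, m⟩ = J from h'), this]
      simp [val, sign]
    · rw [if_neg h'] at this
      rw [if_neg (show ¬ ofEdge h ⟨l, r, false, m⟩ = J from h'), this]
      simp [val]
  · exact height_mul_edge J h l r m

lemma height_smul (g h : P.PathGroup) (J : P.Hyperplane) :
    height (g • J) (g * h) = height (g • J) g + height J h := by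
  induction h using eval_induction with
  | one => simp
  | step h e ih =>
    rw [← mul_assoc, height_mul_val, ih, height_mul_val, ← smul_ofEdge]
    by_cases he : ofEdge h e = J
    · rw [if_pos he, if_pos (congrArg (g • ·) he), add_assoc]
    · rw [if_neg he, if_neg fun h' => he (smul_left_cancel g h'), add_zero, add_zero]

lemma height_smul_sub (g x y : P.PathGroup) (J : P.Hyperplane) :
    height J (g * x) - height J (g * y) = height (g⁻¹ • J) x - height (g⁻¹ • J) y := by
  have h1 := height_smul g x (g⁻¹ • J)
  have h2 := height_smul g y (g⁻¹ • J)
  rw [smul_inv_smul] at h1 h2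
  omega

lemma finite_height_ne_zero (g : P.PathGroup) : {J : P.Hyperplane | height J g ≠ 0}.Finite := by
  induction g using eval_induction with
  | one => simp
  | step h e ih =>
    refine (ih.union (Set.finite_singleton (ofEdge h e))).subset ?_
    intro J hJ
    by_contra hn
    simp only [Set.mem_union, Set.mem_ofPred_eq, Set.mem_singleton_iff, not_or, not_not] at hn
    refine hJ ?_
    rw [height_mul_val, hn.1, if_neg (fun h => hn.2 h.symm), add_zero]

lemma finite_height_ne (g h : P.PathGroup) :
    {J : P.Hyperplane | height J g ≠ height J h}.Finite := by
  refine ((finite_height_ne_zero g).union (finite_height_ne_zero h)).subset ?_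
  intro J hJ
  by_contra hn
  simp only [Set.mem_union, Set.mem_ofPred_eq, not_or, not_not] at hn
  exact hJ (hn.1.trans hn.2.symm)

/-- A path on which the height of a hyperplane changes contains an edge that crosses it. -/
lemma exists_of_height_ne {J : P.Hyperplane} {g : P.PathGroup} {s : List P.SignedEdge}
    (h : height J (g * eval s) ≠ height J g) :
    ∃ s₁ e s₂, s = s₁ ++ e :: s₂ ∧ ofEdge (g * eval s₂) e = J := by
  induction s with
  | nil => simp at h
  | cons e s ih =>
    by_cases he : ofEdge (g * eval s) e = J
    · exact ⟨[], e, s, rfl, he⟩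
    · rw [eval_cons, ← mul_assoc, height_mul_val, if_neg he, add_zero] at h
      obtain ⟨s₁, e', s₂, rfl, h'⟩ := ih h
      exact ⟨e :: s₁, e', s₂, rfl, h'⟩

/-- A path `A + ub` crosses only hyperplanes that precede the one dual to `[a, u = v, b]`. -/
lemma precedes_of_height_ne_left {K : P.Hyperplane} {g A : P.PathGroup} {a a' b : List α}
    {r : P.rels} (hA : A ∈ P.Hom a a')
    (h : height K (g * whisker [] (r.1.1 ++ b) A) ≠ height K g) :
    Precedes K (mk g a r b) := by
  obtain ⟨s, hs, rfl⟩ := hA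
  rw [whisker_eval] at h
  obtain ⟨s₁', e', s₂', h1, rfl⟩ := exists_of_height_ne h
  obtain ⟨s₁, s₂, rfl, rfl, h2⟩ := List.map_eq_append_iff.1 h1
  obtain ⟨e, s₂, rfl, rfl, rfl⟩ := List.map_eq_cons_iff.1 h2
  obtain ⟨c, hc, -⟩ := isPath_append_iff.1 hs
  rw [← whisker_eval]
  have := mk_eq_mk_left (g := g) (⟨s₂, hc.2, rfl⟩ :
    eval s₂ ∈ P.Hom a (e.left ++ e.src ++ e.right)) r b
  rw [this]
  exact ofEdge_precedes _ _ _ _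

/-- A path `au + B` crosses only hyperplanes that are preceded by the one dual to
`[a, u = v, b]`. -/
lemma precedes_of_height_ne_right {K : P.Hyperplane} {g B : P.PathGroup} {a b b' : List α}
    {r : P.rels} (hB : B ∈ P.Hom b b')
    (h : height K (g * whisker (a ++ r.1.1) [] B) ≠ height K g) :
    Precedes (mk g a r b) K := by
  obtain ⟨s, hs, rfl⟩ := hB
  rw [whisker_eval] at h
  obtain ⟨s₁', e', s₂', h1, rfl⟩ := exists_of_height_ne h
  obtain ⟨s₁, s₂, rfl, rfl, h2⟩ := List.map_eq_append_iff.1 h1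
  obtain ⟨e, s₂, rfl, rfl, rfl⟩ := List.map_eq_cons_iff.1 h2
  obtain ⟨c, hc, -⟩ := isPath_append_iff.1 hs
  rw [← whisker_eval]
  have := mk_eq_mk_right (g := g) (⟨s₂, hc.2, rfl⟩ :
    eval s₂ ∈ P.Hom b (e.left ++ e.src ++ e.right)) r a
  rw [this]
  exact precedes_ofEdge _ _ _ _

/-- An element that fixes a hyperplane does not move any vertex across it. -/
lemma height_mul_of_smul_eq {J : P.Hyperplane} {h : P.PathGroup} (hJ : h • J = J)
    (x : P.PathGroup) : height J (h * x) = height J x := by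
  have h0 : h⁻¹ • J = J := by rw [inv_smul_eq_iff, hJ]
  obtain ⟨g, a, r, b, rfl⟩ := exists_rep J
  have h1 := height_smul_sub h x g (mk g a r b)
  rw [h0] at h1
  obtain ⟨l, hl, t, ht, rfl⟩ := smul_eq_self_iff.1 hJ
  obtain ⟨A, hA, rfl⟩ := mem_leftStab_mk.1 hl
  obtain ⟨B, hB, rfl⟩ := mem_rightStab_mk.1 ht
  have h2 : height (mk g a r b) (g * whisker [] (r.1.1 ++ b) A) = height (mk g a r b) g := by
    by_contra hn
    exact not_precedes_self _ (precedes_of_height_ne_left hA hn)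
  have h3 : height (mk g a r b) (g * whisker [] (r.1.1 ++ b) A * whisker (a ++ r.1.1) [] B) =
      height (mk g a r b) (g * whisker [] (r.1.1 ++ b) A) := by
    by_contra hn
    have := precedes_of_height_ne_right (a := a) (r := r) hB hn
    rw [← mk_eq_mk_left hA] at this
    exact not_precedes_self _ this
  have h4 : g * whisker [] (r.1.1 ++ b) A * g⁻¹ * (g * whisker (a ++ r.1.1) [] B * g⁻¹) * g =
      g * whisker [] (r.1.1 ++ b) A * whisker (a ++ r.1.1) [] B := by simp [mul_assoc]
  rw [h4, h3, h2] at h1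
  linarith

end Hyperplane

end Hyperplane

/-! ### Skewering -/

lemma eq_of_forall_add_one_eq {β : Type*} {f : ℤ → β} (h : ∀ t, f (t + 1) = f t) (m n : ℤ) :
    f m = f n := by
  have h0 : ∀ t, f t = f 0 := fun t => by
    induction t using Int.induction_on with
    | zero => rfl
    | succ i ih => rw [h, ih]
    | pred i ih => rw [← ih, ← h, sub_add_cancel]
  rw [h0 m, h0 n]

section Skewer

open Filter

variable {α : Type v} {P : SemigroupPresentation α}

open PathGroup SignedEdge

namespace Hyperplane

/-- The nonzero powers of `g` do not fix `J`. -/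
def FreeOrbit (g : P.PathGroup) (J : P.Hyperplane) : Prop := ∀ i : ℤ, i ≠ 0 → g ^ i • J ≠ J

lemma zpow_smul_eq_self {g : P.PathGroup} {J : P.Hyperplane} (h : g • J = J) (i : ℤ) :
    g ^ i • J = J :=
  (MulAction.stabilizer P.PathGroup J).zpow_mem (x := g) h i

lemma FreeOrbit.injective {g : P.PathGroup} {J : P.Hyperplane} (h : FreeOrbit g J) :
    Function.Injective fun n : ℤ => g ^ n • J := by
  intro m n hmn
  by_contra hne
  refine h (m - n) (sub_ne_zero.2 hne) ?_
  have h1 : g ^ m • J = g ^ n • J := hmn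
  rw [sub_eq_neg_add, zpow_add, mul_smul, h1, ← mul_smul, ← zpow_add, neg_add_cancel, zpow_zero,
    one_smul]

/-- Two parallel orbits are on the same side of `J` up to finitely many points. -/
lemma FreeOrbit.eventually_eq {g : P.PathGroup} {J : P.Hyperplane} (h : FreeOrbit g J)
    (x y : P.PathGroup) :
    ∀ᶠ n : ℤ in cofinite, height J (g ^ n * x) = height J (g ^ n * y) := by
  have hi : Function.Injective fun n : ℤ => (g ^ n)⁻¹ • J := by
    intro m n hmn
    simp only [← zpow_neg] at hmn
    simpa using h.injective hmn
  have := (finite_height_ne x y).preimage hi.injOn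
  refine (this.subset ?_)
  intro n hn (hn' : height ((g ^ n)⁻¹ • J) x = height ((g ^ n)⁻¹ • J) y)
  have h1 := height_smul_sub (g ^ n) x y J
  exact hn (sub_eq_zero.1 (h1.trans (sub_eq_zero.2 hn')))

lemma FreeOrbit.exists_ends {g : P.PathGroup} {J : P.Hyperplane} (h : FreeOrbit g J) :
    ∃ cp cm : ℤ, ∀ x, (∀ᶠ n : ℤ in atTop, height J (g ^ n * x) = cp) ∧
      ∀ᶠ n : ℤ in atBot, height J (g ^ n * x) = cm := by
  have h1 := h.eventually_eq g 1
  rw [Int.cofinite_eq, eventually_sup, eventually_atBot, eventually_atTop] at h1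
  obtain ⟨⟨m, hm⟩, ⟨M, hM⟩⟩ := h1
  refine ⟨height J (g ^ M), height J (g ^ m), fun x => ?_⟩
  have h2 := h.eventually_eq x 1
  rw [Int.cofinite_eq, eventually_sup] at h2
  simp only [← zpow_add_one, mul_one] at hm hM
  constructor
  · filter_upwards [h2.2, eventually_ge_atTop M] with n hn hMn
    rw [hn, mul_one]
    clear hn
    induction n, hMn using Int.leInduction with
    | base => rfl
    | succ n hMn ih => rw [hM n hMn, ih]
  · filter_upwards [h2.1, eventually_le_atBot m] with n hn hmn
    rw [hn, mul_one]
    clear hn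
    induction n, hmn using Int.leInductionDown with
    | base => rfl
    | pred n hmn ih =>
      rw [← ih, ← hm (n - 1) (by omega), sub_add_cancel]

/-- The orbit of the base vertex under `g` goes from one side of `J` to the other one, and crosses
each translate of `J` only finitely many times. -/
def Skewers (g : P.PathGroup) (J : P.Hyperplane) : Prop :=
  FreeOrbit g J ∧ ∃ cp cm : ℤ, cp ≠ cm ∧ ∀ x, (∀ᶠ n : ℤ in atTop, height J (g ^ n * x) = cp) ∧
    ∀ᶠ n : ℤ in atBot, height J (g ^ n * x) = cm

lemma Skewers.mul_of_smul_eq {x y : P.PathGroup} {K : P.Hyperplane} (h : Skewers x K)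
    (hxy : Commute x y) (hy : y • K = K) : Skewers (x * y) K := by
  obtain ⟨h1, cp, cm, hc, h2⟩ := h
  refine ⟨fun i hi => ?_, cp, cm, hc, fun z => ?_⟩
  · rw [hxy.mul_zpow, mul_smul, zpow_smul_eq_self hy]
    exact h1 i hi
  · have h3 : ∀ n : ℤ, height K ((x * y) ^ n * z) = height K (x ^ n * z) := fun n => by
      rw [hxy.mul_zpow, (hxy.zpow_zpow n n).eq, mul_assoc,
        height_mul_of_smul_eq (zpow_smul_eq_self hy n)]
    simp only [h3]
    exact h2 z

lemma skewers_zpow_iff {x : P.PathGroup} {K : P.Hyperplane} {m : ℤ} (hm : m ≠ 0) :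
    Skewers (x ^ m) K ↔ Skewers x K := by
  have hfree : FreeOrbit (x ^ m) K ↔ FreeOrbit x K := by
    refine ⟨fun h i hi hK => h i hi ?_, fun h i hi => ?_⟩
    · rw [← zpow_mul, mul_comm, zpow_mul]
      exact zpow_smul_eq_self hK m
    · rw [← zpow_mul]
      exact h _ (mul_ne_zero hm hi)
  unfold Skewers
  rw [hfree]
  refine and_congr_right fun h => ?_
  obtain ⟨dp, dm, hd⟩ := h.exists_ends
  obtain ⟨ep, em, he⟩ := (hfree.2 h).exists_ends
  have key : ∀ {g : P.PathGroup} {dp dm : ℤ}, (∀ x, (∀ᶠ n : ℤ in atTop,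
      height K (g ^ n * x) = dp) ∧ ∀ᶠ n : ℤ in atBot, height K (g ^ n * x) = dm) →
      ((∃ cp cm : ℤ, cp ≠ cm ∧ ∀ x, (∀ᶠ n : ℤ in atTop, height K (g ^ n * x) = cp) ∧
    ∀ᶠ n : ℤ in atBot, height K (g ^ n * x) = cm) ↔ dp ≠ dm) := by
    intro g dp dm hd
    refine ⟨?_, fun h => ⟨dp, dm, h, hd⟩⟩
    rintro ⟨cp, cm, hc, h⟩
    obtain ⟨n, hn1, hn2⟩ := ((hd 1).1.and (h 1).1).exists
    obtain ⟨m, hm1, hm2⟩ := ((hd 1).2.and (h 1).2).exists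
    rwa [← hn1, ← hm1, hn2, hm2]
  rw [key hd, key he]
  have hmul : ∀ n : ℤ, (x ^ m) ^ n = x ^ (m * n) := fun n => (zpow_mul x m n).symm
  rcases lt_or_gt_of_ne hm with hm | hm
  · have t1 : Tendsto (fun n : ℤ => m * n) atTop atBot := by
      have := tendsto_neg_atTop_atBot.comp
        (tendsto_id.const_mul_atTop' (neg_pos.2 hm) : Tendsto (fun n : ℤ => -m * id n) atTop atTop)
      simpa [Function.comp_def] using this
    have t2 : Tendsto (fun n : ℤ => m * n) atBot atTop := by
      have := (tendsto_id.const_mul_atTop' (neg_pos.2 hm) :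
        Tendsto (fun n : ℤ => -m * id n) atTop atTop).comp tendsto_neg_atBot_atTop
      simpa [Function.comp_def] using this
    obtain ⟨n, hn1, hn2⟩ := ((he 1).1.and (t1.eventually (hd 1).2)).exists
    obtain ⟨k, hk1, hk2⟩ := ((he 1).2.and (t2.eventually (hd 1).1)).exists
    rw [hmul, hn2] at hn1
    rw [hmul, hk2] at hk1
    rw [← hn1, ← hk1, ne_comm]
  · have t1 : Tendsto (fun n : ℤ => m * n) atTop atTop := tendsto_id.const_mul_atTop' hm
    have t2 : Tendsto (fun n : ℤ => m * n) atBot atBot := by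
      have := tendsto_neg_atTop_atBot.comp ((tendsto_id.const_mul_atTop' hm :
        Tendsto (fun n : ℤ => m * id n) atTop atTop).comp tendsto_neg_atBot_atTop)
      simpa [Function.comp_def] using this
    obtain ⟨n, hn1, hn2⟩ := ((he 1).1.and (t1.eventually (hd 1).1)).exists
    obtain ⟨k, hk1, hk2⟩ := ((he 1).2.and (t2.eventually (hd 1).2)).exists
    rw [hmul, hn2] at hn1
    rw [hmul, hk2] at hk1
    rw [← hn1, ← hk1]

/-- The centralizer of an element permutes the hyperplanes skewered by that element, and there are
finitely many of them up to the action of the element itself. -/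
lemma Skewers.exists_smul_eq {g a : P.PathGroup} {J : P.Hyperplane} (h : Skewers g J)
    (ha : Commute a g) : ∃ i j : ℤ, i ≠ 0 ∧ (a ^ i * g ^ j) • J = J := by
  obtain ⟨h1, cp, cm, hc, h2⟩ := h
  have key : ∀ k : ℤ, ∃ t : ℤ, height ((g ^ t * a ^ k) • J) g ≠ 0 := by
    intro k
    by_contra! hk
    have h3 : ∀ t : ℤ, height J (g ^ (t + 1) * a ^ (-k)) = height J (g ^ t * a ^ (-k)) := by
      intro t
      have h4 := height_smul_sub ((g ^ (-t) * a ^ k)⁻¹) g 1 J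
      rw [_root_.inv_inv, hk, height_one, sub_zero, mul_one, sub_eq_zero, mul_inv_rev, ← zpow_neg,
        ← zpow_neg, neg_neg, mul_assoc, ← zpow_add_one] at h4
      rw [← (ha.zpow_zpow (-k) (t + 1)).eq, ← (ha.zpow_zpow (-k) t).eq, h4]
    obtain ⟨m, hm⟩ := (h2 (a ^ (-k))).1.exists
    obtain ⟨n, hn⟩ := (h2 (a ^ (-k))).2.exists
    exact hc (hm.symm.trans ((eq_of_forall_add_one_eq
      (f := fun t => height J (g ^ t * a ^ (-k))) h3 m n).trans hn))
  choose t ht using key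
  obtain ⟨m, -, n, -, hmn, h5⟩ := Set.infinite_univ.exists_ne_map_eq_of_mapsTo
    (f := fun k : ℤ => (g ^ t k * a ^ k) • J) (fun k _ => ht k) (finite_height_ne_zero g)
  refine ⟨m - n, t m - t n, sub_ne_zero.2 hmn, ?_⟩
  have h6 : a ^ (m - n) * g ^ (t m - t n) = (g ^ t n * a ^ n)⁻¹ * (g ^ t m * a ^ m) := by
    rw [sub_eq_neg_add, zpow_add, mul_assoc, (ha.zpow_zpow _ _).eq, sub_eq_neg_add, zpow_add,
      zpow_neg, zpow_neg]
    simp only [mul_inv_rev, mul_assoc]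
  rw [h6, mul_smul, inv_smul_eq_iff]
  exact h5

/-- An element that moves the subwords to the right of `J` skewers only hyperplanes which are
preceded by `J`. -/
lemma Skewers.precedes {n : P.PathGroup} {J K : P.Hyperplane} (h : Skewers n K)
    (hn : n ∈ rightStab J) : Precedes J K := by
  obtain ⟨h1, cp, cm, hc, h2⟩ := h
  obtain ⟨g, a, r, b, rfl⟩ := exists_rep J
  obtain ⟨B, hB, rfl⟩ := mem_rightStab_mk.1 hn
  obtain ⟨m, hm⟩ := (h2 g).1.exists
  obtain ⟨k, hk⟩ := (h2 g).2.exists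
  have h3 : ∀ m : ℤ, (g * whisker (a ++ r.1.1) [] B * g⁻¹) ^ m * g =
      g * whisker (a ++ r.1.1) [] (B ^ m) := fun m => by
    rw [conj_zpow, inv_mul_cancel_right, map_zpow]
  rw [h3] at hm hk
  have hBm : ∀ m : ℤ, B ^ m ∈ P.Hom b b := (P.loops b).zpow_mem hB
  rw [mk_eq_mk_right (hBm k)]
  refine precedes_of_height_ne_right (B := B ^ (m - k)) (hBm _) ?_
  rw [mul_assoc, ← map_mul, ← zpow_add, add_sub_cancel, hm, hk]
  exact hc

open Classical in
lemma exists_area {J K : P.Hyperplane} (h1 : ¬ Precedes J K) (h2 : ¬ Precedes K J)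
    (hne : K ≠ J) : ∃ F : P.PathGroup → ℤ, ∀ h (e : P.SignedEdge), F (h * e.val) =
      F h + if ofEdge h e = K then sign e * height J h else 0 := by
  obtain ⟨F, -, hF⟩ := exists_potential
    (fun a r b h => if mk h a r b = K then height J h else 0) (P := P) (by
      intro a b c r s h
      have e1 := mk_edge_left h a b c r s
      have e2 := mk_edge_right h a b c r s
      have hp : Precedes (mk h a r (b ++ s.1.1 ++ c)) (mk h (a ++ r.1.1 ++ b) s c) :=
        ⟨h, a, b, c, r, s, rfl, rfl⟩
      simp only [e1, e2, height_mul_edge]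
      generalize mk h a r (b ++ s.1.1 ++ c) = X at *
      generalize mk h (a ++ r.1.1 ++ b) s c = Y at *
      by_cases h3 : X = K <;> by_cases h4 : Y = K
      · rw [h3, h4] at hp
        exact absurd hp (not_precedes_self K)
      · have : Y ≠ J := by
          rintro rfl; exact h2 (h3 ▸ hp)
        simp [h3, h4, this]
      · have : X ≠ J := by
          rintro rfl; exact h1 (h4 ▸ hp)
        simp [h3, h4, this]
      · simp [h3, h4])
  refine ⟨F, fun h e => ?_⟩
  have hh : ofEdge h e = K → height J (h * e.val) = height J h := fun he => by
    rw [height_mul_val, he, if_neg hne, add_zero]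
  rcases e with ⟨l, r, _ | _, m⟩
  · have := hF (h * (edge l r m)⁻¹) l r m
    rw [inv_mul_cancel_right] at this
    by_cases h' : mk (h * (edge l r m)⁻¹) l r m = K
    · rw [if_pos h'] at this
      have hh' := hh h'
      simp only [val, cond_false] at hh'
      rw [if_pos (show ofEdge h ⟨l, r, false, m⟩ = K from h'), this]
      simp [val, sign, hh']
    · rw [if_neg h'] at this
      rw [if_neg (show ¬ ofEdge h ⟨l, r, false, m⟩ = K from h'), this]
      simp [val]
  · have := hF h l r m
    by_cases h' : mk h l r m = K
    · rw [if_pos h'] at this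
      rw [if_pos (show ofEdge h ⟨l, r, true, m⟩ = K from h')]
      simpa [val, sign] using this
    · rw [if_neg h'] at this
      rw [if_neg (show ¬ ofEdge h ⟨l, r, true, m⟩ = K from h')]
      simpa [val] using this

/-- Two hyperplanes cross if there are commuting elements each of which fixes one of them and
skewers the other. Otherwise the area of a large rectangle in the flat spanned by the two elements,
counted in pairs of crossings, would be both zero and nonzero. -/
lemma precedes_or_precedes {s s' : P.PathGroup} {J K : P.Hyperplane} (hs : Commute s s')
    (hJ : s • J = J) (hK : s' • K = K) (hsJ : Skewers s' J) (hsK : Skewers s K) :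
    Precedes J K ∨ Precedes K J := by
  by_contra! hn
  have hne : K ≠ J := by
    rintro rfl
    exact hsK.1 1 one_ne_zero (by rwa [zpow_one])
  obtain ⟨F, hF⟩ := exists_area hn.1 hn.2 hne
  obtain ⟨h1, cp, cm, hc, h2⟩ := hsJ
  obtain ⟨k1, dp, dm, hd, k2⟩ := hsK
  have hs' : ∀ i j : ℤ, s ^ i * s' ^ j = s' ^ j * s ^ i := fun i j => (hs.zpow_zpow i j).eq
  -- Far away from `J`, the potential is proportional to the height of `K`.
  have far : ∀ (l : Filter ℤ) (c : ℤ), (∀ x, ∀ᶠ n in l, height J (s' ^ n * x) = c) →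
      ∀ p, ∀ᶠ m in l, ∀ t : ℤ, F (s' ^ m * s ^ t * p) - F (s' ^ m * s ^ t) =
        c * (height K (s' ^ m * s ^ t * p) - height K (s' ^ m * s ^ t)) := by
    intro l c hl p
    induction p using eval_induction with
    | one => simp
    | step p e ih =>
      filter_upwards [ih, hl p] with m hm hm' t
      have h3 : height J (s' ^ m * s ^ t * p) = c := by
        rw [← hs', mul_assoc, height_mul_of_smul_eq (zpow_smul_eq_self hJ t), hm']
      rw [← mul_assoc, hF, height_mul_val, h3]
      have := hm t
      split_ifs <;> linarith
  -- Far away from `K`, the potential is constant.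
  have const : ∀ p, ∀ᶠ m : ℤ in cofinite, ∀ t : ℤ, F (s ^ m * s' ^ t * p) = F (s ^ m * s' ^ t) := by
    intro p
    induction p using eval_induction with
    | one => simp
    | step p e ih =>
      have : ∀ᶠ m : ℤ in cofinite, s ^ m • ofEdge p e ≠ K := by
        have hsub : {m : ℤ | s ^ m • ofEdge p e = K}.Subsingleton := by
          intro m hm n hn
          have hm : s ^ m • ofEdge p e = K := hm
          have hn : s ^ n • ofEdge p e = K := hn
          by_contra hmn
          refine k1 (m - n) (sub_ne_zero.2 hmn) ?_
          nth_rw 1 [← hn]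
          rw [← mul_smul, ← zpow_add, sub_add_cancel, hm]
        refine hsub.finite.subset fun m hm => ?_
        simpa using hm
      filter_upwards [ih, this] with m hm hm' t
      rw [← mul_assoc, hF, if_neg, add_zero, hm]
      intro h
      refine hm' ?_
      rw [smul_ofEdge]
      rw [hs', mul_assoc, ← smul_ofEdge] at h
      exact smul_left_cancel _ (h.trans (zpow_smul_eq_self hK t).symm)
  have hK' : ∀ m t : ℤ, height K (s' ^ m * s ^ t) = height K (s ^ t) := fun m t =>
    height_mul_of_smul_eq (zpow_smul_eq_self hK m) _
  have far' : ∀ (l : Filter ℤ) (c : ℤ), (∀ x, ∀ᶠ n in l, height J (s' ^ n * x) = c) →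
      ∀ᶠ m in l, ∀ t t' : ℤ, F (s' ^ m * s ^ t) - F (s' ^ m * s ^ t') =
        c * (height K (s ^ t) - height K (s ^ t')) := by
    intro l c hl
    filter_upwards [far l c hl s] with m hm t t'
    have := eq_of_forall_add_one_eq (f := fun t => F (s' ^ m * s ^ t) - c * height K (s ^ t))
      (fun t => by
        have := hm t
        rw [mul_assoc, ← zpow_add_one, hK', hK'] at this
        linarith) t t'
    linarith
  have const' : ∀ᶠ m : ℤ in cofinite, ∀ t t' : ℤ, F (s' ^ t * s ^ m) = F (s' ^ t' * s ^ m) := by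
    filter_upwards [const s'] with m hm
    refine eq_of_forall_add_one_eq fun t => ?_
    rw [← hs', ← hs', zpow_add_one, ← mul_assoc, hm]
  rw [Int.cofinite_eq, eventually_sup] at const'
  obtain ⟨mp, hmp⟩ := (far' _ _ fun x => (h2 x).1).exists
  obtain ⟨mm, hmm⟩ := (far' _ _ fun x => (h2 x).2).exists
  obtain ⟨np, hnp, hnp'⟩ := (const'.2.and (k2 1).1).exists
  obtain ⟨nm, hnm, hnm'⟩ := (const'.1.and (k2 1).2).exists
  have e1 := hmp np nm
  have e2 := hmm np nm
  rw [mul_one] at hnp' hnm'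
  rw [hnp mp mm, hnm mp mm, e2, hnp', hnm', ← sub_eq_zero, ← sub_mul] at e1
  rcases mul_eq_zero.1 e1 with h | h
  · exact hc (by linarith)
  · exact hd (by linarith)

end Hyperplane

end Skewer

/-! ### Leftmost skewered hyperplanes -/

section Leftmost

open Filter

variable {α : Type v} {P : SemigroupPresentation α}

open PathGroup SignedEdge

lemma length_nf_mul_le (g h : P.PathGroup) :
    (nf (g * h)).length ≤ (nf g).length + (nf h).length := by
  conv_lhs => rw [← eval_nf g, ← eval_nf h, ← eval_append]
  refine (length_nf_eval_le _).trans ?_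
  rw [List.length_append, add_comm]

lemma length_nf_whisker (x y : List α) (g : P.PathGroup) :
    (nf (whisker x y g)).length = (nf g).length := by
  rw [nf_whisker, List.length_map]

lemma eq_nil_of_hom_nil {a : List α} {A : P.PathGroup} (hA : A ∈ P.Hom a []) : a = [] := by
  obtain ⟨s, hs, -⟩ := hA
  cases s with
  | nil => exact hs
  | cons e s =>
    have := congrArg List.length hs.1
    have h1 := e.tgt_length_pos
    simp only [List.length_append, List.length_nil] at this
    omega

lemma eq_one_of_hom_nil {a : List α} {A : P.PathGroup} (hA : A ∈ P.Hom a []) : A = 1 := by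
  obtain ⟨s, hs, rfl⟩ := hA
  cases s with
  | nil => rfl
  | cons e s =>
    have := congrArg List.length hs.1
    have h1 := e.tgt_length_pos
    simp only [List.length_append, List.length_nil] at this
    omega

/-- A path that never touches the first letter is obtained from a path between shorter words. -/
lemma IsPath.exists_of_forall_left_ne_nil {x : α} {v c : List α} {s : List P.SignedEdge}
    (hs : IsPath (x :: v) s c) (h : ∀ e ∈ s, e.left ≠ []) :
    ∃ s' c', c = x :: c' ∧ s = s'.map (SignedEdge.whisker [x] []) ∧ IsPath v s' c' := by
  induction s generalizing c with
  | nil => exact ⟨[], v, Eq.symm hs, rfl, rfl⟩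
  | cons e s ih =>
    obtain ⟨rfl, hs⟩ := hs
    obtain ⟨s', c', h1, rfl, h2⟩ := ih hs fun e he => h e (List.mem_cons_of_mem _ he)
    rcases e with ⟨_ | ⟨y, l⟩, r, d, m⟩
    · exact absurd rfl (h _ List.mem_cons_self)
    · simp only [List.cons_append, List.cons.injEq] at h1
      obtain ⟨rfl, rfl⟩ := h1
      exact ⟨⟨l, r, d, m⟩ :: s', _, rfl, by simp [SignedEdge.whisker], rfl, h2⟩

namespace Hyperplane

lemma left_eq_nil {g g' : P.PathGroup} {a b b' : List α} {r r' : P.rels}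
    (h : mk g a r b = mk g' [] r' b') : a = [] := by
  obtain ⟨-, A, hA, -⟩ := mk_eq_mk_iff.1 h
  exact eq_nil_of_hom_nil hA

lemma left_eq_nil_of_ofEdge {g g' : P.PathGroup} {e e' : P.SignedEdge}
    (h : ofEdge g e = ofEdge g' e') (h' : e'.left = []) : e.left = [] := by
  unfold ofEdge at h
  rw [h'] at h
  exact left_eq_nil h

/-- A path `u + B` crosses no hyperplane that is dual to an edge at the left end of a word. -/
lemma height_mul_whisker_eq {g g' B : P.PathGroup} {u b : List α} {e : P.SignedEdge}
    (hu : u ≠ []) (he : e.left = []) :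
    height (ofEdge g' e) (g * whisker u b B) = height (ofEdge g' e) g := by
  by_contra hn
  rw [← eval_nf B, whisker_eval] at hn
  obtain ⟨s₁, f, s₂, h1, h2⟩ := exists_of_height_ne hn
  have h3 : f ∈ (nf B).map (SignedEdge.whisker u b) := by rw [h1]; simp
  obtain ⟨f', -, rfl⟩ := List.mem_map.1 h3
  have := left_eq_nil_of_ofEdge h2 he
  simp [hu] at this

/-- Two consecutive crossings in opposite directions of a hyperplane that is dual to edges at the
left end of words: the path between them never touches the left end, up to homotopy. -/
lemma exists_whisker_of_ofEdge_eq {x m : P.PathGroup} {e e' : P.SignedEdge} (he : e.left = [])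
    (he' : e'.left = []) (hd : e.dir ≠ e'.dir)
    (h : ofEdge x e = ofEdge (x * e.val * m) e') :
    ∃ B ∈ P.Hom e.right e'.right, m = whisker e.tgt [] B ∧
      e.val * m * e'.val = whisker e.src [] B := by
  rcases e with ⟨l, r, d, b⟩
  rcases e' with ⟨l', r', d', b'⟩
  simp only at he he' hd
  subst he he'
  obtain ⟨h1, A, hA, B, hB, h2⟩ := mk_eq_mk_iff.1 h
  simp only at h1 hA hB h2
  subst h1
  rw [eq_one_of_hom_nil hA] at h2
  have key := interchange (Hom.val (⟨[], r, true, []⟩ : P.SignedEdge)) hB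
  simp only [whisker_val, SignedEdge.whisker, List.append_nil, List.nil_append] at key
  simp only [val, src, tgt, cond_true] at key
  have key2 : whisker r.1.2 [] B = (edge [] r b)⁻¹ * (whisker r.1.1 [] B * edge [] r b') := by
    rw [← key, inv_mul_cancel_left]
  refine ⟨B, hB, ?_⟩
  rcases d with _ | _ <;> rcases d' with _ | _
  · exact absurd rfl hd
  · simp only [cond_false, cond_true, sandwich, map_one, one_mul, List.nil_append, val] at h2
    rw [mul_right_inj] at h2
    subst h2
    refine ⟨rfl, ?_⟩
    simp only [val, src, cond_false, cond_true, mul_assoc]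
    exact key2.symm
  · simp only [cond_false, cond_true, sandwich, map_one, one_mul, List.nil_append, val] at h2
    rw [mul_assoc, mul_assoc, mul_right_inj] at h2
    refine ⟨?_, ?_⟩
    · simp only [tgt, cond_true]
      rw [key2, ← h2]
      simp [mul_assoc]
    · simp only [val, src, cond_false, cond_true, mul_assoc]
      exact h2
  · exact absurd rfl hd

end Hyperplane

/-! ### Periodic paths -/

/-- The path from the base vertex that crosses the edges of the sequence `ε`. -/
def run (ε : ℕ → P.SignedEdge) : ℕ → P.PathGroup
  | 0 => 1
  | i + 1 => run ε i * (ε i).val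

/-- The source of an edge of a path. -/
def source (e : P.SignedEdge) : List α := e.left ++ e.src ++ e.right

/-- The target of an edge of a path. -/
def target (e : P.SignedEdge) : List α := e.left ++ e.tgt ++ e.right

/-- An infinite path with period `n`. -/
structure IsPeriodicPath (ε : ℕ → P.SignedEdge) (n : ℕ) : Prop where
  pos : 0 < n
  target_eq : ∀ i, target (ε i) = source (ε (i + 1))
  periodic : ∀ i, ε (i + n) = ε i

lemma length_nf_run (ε : ℕ → P.SignedEdge) (i k : ℕ) :
    (nf ((run ε i)⁻¹ * run ε (i + k))).length ≤ k := by
  induction k with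
  | zero => simp
  | succ k ih =>
    rw [← add_assoc, run, ← mul_assoc, nf_mul_val]
    exact (push_length_le _ _).trans (by omega)

/-- A closed path can be repeated. -/
lemma exists_isPeriodicPath {v : List α} {s : List P.SignedEdge} (hs : IsPath v s v)
    (h0 : s ≠ []) : ∃ ε : ℕ → P.SignedEdge, IsPeriodicPath ε s.length ∧ source (ε 0) = v ∧
      run ε s.length = eval s ∧ ∀ e ∈ s, ∃ i, ε i = e := by
  have hpos : 0 < s.length := List.length_pos_iff.2 h0
  have hpos' : 0 < s.reverse.length := by simpa using hpos
  have hchain : ∀ {a b : List α} {s : List P.SignedEdge}, IsPath a s b →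
      s.IsChain (fun e' e => target e = source e') := by
    intro a b s hs
    induction s generalizing b with
    | nil => exact List.IsChain.nil
    | cons e s ih =>
      refine List.isChain_cons.2 ⟨fun f hf => ?_, ih hs.2⟩
      cases s with
      | nil => simp at hf
      | cons f' s =>
        simp only [List.head?_cons, Option.mem_some_iff] at hf
        subst hf
        exact hs.2.1.symm
  have hc : s.reverse.IsChain (fun e e' => target e = source e') :=
    List.isChain_reverse.2 (hchain hs)
  let ε : ℕ → P.SignedEdge := fun i => s.reverse[i % s.reverse.length]'(Nat.mod_lt _ hpos')
  have hε : ∀ i (h : i < s.reverse.length), ε i = s.reverse[i] := fun i h => by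
    simp only [ε, Nat.mod_eq_of_lt h]
  have hper : ∀ i, ε (i + s.length) = ε i := fun i => by
    have : s.length = s.reverse.length := by simp
    simp only [ε]
    congr 1
    rw [this, Nat.add_mod_right]
  have hrun : ∀ k ≤ s.length, run ε k = eval (s.reverse.take k).reverse := by
    intro k hk
    induction k with
    | zero => simp [run]
    | succ k ih =>
      have hk' : k < s.reverse.length := by simpa using hk
      rw [run, ih (by omega), hε k hk', List.take_succ_eq_append_getElem hk']
      simp
  have hfirst : source (ε 0) = v := by
    have key : ∀ {s : List P.SignedEdge} (h : s.length - 1 < s.length), IsPath v s v →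
        source s[s.length - 1] = v := by
      intro s h hs
      rcases List.eq_nil_or_concat s with rfl | ⟨s', e, rfl⟩
      · simp at h
      · rw [List.concat_eq_append, isPath_append_iff] at hs
        obtain ⟨b, ⟨-, hb⟩, -⟩ := hs
        simpa [source] using hb.symm
    rw [hε 0 hpos']
    simpa [List.getElem_reverse] using key (by omega) hs
  have hlast : target (ε (s.length - 1)) = v := by
    have key : ∀ {s : List P.SignedEdge} (h : 0 < s.length), IsPath v s v →
        target s[0] = v := by
      intro s h hs
      cases s with
      | nil => simp at h
      | cons e s => exact hs.1.symm
    rw [hε (s.length - 1) (by simpa using hpos)]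
    have h1 : s.length - 1 - (s.length - 1) = 0 := by omega
    simpa [List.getElem_reverse, h1] using key hpos hs
  refine ⟨ε, ⟨hpos, fun i => ?_, hper⟩, hfirst, ?_, ?_⟩
  · have hmod : ∀ i, ε i = ε (i % s.length) := fun i => by
      simp only [ε, List.length_reverse, Nat.mod_mod]
    have hq := Nat.mod_lt i hpos
    by_cases hq1 : i % s.length + 1 < s.length
    · rw [hmod i, hmod (i + 1), Nat.add_mod, Nat.mod_eq_of_lt (a := 1) (by omega),
        Nat.mod_eq_of_lt hq1, hε _ (by simpa using hq), hε _ (by simpa using hq1)]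
      exact List.isChain_iff_getElem.1 hc _ (by simpa using hq1)
    · have h1 : i % s.length = s.length - 1 := by omega
      have h2 : (i + 1) % s.length = 0 := by
        rw [← Nat.mod_add_mod, h1, Nat.sub_add_cancel hpos, Nat.mod_self]
      rw [hmod i, hmod (i + 1), h1, h2, hlast, hfirst]
  · rw [hrun _ le_rfl]
    rw [List.take_of_length_le (by simp), List.reverse_reverse]
  · intro e he
    obtain ⟨i, hi, rfl⟩ := List.getElem_of_mem (List.mem_reverse.2 he)
    exact ⟨i, hε i hi⟩

namespace IsPeriodicPath

variable {ε : ℕ → P.SignedEdge} {n : ℕ}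

lemma run_mem (h : IsPeriodicPath ε n) (i k : ℕ) :
    (run ε i)⁻¹ * run ε (i + k) ∈ P.Hom (source (ε i)) (source (ε (i + k))) := by
  induction k with
  | zero => simpa using Hom.one _
  | succ k ih =>
    rw [← add_assoc, run, ← mul_assoc, ← h.target_eq]
    exact Hom.mul ih (Hom.val _)

lemma run_add (h : IsPeriodicPath ε n) (i : ℕ) : run ε (i + n) = run ε n * run ε i := by
  induction i with
  | zero => simp [run]
  | succ i ih => rw [add_right_comm, run, ih, h.periodic, run, mul_assoc]

lemma run_pow (h : IsPeriodicPath ε n) (N i : ℕ) : run ε (i + N * n) = run ε n ^ N * run ε i := by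
  induction N with
  | zero => simp
  | succ N ih => rw [Nat.succ_mul, ← add_assoc, h.run_add, ih, pow_succ', mul_assoc]

lemma periodic_mul (h : IsPeriodicPath ε n) (N i : ℕ) : ε (i + N * n) = ε i := by
  induction N with
  | zero => simp
  | succ N ih => rw [Nat.succ_mul, ← add_assoc, h.periodic, ih]

end IsPeriodicPath

namespace Hyperplane

/-- If a hyperplane is always crossed in the same direction, then it is not crossed back. -/
lemma height_run_mono {ε : ℕ → P.SignedEdge} {J : P.Hyperplane} {σ : ℤ} {a b : ℕ} (hab : a ≤ b)
    (h : ∀ q, a ≤ q → q < b → ofEdge (run ε q) (ε q) = J → sign (ε q) = σ) :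
    σ * height J (run ε a) ≤ σ * height J (run ε b) := by
  induction b, hab using Nat.le_induction with
  | base => rfl
  | succ b hab ih =>
    refine (ih fun q h1 h2 => h q h1 (by omega)).trans ?_
    rw [run, height_mul_val]
    split_ifs with hb
    · rw [h b hab (by omega) hb, mul_add]
      have := mul_self_nonneg σ
      omega
    · simp

lemma height_run_lt {ε : ℕ → P.SignedEdge} {J : P.Hyperplane} {σ : ℤ} {a b q : ℕ} (haq : a ≤ q)
    (hqb : q < b) (hq : ofEdge (run ε q) (ε q) = J)
    (h : ∀ q, a ≤ q → q < b → ofEdge (run ε q) (ε q) = J → sign (ε q) = σ) :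
    σ * height J (run ε a) < σ * height J (run ε b) := by
  have h1 := height_run_mono haq fun q h1 h2 => h q h1 (by omega)
  have h2 := height_run_mono (Nat.succ_le_of_lt hqb) fun q h1 h2 => h q (by omega) h2
  rw [Nat.succ_eq_add_one, run, height_mul_val, if_pos hq, h q haq hqb hq, mul_add] at h2
  have : 0 < σ * σ := mul_self_pos.2 (by rw [← h q haq hqb hq]; exact sign_ne_zero _)
  omega

lemma sign_eq_iff {e e' : P.SignedEdge} : sign e = sign e' ↔ e.dir = e'.dir := by
  rcases e with ⟨l, r, _ | _, m⟩ <;> rcases e' with ⟨l', r', _ | _, m'⟩ <;> simp [sign]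

/-- If the period of a periodic path cannot be shortened, then the path never crosses the same
hyperplane in both directions, provided that the hyperplane is dual to edges at the left end of
words. -/
lemma dir_eq_of_ofEdge_eq {ε : ℕ → P.SignedEdge} {n : ℕ} (h : IsPeriodicPath ε n)
    (hmin : ∀ i, n ≤ (nf ((run ε i)⁻¹ * run ε (i + n))).length) {i j : ℕ} (hij : i < j)
    (hi : (ε i).left = []) (hJ : ofEdge (run ε i) (ε i) = ofEdge (run ε j) (ε j)) :
    (ε i).dir = (ε j).dir := by
  obtain ⟨d, hd⟩ : ∃ d, j - i = d := ⟨_, rfl⟩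
  induction d using Nat.strong_induction_on generalizing i j with
  | _ d ih =>
  by_contra hdir
  have hj : (ε j).left = [] := left_eq_nil_of_ofEdge hJ.symm hi
  have hj' : run ε j = run ε i * (ε i).val * ((run ε (i + 1))⁻¹ * run ε j) := by
    rw [run]; simp [mul_assoc]
  rw [hj'] at hJ
  obtain ⟨B, hB, h1, h2⟩ := exists_whisker_of_ofEdge_eq hi hj hdir hJ
  rw [← hj'] at hJ
  have h3 : run ε j = run ε (i + 1) * whisker (ε i).tgt [] B := by rw [← h1]; simp
  -- No edge at the left end is crossed in between, since it would have to be crossed back.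
  have hbetween : ∀ q, i < q → q < j → (ε q).left ≠ [] := by
    intro q hiq hqj hq
    have h4 := height_mul_whisker_eq (g := run ε (i + 1)) (g' := run ε q) (B := B) (b := [])
      (ε i).tgt_ne_nil hq
    rw [← h3] at h4
    have h5 : ∃ q', i < q' ∧ q' < j ∧ ofEdge (run ε q') (ε q') = ofEdge (run ε q) (ε q) ∧
        (ε q').dir ≠ (ε q).dir := by
      by_contra! hn
      have := height_run_lt (a := i + 1) (b := j) (σ := sign (ε q)) hiq hqj rfl
        fun q' h5 h6 h7 => sign_eq_iff.2 (hn q' h5 h6 h7)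
      rw [h4] at this
      exact lt_irrefl _ this
    obtain ⟨q', h5, h6, h7, h8⟩ := h5
    rcases lt_trichotomy q q' with hlt | rfl | hlt
    · exact h8 (ih (q' - q) (by omega) hlt hq h7.symm rfl).symm
    · exact h8 rfl
    · exact h8 (ih (q - q') (by omega) hlt (left_eq_nil_of_ofEdge h7 hq) h7 rfl)
  have hjn : j < i + n := by
    by_contra! hle
    rcases hle.eq_or_lt with rfl | hlt
    · exact hdir (by rw [h.periodic])
    · exact hbetween (i + n) (by have := h.pos; omega) hlt (by rw [h.periodic, hi])
  -- The part of the path between the two crossings can be replaced by a shorter one.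
  have h4 : (run ε i)⁻¹ * run ε (i + n) =
      whisker (ε i).src [] B * ((run ε (j + 1))⁻¹ * run ε (i + n)) := by
    rw [← h2, run, run]; simp [mul_assoc]
  have h5 : (nf B).length ≤ j - (i + 1) := by
    have := length_nf_run ε (i + 1) (j - (i + 1))
    rwa [Nat.add_sub_cancel' (by omega), h1, length_nf_whisker] at this
  have h6 := length_nf_run ε (j + 1) (i + n - (j + 1))
  rw [Nat.add_sub_cancel' (by omega)] at h6
  have h7 := hmin i
  rw [h4] at h7
  have h8 := length_nf_mul_le (whisker (ε i).src [] B) ((run ε (j + 1))⁻¹ * run ε (i + n))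
  rw [length_nf_whisker] at h8
  omega

lemma FreeOrbit.skewers {g x : P.PathGroup} {J : P.Hyperplane} (h : FreeOrbit g J)
    (hx : ∀ c : ℤ, (∀ᶠ n : ℤ in atTop, height J (g ^ n * x) = c) →
      ¬ ∀ᶠ n : ℤ in atBot, height J (g ^ n * x) = c) : Skewers g J := by
  obtain ⟨cp, cm, hc⟩ := h.exists_ends
  refine ⟨h, cp, cm, ?_, hc⟩
  rintro rfl
  exact hx cp (hc x).1 (hc x).2

/-- An edge at the left end of a periodic path whose period cannot be shortened is dual to a
hyperplane that is skewered by the period. -/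
lemma skewers_of_left_eq_nil {ε : ℕ → P.SignedEdge} {n : ℕ} (h : IsPeriodicPath ε n)
    (hmin : ∀ i, n ≤ (nf ((run ε i)⁻¹ * run ε (i + n))).length) {i : ℕ}
    (hi : (ε i).left = []) : Skewers (run ε n) (ofEdge (run ε i) (ε i)) := by
  have hdir : ∀ q (k : ℕ), ofEdge (run ε q) (ε q) = run ε n ^ k • ofEdge (run ε i) (ε i) →
      sign (ε q) = sign (ε i) := by
    intro q k hq
    rw [smul_ofEdge, ← h.run_pow, ← h.periodic_mul k i] at hq
    rw [sign_eq_iff, show (ε i).dir = (ε (i + k * n)).dir by rw [h.periodic_mul]]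
    have hi' : (ε (i + k * n)).left = [] := by rw [h.periodic_mul, hi]
    rcases lt_trichotomy q (i + k * n) with hlt | rfl | hlt
    · exact dir_eq_of_ofEdge_eq h hmin hlt (left_eq_nil_of_ofEdge hq hi') hq
    · rfl
    · exact (dir_eq_of_ofEdge_eq h hmin hlt hi' hq.symm).symm
  set J := ofEdge (run ε i) (ε i) with hJ
  have hz : ∀ N : ℕ, run ε n ^ N = run ε (N * n) := fun N => by
    have := h.run_pow N 0
    rw [zero_add] at this
    rw [this, run, mul_one]
  have hlt : ∀ N : ℕ, i < N * n → 0 < sign (ε i) * height J (run ε n ^ N) := by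
    intro N hN
    have := height_run_lt (a := 0) (b := N * n) (σ := sign (ε i)) (Nat.zero_le i) hN hJ.symm
      fun q _ _ hq => hdir q 0 (by rw [hq, pow_zero, one_smul])
    rwa [run, height_one, mul_zero, ← hz] at this
  have hle : ∀ N : ℕ, sign (ε i) * height J ((run ε n ^ N)⁻¹) ≤ 0 := by
    intro N
    have h1 := height_run_mono (σ := sign (ε i)) (J := run ε n ^ N • J) (Nat.zero_le (N * n))
      fun q _ _ hq => hdir q N hq
    rw [run, height_one, mul_zero, ← hz] at h1
    have h2 := height_smul_sub (run ε n ^ N)⁻¹ (run ε n ^ N) 1 J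
    rw [inv_mul_cancel, height_one, _root_.inv_inv, height_one, mul_one] at h2
    have : height J ((run ε n ^ N)⁻¹) = -height (run ε n ^ N • J) (run ε n ^ N) := by omega
    rw [this, mul_neg]
    omega
  have hpos := h.pos
  have hfree : FreeOrbit (run ε n) J := by
    intro k hk hkJ
    have h1 : run ε n ^ k.natAbs • J = J := by
      rcases Int.natAbs_eq k with h' | h'
      · rw [h', zpow_natCast] at hkJ
        exact hkJ
      · rw [h', zpow_neg, zpow_natCast, inv_smul_eq_iff] at hkJ
        exact hkJ.symm
    have h2 : (run ε n ^ (k.natAbs * (i + 1))) • J = J := by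
      rw [pow_mul, ← zpow_natCast]
      exact zpow_smul_eq_self h1 _
    have h3 := hlt (k.natAbs * (i + 1)) (by
      have : 0 < k.natAbs := Int.natAbs_pos.2 hk
      nlinarith [Nat.mul_le_mul this hpos, Nat.mul_le_mul (Nat.mul_le_mul this (le_refl (i + 1))) hpos])
    have h4 := height_mul_of_smul_eq h2 1
    rw [mul_one, height_one] at h4
    rw [h4, mul_zero] at h3
    exact lt_irrefl _ h3
  refine hfree.skewers (x := 1) fun c h1 h2 => ?_
  have h3 := tendsto_natCast_atTop_atTop (R := ℤ) |>.eventually h1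
  have h4 := (tendsto_neg_atTop_atBot.comp (tendsto_natCast_atTop_atTop (R := ℤ))).eventually h2
  obtain ⟨N, ⟨hN1, hN2⟩, hN3⟩ := ((h3.and h4).and (eventually_gt_atTop i)).exists
  simp only [Function.comp_apply, mul_one, zpow_natCast, zpow_neg] at hN1 hN2
  have h5 := hlt N (hN3.trans_le (Nat.le_mul_of_pos_right _ hpos))
  have h6 := hle N
  rw [hN1] at h5
  rw [hN2] at h6
  omega

/-! ### Transfer to longer words -/

lemma mk_whisker_eq_iff {k h h' : P.PathGroup} {p a b b' : List α} {r r' : P.rels} :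
    mk (k * whisker p [] h) (p ++ a) r b = mk (k * whisker p [] h') p r' b' ↔
      mk h a r b = mk h' [] r' b' := by
  rw [eq_comm, eq_comm (a := mk h a r b), mk_eq_mk_iff, mk_eq_mk_iff]
  refine and_congr_right ?_
  rintro rfl
  constructor
  · rintro ⟨A, hA, B, hB, h1⟩
    rw [mul_assoc, mul_right_inj] at h1
    have h2 := (inv_mul_eq_iff_eq_mul.2 h1).symm
    rw [← map_inv, ← map_mul] at h2
    have h3 := eq_one_of_whisker_mul_whisker hA h2
    subst h3
    have h4 := Hom.eq_of_one hA
    have h5 : a = [] := by simpa using h4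
    subst h5
    refine ⟨1, Hom.one _, B, hB, ?_⟩
    refine whisker_injective p [] ?_
    rw [h1]
    simp [sandwich, whisker_whisker]
  · rintro ⟨A, hA, B, hB, h1⟩
    have h2 := eq_nil_of_hom_nil (Hom.inv hA)
    subst h2
    have h3 := eq_one_of_hom_nil hA
    subst h3
    refine ⟨1, by simpa using Hom.one _, B, hB, ?_⟩
    rw [h1]
    simp [sandwich, whisker_whisker, mul_assoc]

lemma ofEdge_whisker (k h : P.PathGroup) (p : List α) (e : P.SignedEdge) :
    ofEdge (k * whisker p [] h) (e.whisker p []) =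
      mk (k * whisker p [] (cond e.dir h (h * e.val))) (p ++ e.left) e.rel e.right := by
  rcases e with ⟨l, r, _ | _, m⟩ <;> simp [ofEdge, SignedEdge.whisker, mul_assoc]

lemma height_whisker (k h x : P.PathGroup) (p : List α) (r : P.rels) (b : List α) :
    height (mk (k * whisker p [] h) p r b) (k * whisker p [] x) =
      height (mk (k * whisker p [] h) p r b) k + height (mk h [] r b) x := by
  induction x using eval_induction with
  | one => simp
  | step x e ih =>
    rw [map_mul, ← mul_assoc, whisker_val, height_mul_val, ih, height_mul_val, add_assoc]
    congr 2
    have h1 : ofEdge (k * whisker p [] x) (e.whisker p []) = mk (k * whisker p [] h) p r b ↔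
        ofEdge x e = mk h [] r b := by
      rw [ofEdge_whisker, mk_whisker_eq_iff, ofEdge]
    by_cases h2 : ofEdge x e = mk h [] r b
    · rw [if_pos h2, if_pos (h1.2 h2)]; rfl
    · rw [if_neg h2, if_neg (fun h3 => h2 (h1.1 h3))]

lemma Skewers.whisker {z h : P.PathGroup} {r : P.rels} {b : List α}
    (hz : Skewers z (mk h [] r b)) (k : P.PathGroup) (p : List α) :
    Skewers (k * SemigroupPresentation.whisker p [] z * k⁻¹)
      (mk (k * SemigroupPresentation.whisker p [] h) p r b) := by
  have hpow : ∀ i : ℤ, (k * SemigroupPresentation.whisker p [] z * k⁻¹) ^ i * k =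
      k * SemigroupPresentation.whisker p [] (z ^ i) := fun i => by
    rw [conj_zpow, inv_mul_cancel_right, map_zpow]
  obtain ⟨h1, cp, cm, hc, h2⟩ := hz
  refine FreeOrbit.skewers (x := k) (fun i hi hi' => ?_) fun c h3 h4 => ?_
  · rw [smul_mk, ← mul_assoc, hpow, mul_assoc, ← map_mul] at hi'
    have h3 := mk_whisker_eq_iff (a := []) (k := k) (p := p) (h := z ^ i * h) (h' := h)
      (r := r) (r' := r) (b := b) (b' := b)
    rw [List.append_nil] at h3
    exact h1 i hi (h3.1 hi')
  · simp only [hpow, height_whisker] at h3 h4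
    obtain ⟨m, hm, hm'⟩ := (h3.and (h2 1).1).exists
    obtain ⟨n, hn, hn'⟩ := (h4.and (h2 1).2).exists
    rw [mul_one] at hm' hn'
    rw [hm'] at hm
    rw [hn', ← hm] at hn
    exact hc (by omega)

/-- Every nontrivial closed path skewers a hyperplane `J` such that moving only the subwords to the
left of `J` commutes with the closed path. -/
theorem exists_leftmost {w : List α} {g : P.PathGroup} (hg : g ∈ P.Hom w w) (h1 : g ≠ 1) :
    ∃ (k : P.PathGroup) (p : List α) (r : P.rels) (b : List α),
      k ∈ P.Hom w (p ++ r.1.1 ++ b) ∧ Skewers g (mk k p r b) ∧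
      ∀ l ∈ leftStab (mk k p r b), Commute l g := by
  -- Conjugate `g` into the form `p + z`, where `z` is as short as possible.
  let S : Set (ℕ × ℕ) := {m | ∃ (k z : P.PathGroup) (p v : List α), k ∈ P.Hom w (p ++ v) ∧
    z ∈ P.Hom v v ∧ g = k * whisker p [] z * k⁻¹ ∧ m = ((nf z).length, v.length)}
  have hS : S.Nonempty := ⟨_, 1, g, [], w, Hom.one w, hg, by simp, rfl⟩
  have wf : WellFounded (Prod.Lex (· < ·) (· < ·) : ℕ × ℕ → ℕ × ℕ → Prop) :=
    WellFounded.prod_lex wellFounded_lt wellFounded_lt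
  obtain ⟨k, z, p, v, hk, hz, hgz, hm⟩ := wf.min_mem S hS
  have hmin : ∀ {k z : P.PathGroup} {p v : List α}, k ∈ P.Hom w (p ++ v) →
    z ∈ P.Hom v v → g = k * whisker p [] z * k⁻¹ →
    ¬ Prod.Lex (· < ·) (· < ·) ((nf z).length, v.length) (wf.min S hS) :=
    fun h1 h2 h3 => wf.not_lt_min S ⟨_, _, _, _, h1, h2, h3, rfl⟩
  rw [hm] at hmin
  have hz1 : nf z ≠ [] := by
    intro h
    apply h1
    have : z = 1 := by rw [← eval_nf z, h, eval_nil]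
    rw [hgz, this]; simp
  have hpath := Hom.isPath_nf hz
  -- By minimality, some edge of `z` is at the left end of a word.
  have hleft : ∃ e ∈ nf z, e.left = [] := by
    by_contra! hn
    cases v with
    | nil =>
      apply hz1
      rw [eq_one_of_hom_nil hz, nf_one]
    | cons x v =>
      obtain ⟨s', c', hc, hs, hp⟩ := IsPath.exists_of_forall_left_ne_nil hpath hn
      simp only [List.cons.injEq, true_and] at hc
      subst hc
      have hzs : z = whisker [x] [] (eval s') := by rw [whisker_eval, ← hs, eval_nf]
      refine hmin (k := k) (p := p ++ [x]) (z := eval s') (v := v) (by simpa using hk)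
        ⟨s', hp, rfl⟩ (by rw [hgz, hzs, whisker_whisker]; simp) ?_
      rw [hzs, length_nf_whisker]
      exact Prod.Lex.right _ (by simp)
  obtain ⟨ε, hε, hv, hrun, hall⟩ := exists_isPeriodicPath hpath hz1
  rw [eval_nf] at hrun
  obtain ⟨e, he, hel⟩ := hleft
  obtain ⟨i, rfl⟩ := hall e he
  have hrun0 : ∀ i, run ε i ∈ P.Hom v (source (ε i)) := fun i => by
    have := hε.run_mem 0 i
    rw [hv, run, inv_one, one_mul, zero_add] at this
    exact this
  have hshort : ∀ i, (nf z).length ≤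
      (nf ((run ε i)⁻¹ * run ε (i + (nf z).length))).length := by
    intro i
    by_contra! hlt
    have hmem := hε.run_mem i (nf z).length
    rw [hε.periodic] at hmem
    refine hmin (k := k * whisker p [] (run ε i)) (p := p) (v := source (ε i))
      (Hom.mul hk (Hom.whisker_left (hrun0 i) p)) hmem ?_ (Prod.Lex.left _ _ hlt)
    rw [hε.run_add, hrun, hgz]
    simp [mul_assoc]
  have hsk := skewers_of_left_eq_nil hε hshort hel
  rw [hrun] at hsk
  obtain ⟨h, hh, hJ⟩ : ∃ h ∈ P.Hom v ((ε i).rel.1.1 ++ (ε i).right),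
      ofEdge (run ε i) (ε i) = mk h [] (ε i).rel (ε i).right := by
    have h2 := hrun0 i
    have h3 := Hom.val (ε i)
    unfold source at h2
    unfold ofEdge
    rw [hel] at h2 h3 ⊢
    revert h2 h3
    generalize hf : ε i = f
    rcases f with ⟨l, r, _ | _, m⟩
    · intro h2 h3
      refine ⟨_, ?_, rfl⟩
      have := Hom.mul h2 h3
      simpa [tgt] using this
    · intro h2 h3
      refine ⟨_, ?_, rfl⟩
      simpa [src] using h2
  rw [hJ] at hsk
  refine ⟨k * whisker p [] h, p, (ε i).rel, (ε i).right, ?_, ?_, ?_⟩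
  · rw [List.append_assoc]
    exact Hom.mul hk (Hom.whisker_left hh p)
  · rw [hgz]
    exact hsk.whisker k p
  · intro l hl
    obtain ⟨A, hA, rfl⟩ := mem_leftStab_mk.1 hl
    have h2 := interchange hA (Hom.mul (Hom.mul (Hom.inv hh) hz) hh)
    have h3 : g = k * whisker p [] h * whisker p [] (h⁻¹ * z * h) * (k * whisker p [] h)⁻¹ := by
      rw [hgz]; simp [mul_assoc]
    rw [h3]
    exact (show Commute _ _ from h2).conj _

end Hyperplane

end Leftmost

/-! ### Diagram groups as subgroups of the path group -/

section Bridge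

variable {α : Type v} {P : SemigroupPresentation α}

open PathGroup SignedEdge

/-- An edge of the Squier complex, as a morphism of the fundamental groupoid. -/
def edgeHom {x y : P.Vertex} (e : P.Edge x y) : P.basepoint x ⟶ P.basepoint y :=
  (CategoryTheory.Quotient.functor P.SquareRel).map (P.edgePath e)

lemma hom_induction {x : P.Vertex}
    {p : ∀ y : P.Vertex, (P.basepoint x ⟶ P.basepoint y) → Prop} (id : p x (𝟙 _))
    (edge : ∀ y z (m : P.basepoint x ⟶ P.basepoint y) (e : P.Edge y z), p y m →
      p z (m ≫ edgeHom e))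
    (inv : ∀ y z (m : P.basepoint x ⟶ P.basepoint y) (e : P.Edge z y), p y m →
      p z (m ≫ Groupoid.inv (edgeHom e)))
    (y : P.Vertex) (m : P.basepoint x ⟶ P.basepoint y) : p y m := by
  obtain ⟨m, rfl⟩ := (CategoryTheory.Quotient.functor P.SquareRel).map_surjective m
  obtain ⟨m, rfl⟩ := Quot.exists_rep m
  have key : ∀ (y : P.Vertex) (m : @Quiver.Path (Quiver.Symmetrify P.Vertex) _ x y),
      p y ((CategoryTheory.Quotient.functor P.SquareRel).map (Quot.mk _ m)) := by
    intro y m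
    induction m with
    | nil => exact id
    | cons q e ih =>
      rcases e with e | e
      · exact edge _ _ _ e ih
      · exact inv _ _ _ e ih
  exact key y m

/-- The functor that sends a path to the product of its edges, before squares are taken into
account. -/
def freePathFunctor (P : SemigroupPresentation α) :
    P.FreePathGroupoid ⥤ SingleObj (P.PathGroupᵐᵒᵖ) :=
  Quiver.FreeGroupoid.lift
    { obj := fun _ => SingleObj.star P.PathGroupᵐᵒᵖ
      map := fun (e : P.Edge _ _) => (MulOpposite.op (edge e.left e.rel e.right) : P.PathGroupᵐᵒᵖ) }

lemma freePathFunctor_edgePath {x y : P.Vertex} (e : P.Edge x y) :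
    P.freePathFunctor.map (P.edgePath e) =
      (MulOpposite.op (edge e.left e.rel e.right) : P.PathGroupᵐᵒᵖ) :=
  mul_one (MulOpposite.op (edge e.left e.rel e.right) : P.PathGroupᵐᵒᵖ)

/-- The functor that sends a path to the product of its edges. -/
def pathFunctor (P : SemigroupPresentation α) :
    P.SquierGroupoid ⥤ SingleObj (P.PathGroupᵐᵒᵖ) :=
  CategoryTheory.Quotient.lift P.SquareRel P.freePathFunctor (by
    rintro _ _ _ _ ⟨a, b, c, r, s, x, y, z, t, hx, hy, hz, ht⟩
    rw [Functor.map_comp, Functor.map_comp, freePathFunctor_edgePath, freePathFunctor_edgePath,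
      freePathFunctor_edgePath, freePathFunctor_edgePath]
    exact congrArg MulOpposite.op (edge_square a b c r s))

/-- The product of the edges of a path. -/
def toPathGroup {x y : P.SquierGroupoid} (m : x ⟶ y) : P.PathGroup :=
  MulOpposite.unop ((pathFunctor P).map m)

@[simp] lemma toPathGroup_id (x : P.SquierGroupoid) : toPathGroup (𝟙 x) = 1 := by
  unfold toPathGroup
  rw [CategoryTheory.Functor.map_id]
  rfl

@[simp] lemma toPathGroup_comp {x y z : P.SquierGroupoid} (m : x ⟶ y) (n : y ⟶ z) :
    toPathGroup (m ≫ n) = toPathGroup m * toPathGroup n := by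
  unfold toPathGroup
  rw [Functor.map_comp]
  rfl

@[simp] lemma toPathGroup_edgeHom {x y : P.Vertex} (e : P.Edge x y) :
    toPathGroup (edgeHom e) = edge e.left e.rel e.right :=
  congrArg MulOpposite.unop (freePathFunctor_edgePath e)

@[simp] lemma toPathGroup_inv {x y : P.SquierGroupoid} (m : x ⟶ y) :
    toPathGroup (Groupoid.inv m) = (toPathGroup m)⁻¹ := by
  rw [eq_inv_iff_mul_eq_one, ← toPathGroup_comp, Groupoid.inv_comp, toPathGroup_id]

lemma edgeHom_square (a b c : List α) (r s : P.rels) (x y z t : P.Vertex)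
    (e₁ : P.Edge x y) (e₂ : P.Edge y t) (e₃ : P.Edge x z) (e₄ : P.Edge z t)
    (h₁ : e₁.left = a ∧ e₁.rel = r ∧ e₁.right = b ++ s.1.1 ++ c)
    (h₂ : e₂.left = a ++ r.1.2 ++ b ∧ e₂.rel = s ∧ e₂.right = c)
    (h₃ : e₃.left = a ++ r.1.1 ++ b ∧ e₃.rel = s ∧ e₃.right = c)
    (h₄ : e₄.left = a ∧ e₄.rel = r ∧ e₄.right = b ++ s.1.2 ++ c) :
    edgeHom e₁ ≫ edgeHom e₂ = edgeHom e₃ ≫ edgeHom e₄ := by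
  rcases e₁ with ⟨_, _, _, p₁, q₁⟩
  rcases e₂ with ⟨_, _, _, p₂, q₂⟩
  rcases e₃ with ⟨_, _, _, p₃, q₃⟩
  rcases e₄ with ⟨_, _, _, p₄, q₄⟩
  simp only at h₁ h₂ h₃ h₄
  obtain ⟨rfl, rfl, rfl⟩ := h₁
  obtain ⟨rfl, rfl, rfl⟩ := h₂
  obtain ⟨rfl, rfl, rfl⟩ := h₃
  obtain ⟨rfl, rfl, rfl⟩ := h₄
  have := CategoryTheory.Quotient.sound P.SquareRel (SquareRel.square (P := P) _ _ _ _ _ x y z t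
    (by simpa using p₁) (by simpa using q₁) (by simpa using q₃) (by simpa using q₂))
  rw [Functor.map_comp, Functor.map_comp] at this
  exact this

/-- The vertex at the source of the edge `[a, r, b]`. -/
def sourceVertex (a : List α) (r : P.rels) (b : List α) : P.Vertex :=
  ⟨a ++ r.1.1 ++ b, by simp [P.left_ne_nil _ r.2]⟩

/-- The vertex at the target of the edge `[a, r, b]`. -/
def targetVertex (a : List α) (r : P.rels) (b : List α) : P.Vertex :=
  ⟨a ++ r.1.2 ++ b, by simp [P.right_ne_nil _ r.2]⟩

/-- The edge `[a, r, b]`. -/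
def mkEdge (a : List α) (r : P.rels) (b : List α) :
    P.Edge (sourceVertex a r b) (targetVertex a r b) := ⟨a, r, b, rfl, rfl⟩

open Classical in
/-- A chosen path from the vertex `w` to the vertex `y`, if there is one. -/
noncomputable def chosenPath (w y : P.Vertex) (h : Nonempty (P.basepoint w ⟶ P.basepoint y)) :
    P.basepoint w ⟶ P.basepoint y := h.some

open Classical in
/-- The closed path that follows an edge and returns along the chosen paths. -/
noncomputable def edgeLoop (w : P.Vertex) (a : List α) (r : P.rels) (b : List α) :
    P.DiagramGroup w :=
  if h : Nonempty (P.basepoint w ⟶ P.basepoint (sourceVertex a r b)) then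
    chosenPath w _ h ≫ edgeHom (mkEdge a r b) ≫
      Groupoid.inv (chosenPath w _ ⟨h.some ≫ edgeHom (mkEdge a r b)⟩)
  else 1

lemma edgeLoop_of_nonempty {w x y : P.Vertex} (e : P.Edge x y)
    (hx : Nonempty (P.basepoint w ⟶ P.basepoint x))
    (hy : Nonempty (P.basepoint w ⟶ P.basepoint y)) :
    edgeLoop w e.left e.rel e.right =
      chosenPath w x hx ≫ edgeHom e ≫ Groupoid.inv (chosenPath w y hy) := by
  rcases x with ⟨x, hx0⟩
  rcases y with ⟨y, hy0⟩
  rcases e with ⟨a, r, b, hx', hy'⟩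
  simp only at hx' hy'
  subst hx' hy'
  exact dif_pos hx

lemma edgeLoop_of_isEmpty {w x y : P.Vertex} (e : P.Edge x y)
    (hx : ¬ Nonempty (P.basepoint w ⟶ P.basepoint x)) :
    edgeLoop w e.left e.rel e.right = 1 := by
  rcases x with ⟨x, hx0⟩
  rcases y with ⟨y, hy0⟩
  rcases e with ⟨a, r, b, hx', hy'⟩
  simp only at hx' hy'
  subst hx' hy'
  exact dif_neg hx

/-- A retraction of the path group onto a diagram group. -/
noncomputable def toDiagramGroup (w : P.Vertex) : P.PathGroup →* P.DiagramGroup w :=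
  PathGroup.lift (edgeLoop w) (by
    intro a b c r s
    let x : P.Vertex := ⟨a ++ r.1.1 ++ b ++ s.1.1 ++ c, by simp [P.left_ne_nil _ r.2]⟩
    let y : P.Vertex := ⟨a ++ r.1.2 ++ b ++ s.1.1 ++ c, by simp [P.right_ne_nil _ r.2]⟩
    let z : P.Vertex := ⟨a ++ r.1.1 ++ b ++ s.1.2 ++ c, by simp [P.left_ne_nil _ r.2]⟩
    let t : P.Vertex := ⟨a ++ r.1.2 ++ b ++ s.1.2 ++ c, by simp [P.right_ne_nil _ r.2]⟩
    let e₁ : P.Edge x y := ⟨a, r, b ++ s.1.1 ++ c, by simp [x], by simp [y]⟩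
    let e₂ : P.Edge y t := ⟨a ++ r.1.2 ++ b, s, c, by simp [y], by simp [t]⟩
    let e₃ : P.Edge x z := ⟨a ++ r.1.1 ++ b, s, c, by simp [x], by simp [z]⟩
    let e₄ : P.Edge z t := ⟨a, r, b ++ s.1.2 ++ c, by simp [z], by simp [t]⟩
    change edgeLoop w e₁.left e₁.rel e₁.right * edgeLoop w e₂.left e₂.rel e₂.right =
      edgeLoop w e₃.left e₃.rel e₃.right * edgeLoop w e₄.left e₄.rel e₄.right
    by_cases hx : Nonempty (P.basepoint w ⟶ P.basepoint x)
    · have hy : Nonempty (P.basepoint w ⟶ P.basepoint y) := ⟨hx.some ≫ edgeHom e₁⟩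
      have hz : Nonempty (P.basepoint w ⟶ P.basepoint z) := ⟨hx.some ≫ edgeHom e₃⟩
      have ht : Nonempty (P.basepoint w ⟶ P.basepoint t) := ⟨hy.some ≫ edgeHom e₂⟩
      have hsq := edgeHom_square a b c r s x y z t e₁ e₂ e₃ e₄ ⟨rfl, rfl, rfl⟩ ⟨rfl, rfl, rfl⟩
        ⟨rfl, rfl, rfl⟩ ⟨rfl, rfl, rfl⟩
      rw [edgeLoop_of_nonempty e₁ hx hy, edgeLoop_of_nonempty e₂ hy ht,
        edgeLoop_of_nonempty e₃ hx hz, edgeLoop_of_nonempty e₄ hz ht]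
      change (_ ≫ _ ≫ _) ≫ _ ≫ _ ≫ _ = (_ ≫ _ ≫ _) ≫ _ ≫ _ ≫ _
      have h : ∀ {v : P.Vertex} (e : P.Edge x v) (f : P.Edge v t)
          (hv : Nonempty (P.basepoint w ⟶ P.basepoint v)),
          (chosenPath w x hx ≫ edgeHom e ≫ Groupoid.inv (chosenPath w v hv)) ≫
            chosenPath w v hv ≫ edgeHom f ≫ Groupoid.inv (chosenPath w t ht) =
          chosenPath w x hx ≫ (edgeHom e ≫ edgeHom f) ≫ Groupoid.inv (chosenPath w t ht) := by
        intro v e f hv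
        simp
      rw [h, h, hsq]
    · have hy : ¬ Nonempty (P.basepoint w ⟶ P.basepoint y) := fun h =>
        hx ⟨h.some ≫ Groupoid.inv (edgeHom e₁)⟩
      have hz : ¬ Nonempty (P.basepoint w ⟶ P.basepoint z) := fun h =>
        hx ⟨h.some ≫ Groupoid.inv (edgeHom e₃)⟩
      rw [edgeLoop_of_isEmpty e₁ hx, edgeLoop_of_isEmpty e₂ hy, edgeLoop_of_isEmpty e₃ hx,
        edgeLoop_of_isEmpty e₄ hz])

lemma toDiagramGroup_toPathGroup {w y : P.Vertex} (m : P.basepoint w ⟶ P.basepoint y) :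
    toDiagramGroup w (toPathGroup m) =
      chosenPath w w ⟨𝟙 _⟩ ≫ m ≫ Groupoid.inv (chosenPath w y ⟨m⟩) := by
  induction y, m using hom_induction with
  | id =>
    rw [toPathGroup_id, map_one]
    change 𝟙 _ = _
    simp
  | edge y z m e ih =>
    rw [toPathGroup_comp, map_mul, ih, toPathGroup_edgeHom, toDiagramGroup, lift_edge,
      edgeLoop_of_nonempty e ⟨m⟩ ⟨m ≫ edgeHom e⟩]
    change (_ ≫ _ ≫ _) ≫ _ ≫ _ ≫ _ = _
    simp
  | inv y z m e ih =>
    rw [toPathGroup_comp, map_mul, ih, toPathGroup_inv, toPathGroup_edgeHom, map_inv,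
      toDiagramGroup, lift_edge,
      edgeLoop_of_nonempty e ⟨m ≫ Groupoid.inv (edgeHom e)⟩ ⟨m⟩]
    change (_ ≫ _ ≫ _) ≫ Groupoid.inv (_ ≫ _ ≫ _) = _
    simp

lemma toPathGroup_mem {w y : P.Vertex} (m : P.basepoint w ⟶ P.basepoint y) :
    toPathGroup m ∈ P.Hom w.word y.word := by
  induction y, m using hom_induction with
  | id => rw [toPathGroup_id]; exact Hom.one _
  | edge y z m e ih =>
    rw [toPathGroup_comp, toPathGroup_edgeHom]
    refine Hom.mul ih ?_
    have := Hom.val (⟨e.left, e.rel, true, e.right⟩ : P.SignedEdge)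
    rw [e.source_eq, e.target_eq]
    exact this
  | inv y z m e ih =>
    rw [toPathGroup_comp, toPathGroup_inv, toPathGroup_edgeHom]
    refine Hom.mul ih (Hom.inv ?_)
    have := Hom.val (⟨e.left, e.rel, true, e.right⟩ : P.SignedEdge)
    rw [e.source_eq, e.target_eq]
    exact this

lemma exists_toPathGroup_eq {w : P.Vertex} {b : List α} {g : P.PathGroup}
    (hg : g ∈ P.Hom w.word b) : ∃ (y : P.Vertex) (m : P.basepoint w ⟶ P.basepoint y),
      y.word = b ∧ toPathGroup m = g := by
  obtain ⟨s, hs, rfl⟩ := hg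
  induction s generalizing b with
  | nil => exact ⟨w, 𝟙 _, hs, toPathGroup_id _⟩
  | cons e s ih =>
    obtain ⟨rfl, hs⟩ := hs
    obtain ⟨y, m, hy, hm⟩ := ih hs
    let z : P.Vertex := ⟨e.left ++ e.tgt ++ e.right, by simp [e.tgt_ne_nil]⟩
    rcases e with ⟨l, r, _ | _, b⟩
    · refine ⟨z, m ≫ Groupoid.inv (edgeHom (⟨l, r, b, rfl, hy⟩ : P.Edge z y)), rfl, ?_⟩
      rw [toPathGroup_comp, toPathGroup_inv, toPathGroup_edgeHom, hm, eval_cons]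
      rfl
    · refine ⟨z, m ≫ edgeHom (⟨l, r, b, hy, rfl⟩ : P.Edge y z), rfl, ?_⟩
      rw [toPathGroup_comp, toPathGroup_edgeHom, hm, eval_cons]
      rfl

/-- The diagram group `D(P, w)` is the group of closed paths at `w` in the path group. -/
noncomputable def diagramGroupEquiv (w : P.Vertex) : P.DiagramGroup w ≃* P.loops w.word :=
  MulEquiv.ofBijective
    { toFun := fun m => ⟨toPathGroup m, toPathGroup_mem m⟩
      map_one' := Subtype.ext (toPathGroup_id (P.basepoint w))
      map_mul' := fun m n => Subtype.ext (toPathGroup_comp m n) :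
      P.DiagramGroup w →* P.loops w.word } (by
    constructor
    · intro m n h
      have h1 : toPathGroup m = toPathGroup n := congrArg Subtype.val h
      have h2 := congrArg (toDiagramGroup w) h1
      rw [toDiagramGroup_toPathGroup, toDiagramGroup_toPathGroup] at h2
      have h3 := congrArg (fun x => Groupoid.inv (chosenPath w w ⟨𝟙 _⟩) ≫ x ≫
        chosenPath w w ⟨𝟙 _⟩) h2
      simpa using h3
    · rintro ⟨g, hg⟩
      obtain ⟨⟨y, hy⟩, m, rfl, rfl⟩ := exists_toPathGroup_eq hg
      exact ⟨m, rfl⟩)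

end Bridge

end SemigroupPresentation

/-! ### Centralizers in right-angled Artin groups -/

section FreeGroup

/-- In a free group, a basis element `t` satisfies `F tᵐ = tᵐ σ(F)`, where `m ≠ 0` and where `σ`
permutes the basis and fixes `t`, only if `F` is a power of `t`. -/
lemma FreeGroup.exists_eq_zpow_of_mul_zpow_eq {T : Type*} {t : T} (σ : Equiv.Perm T)
    (hσ : σ t = t) {m : ℤ} (hm : m ≠ 0) {F : FreeGroup T}
    (h : F * FreeGroup.of t ^ m = FreeGroup.of t ^ m * FreeGroup.map σ F) :
    ∃ k : ℤ, F = FreeGroup.of t ^ k := by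
  classical
  have word : ∀ (σ : Equiv.Perm T) (F : FreeGroup T),
      (FreeGroup.map σ F).toWord = F.toWord.map fun x => (σ x.1, x.2) := by
    intro σ F
    have hr : FreeGroup.IsReduced (F.toWord.map fun x => (σ x.1, x.2)) := by
      refine (List.isChain_map _).2 (List.IsChain.imp ?_ FreeGroup.isReduced_toWord)
      intro a b hab hab'
      exact hab (σ.injective hab')
    conv_lhs => rw [← FreeGroup.mk_toWord (x := F)]
    rw [FreeGroup.map.mk, FreeGroup.toWord_mk]
    exact hr.reduce_eq
  -- Positive exponents: remove powers of `t` from the beginning of `F`; the remaining word `G` has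
  -- no cancellation in `tᵐ σ(G)`, hence none in `G tᵐ`, so that it would begin with `t`.
  have pos : ∀ (σ : Equiv.Perm T), σ t = t → ∀ (m : ℕ), m ≠ 0 → ∀ (n : ℕ) (F : FreeGroup T),
      F.norm ≤ n → F * FreeGroup.of t ^ m = FreeGroup.of t ^ m * FreeGroup.map σ F →
      ∃ k : ℤ, F = FreeGroup.of t ^ k := by
    intro σ hσ m hm n
    induction n with
    | zero =>
      intro F hF _
      exact ⟨0, by rw [zpow_zero]; exact FreeGroup.norm_eq_zero.1 (Nat.le_zero.1 hF)⟩
    | succ n ih =>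
      intro F hF h
      rcases hL : F.toWord with _ | ⟨⟨c, b⟩, L⟩
      · exact ⟨0, by rw [zpow_zero]; exact FreeGroup.toWord_eq_nil_iff.1 hL⟩
      · by_cases hc : c = t
        · subst hc
          have key : ∀ ε : ℤ, FreeGroup.mk [(c, b)] = FreeGroup.of c ^ ε →
              ∃ k : ℤ, F = FreeGroup.of c ^ k := by
            intro ε hε
            have hFL : F = FreeGroup.of c ^ ε * FreeGroup.mk L := by
              rw [← hε, FreeGroup.mul_mk, ← FreeGroup.mk_toWord (x := F), hL]; rfl
            obtain ⟨k, hk⟩ := ih (FreeGroup.mk L) (by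
              refine FreeGroup.norm_mk_le.trans ?_
              rw [FreeGroup.norm, hL, List.length_cons] at hF
              omega) (by
              rw [hFL, _root_.map_mul, _root_.map_zpow, FreeGroup.map.of, hσ, mul_assoc] at h
              rw [← mul_right_inj (FreeGroup.of c ^ ε), h, ← mul_assoc, ← mul_assoc]
              congr 1
              rw [← zpow_natCast, ← zpow_add, ← zpow_add, add_comm])
            exact ⟨ε + k, by rw [hFL, hk, zpow_add]⟩
          cases b
          · exact key (-1) (by rw [zpow_neg_one]; rfl)
          · exact key 1 (by rw [zpow_one]; rfl)
        · exfalso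
          have h1 : (FreeGroup.of t ^ m * FreeGroup.map σ F).toWord =
              List.replicate m (t, true) ++ (FreeGroup.map σ F).toWord := by
            rw [FreeGroup.toWord_mul, FreeGroup.toWord_of_pow]
            refine FreeGroup.IsReduced.reduce_eq (List.isChain_append.2
              ⟨?_, FreeGroup.isReduced_toWord, ?_⟩)
            · exact List.isChain_replicate_of_rel _ fun _ => rfl
            · intro x hx y hy hxy
              have hx' := List.mem_of_mem_getLast? hx
              rw [List.mem_replicate] at hx'
              rw [word, hL] at hy
              simp only [List.map_cons, List.head?_cons, Option.mem_some_iff] at hy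
              subst hy
              rw [hx'.2] at hxy
              exact absurd (σ.injective (hσ.trans hxy)).symm hc
          have h2 := FreeGroup.toWord_mul_sublist F (FreeGroup.of t ^ m)
          rw [FreeGroup.toWord_of_pow] at h2
          have h3 := h2.eq_of_length (by
            rw [h, h1, word]
            simp [add_comm])
          rw [h, h1, hL] at h3
          obtain ⟨m, rfl⟩ := Nat.exists_eq_succ_of_ne_zero hm
          rw [List.replicate_succ, List.cons_append, List.cons_append, List.cons.injEq] at h3
          exact hc (congrArg Prod.fst h3.1).symm
  obtain ⟨n, rfl | rfl⟩ := Int.eq_nat_or_neg m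
  · rw [zpow_natCast] at h
    exact pos σ hσ n (by simpa using hm) _ F le_rfl h
  · rw [zpow_neg, zpow_natCast, mul_inv_eq_iff_eq_mul, mul_assoc, eq_inv_mul_iff_mul_eq] at h
    have hmap : FreeGroup.map σ.symm (FreeGroup.map σ F) = F := by
      rw [FreeGroup.map.comp]
      simp
    obtain ⟨k, hk⟩ := pos σ.symm (by rw [Equiv.symm_apply_eq, hσ]) n (by simpa using hm) _
      (FreeGroup.map σ F) le_rfl (by rw [hmap, h])
    refine ⟨k, ?_⟩
    rw [← hmap, hk, _root_.map_zpow, FreeGroup.map.of, (Equiv.symm_apply_eq σ).2 hσ.symm]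

end FreeGroup

/-- The integral Heisenberg group. -/
@[ext]
structure Heisenberg where
  x : ℤ
  y : ℤ
  z : ℤ

namespace Heisenberg

instance : Mul Heisenberg := ⟨fun g h => ⟨g.x + h.x, g.y + h.y, g.z + h.z + g.x * h.y⟩⟩
instance : One Heisenberg := ⟨⟨0, 0, 0⟩⟩
instance : Inv Heisenberg := ⟨fun g => ⟨-g.x, -g.y, -g.z + g.x * g.y⟩⟩

@[simp] lemma mul_x (g h : Heisenberg) : (g * h).x = g.x + h.x := rfl
@[simp] lemma mul_y (g h : Heisenberg) : (g * h).y = g.y + h.y := rfl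
@[simp] lemma mul_z (g h : Heisenberg) : (g * h).z = g.z + h.z + g.x * h.y := rfl
@[simp] lemma one_x : (1 : Heisenberg).x = 0 := rfl
@[simp] lemma one_y : (1 : Heisenberg).y = 0 := rfl
@[simp] lemma one_z : (1 : Heisenberg).z = 0 := rfl
@[simp] lemma inv_x (g : Heisenberg) : g⁻¹.x = -g.x := rfl
@[simp] lemma inv_y (g : Heisenberg) : g⁻¹.y = -g.y := rfl
@[simp] lemma inv_z (g : Heisenberg) : g⁻¹.z = -g.z + g.x * g.y := rfl

instance : Group Heisenberg :=
  Group.ofLeftAxioms (fun a b c => by ext <;> simp <;> ring) (fun a => by ext <;> simp)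
    (fun a => by ext <;> simp)

lemma mul_eq_of_commute {g h : Heisenberg} (hgh : Commute g h) : g.x * h.y = g.y * h.x := by
  have := congrArg z hgh.eq
  simp only [mul_z] at this
  linarith

end Heisenberg

namespace RightAngledArtinGroup

variable {V : Type u} {Γ : SimpleGraph V}

/-- The generator given by the vertex `v`. -/
def gen (Γ : SimpleGraph V) (v : V) : RightAngledArtinGroup Γ := PresentedGroup.of v

lemma gen_commute {a b : V} (h : Γ.Adj a b) : Commute (gen Γ a) (gen Γ b) := by
  have h1 := PresentedGroup.one_of_mem (rels := {g : FreeGroup V | ∃ a b : V, Γ.Adj a b ∧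
      g = FreeGroup.of a * FreeGroup.of b * (FreeGroup.of a)⁻¹ * (FreeGroup.of b)⁻¹})
    ⟨a, b, h, rfl⟩
  rw [map_mul, map_mul, map_mul, map_inv, map_inv, mul_inv_eq_one, mul_inv_eq_iff_eq_mul] at h1
  exact h1

/-- A homomorphism out of a right-angled Artin group is given by a map on the vertices under which
adjacent vertices have commuting images. -/
def lift {G : Type*} [Group G] (f : V → G) (hf : ∀ a b, Γ.Adj a b → Commute (f a) (f b)) :
    RightAngledArtinGroup Γ →* G :=
  PresentedGroup.toGroup (f := f) (by
    rintro _ ⟨a, b, h, rfl⟩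
    simp only [map_mul, map_inv, FreeGroup.lift_apply_of]
    rw [mul_inv_eq_one, mul_inv_eq_iff_eq_mul]
    exact hf a b h)

@[simp] lemma lift_gen {G : Type*} [Group G] (f : V → G)
    (hf : ∀ a b, Γ.Adj a b → Commute (f a) (f b)) (v : V) : lift f hf (gen Γ v) = f v :=
  PresentedGroup.toGroup.of _

lemma hom_ext {G : Type*} [Group G] {f g : RightAngledArtinGroup Γ →* G}
    (h : ∀ v, f (gen Γ v) = g (gen Γ v)) : f = g :=
  PresentedGroup.ext h

open Classical in
/-- The exponent sum of the generator `u`. -/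
noncomputable def exponent (u : V) : RightAngledArtinGroup Γ →* Multiplicative ℤ :=
  lift (fun v => if v = u then Multiplicative.ofAdd 1 else 1) fun _ _ _ => Commute.all _ _

/-- The exponent sum of the generator `u`, as an integer. -/
noncomputable def expSum (u : V) (x : RightAngledArtinGroup Γ) : ℤ := (exponent u x).toAdd

@[simp] lemma expSum_mul (u : V) (x y : RightAngledArtinGroup Γ) :
    expSum u (x * y) = expSum u x + expSum u y := by simp [expSum]

@[simp] lemma expSum_zpow (u : V) (x : RightAngledArtinGroup Γ) (n : ℤ) :
    expSum u (x ^ n) = n * expSum u x := by simp [expSum]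

@[simp] lemma expSum_gen_self (u : V) : expSum u (gen Γ u) = 1 := by simp [expSum, exponent]

lemma expSum_gen_of_ne {u v : V} (h : v ≠ u) : expSum u (gen Γ v) = 0 := by
  simp [expSum, exponent, h]

/-- The exponent sums of commuting elements at two vertices which are not adjacent are
proportional, since they are so in the Heisenberg group. -/
lemma expSum_mul_eq_of_commute {u v : V} (huv : u ≠ v) (hadj : ¬ Γ.Adj u v)
    {x y : RightAngledArtinGroup Γ} (h : Commute x y) :
    expSum u x * expSum v y = expSum v x * expSum u y := by
  classical
  let ρ : RightAngledArtinGroup Γ →* Heisenberg :=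
    lift (fun w => if w = u then ⟨1, 0, 0⟩ else if w = v then ⟨0, 1, 0⟩ else 1) (by
      intro a b hab
      have hba := hab.symm
      have hne := hab.ne
      by_cases h1 : a = u <;> by_cases h2 : b = u <;> by_cases h3 : a = v <;>
        by_cases h4 : b = v <;> simp_all)
  let px : Heisenberg →* Multiplicative ℤ :=
    { toFun := fun g => Multiplicative.ofAdd g.x, map_one' := rfl, map_mul' := fun _ _ => rfl }
  let py : Heisenberg →* Multiplicative ℤ :=
    { toFun := fun g => Multiplicative.ofAdd g.y, map_one' := rfl, map_mul' := fun _ _ => rfl }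
  have hx : px.comp ρ = exponent u := hom_ext fun w => by
    by_cases h1 : w = u
    · simp [px, ρ, exponent, h1]
    · by_cases h2 : w = v <;> simp [px, ρ, exponent, h1, h2, huv.symm]
  have hy : py.comp ρ = exponent v := hom_ext fun w => by
    by_cases h1 : w = u
    · simp [py, ρ, exponent, h1, huv]
    · by_cases h2 : w = v <;> simp [py, ρ, exponent, h1, h2, huv.symm]
  have hx' : ∀ g, expSum u g = (ρ g).x := fun g => by rw [expSum, ← hx]; rfl
  have hy' : ∀ g, expSum v g = (ρ g).y := fun g => by rw [expSum, ← hy]; rfl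
  rw [hx', hy', hx', hy']
  exact Heisenberg.mul_eq_of_commute (h.map ρ)

/-- The subgroup generated by the neighbours of `a`. -/
def link (Γ : SimpleGraph V) (a : V) : Subgroup (RightAngledArtinGroup Γ) :=
  Subgroup.closure (gen Γ '' Γ.neighborSet a)

lemma link_le {a : V} {S : Subgroup (RightAngledArtinGroup Γ)}
    (h : ∀ v, Γ.Adj a v → gen Γ v ∈ S) : link Γ a ≤ S := by
  rw [link, Subgroup.closure_le]
  rintro _ ⟨v, hv, rfl⟩
  exact h v hv

lemma gen_mem_link {a b : V} (h : Γ.Adj a b) : gen Γ b ∈ link Γ a :=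
  Subgroup.subset_closure ⟨b, h, rfl⟩

lemma commute_of_mem_link {a : V} {x : RightAngledArtinGroup Γ} (hx : x ∈ link Γ a) :
    Commute (gen Γ a) x := by
  induction hx using Subgroup.closure_induction with
  | mem x hx => obtain ⟨b, hb, rfl⟩ := hx; exact gen_commute hb
  | one => exact Commute.one_right _
  | mul x y _ _ hx hy => exact hx.mul_right hy
  | inv x _ hx => exact hx.inv_right

lemma not_adj_of_adj_of_adj (hΓ : Γ.CliqueFree 3) {a b c : V} (hab : Γ.Adj a b)
    (hac : Γ.Adj a c) : ¬ Γ.Adj b c := by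
  classical
  exact fun h => hΓ {a, b, c} (SimpleGraph.is3Clique_triple_iff.2 ⟨hab, hac, h⟩)

/-- In a triangle-free graph, the links of adjacent vertices are disjoint, and so are the subgroups
that they generate. -/
lemma eq_one_of_mem_link_of_mem_link (hΓ : Γ.CliqueFree 3) {a b : V} (hab : Γ.Adj a b)
    {x : RightAngledArtinGroup Γ} (hxa : x ∈ link Γ a) (hxb : x ∈ link Γ b) : x = 1 := by
  classical
  let ρ : RightAngledArtinGroup Γ →* RightAngledArtinGroup Γ :=
    lift (fun v => if Γ.Adj a v then gen Γ v else 1) (by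
      intro v w hvw
      by_cases h1 : Γ.Adj a v <;> by_cases h2 : Γ.Adj a w <;> simp [h1, h2, gen_commute hvw])
  have h1 : link Γ a ≤ ρ.eqLocus (MonoidHom.id _) := link_le fun v hv => by
    change ρ (gen Γ v) = gen Γ v
    simp [ρ, hv]
  have h2 : link Γ b ≤ ρ.ker := link_le fun v hv => by
    have hv' : ¬ Γ.Adj a v := not_adj_of_adj_of_adj hΓ hab.symm hv
    change ρ (gen Γ v) = 1
    simp [ρ, hv']
  exact (h1 hxa : ρ x = x).symm.trans (h2 hxb)

/-- The cosets of the link of `a` form the basis of a free group on which `A(Γ)` acts. -/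
def cosetAut (Γ : SimpleGraph V) (a : V) :
    RightAngledArtinGroup Γ →* MulAut (FreeGroup (RightAngledArtinGroup Γ ⧸ link Γ a)) where
  toFun g := FreeGroup.freeGroupCongr (MulAction.toPerm g)
  map_one' := by
    ext x
    induction x using FreeGroup.induction_on <;> simp_all
  map_mul' g h := by
    ext x
    induction x using FreeGroup.induction_on <;> simp_all [mul_smul]

lemma cosetAut_of (a : V) (g h : RightAngledArtinGroup Γ) :
    cosetAut Γ a g (FreeGroup.of (h : RightAngledArtinGroup Γ ⧸ link Γ a)) =
      FreeGroup.of ((g * h : RightAngledArtinGroup Γ) : RightAngledArtinGroup Γ ⧸ link Γ a) := by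
  simp [cosetAut]

lemma cosetAut_of_mem {a : V} {k : RightAngledArtinGroup Γ} (hk : k ∈ link Γ a) :
    cosetAut Γ a k (FreeGroup.of ((1 : RightAngledArtinGroup Γ) : RightAngledArtinGroup Γ ⧸ link Γ a)) =
      FreeGroup.of ((1 : RightAngledArtinGroup Γ) : RightAngledArtinGroup Γ ⧸ link Γ a) := by
  rw [cosetAut_of, mul_one]
  congr 1
  exact (QuotientGroup.eq.2 (by simpa using hk)).symm

open Classical in
/-- The embedding of `A(Γ)` in a semidirect product that separates the generator `a`, which becomes
the basis element given by the trivial coset, from the other generators. -/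
noncomputable def split (Γ : SimpleGraph V) (a : V) : RightAngledArtinGroup Γ →*
    FreeGroup (RightAngledArtinGroup Γ ⧸ link Γ a) ⋊[cosetAut Γ a] RightAngledArtinGroup Γ :=
  lift (fun v => if v = a then
      SemidirectProduct.inl (FreeGroup.of ((1 : RightAngledArtinGroup Γ) : _ ⧸ link Γ a))
    else SemidirectProduct.inr (gen Γ v)) (by
    have key : ∀ v, Γ.Adj a v → Commute
        (SemidirectProduct.inl (FreeGroup.of ((1 : RightAngledArtinGroup Γ) : _ ⧸ link Γ a)) :
          _ ⋊[cosetAut Γ a] RightAngledArtinGroup Γ) (SemidirectProduct.inr (gen Γ v)) := by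
      intro v hv
      refine SemidirectProduct.ext ?_ ?_
      · simp [cosetAut_of_mem (gen_mem_link hv)]
      · simp
    intro v w hvw
    by_cases hv : v = a <;> by_cases hw : w = a
    · exact absurd (hv.trans hw.symm) hvw.ne
    · subst hv
      rw [if_pos rfl, if_neg hw]
      exact key w hvw
    · subst hw
      rw [if_neg hv, if_pos rfl]
      exact (key v hvw.symm).symm
    · rw [if_neg hv, if_neg hw]
      exact (gen_commute hvw).map SemidirectProduct.inr)

lemma split_gen_self (a : V) : split Γ a (gen Γ a) =
    SemidirectProduct.inl (FreeGroup.of ((1 : RightAngledArtinGroup Γ) : _ ⧸ link Γ a)) := by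
  simp [split]

lemma split_of_mem_link {a : V} {k : RightAngledArtinGroup Γ} (hk : k ∈ link Γ a) :
    split Γ a k = SemidirectProduct.inr k := by
  have h1 : link Γ a ≤ (split Γ a).eqLocus SemidirectProduct.inr := link_le fun v hv => by
    change split Γ a (gen Γ v) = SemidirectProduct.inr (gen Γ v)
    simp [split, hv.ne']
  exact h1 hk

/-- The left inverse of `split`, which sends the basis element given by the coset of `g` to
`g a g⁻¹`. -/
def unsplit (Γ : SimpleGraph V) (a : V) :
    FreeGroup (RightAngledArtinGroup Γ ⧸ link Γ a) ⋊[cosetAut Γ a] RightAngledArtinGroup Γ →*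
      RightAngledArtinGroup Γ :=
  SemidirectProduct.lift (FreeGroup.lift fun q =>
      Quotient.liftOn' q (fun g => g * gen Γ a * g⁻¹) (by
        intro g h hgh
        obtain ⟨k, rfl⟩ : ∃ k, h = g * k := ⟨g⁻¹ * h, by simp⟩
        have hk := QuotientGroup.leftRel_apply.1 hgh
        rw [inv_mul_cancel_left] at hk
        rw [mul_inv_rev, mul_assoc g k, ← (commute_of_mem_link hk).eq]
        simp [mul_assoc]))
    (MonoidHom.id _) (by
      intro g
      refine FreeGroup.ext_hom _ _ fun q => ?_
      induction q using QuotientGroup.induction_on with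
      | H h =>
        simp only [MonoidHom.comp_apply, MulEquiv.coe_toMonoidHom, cosetAut_of,
          FreeGroup.lift_apply_of]
        change g * h * gen Γ a * (g * h)⁻¹ = g * (h * gen Γ a * h⁻¹) * g⁻¹
        simp [mul_assoc])

lemma unsplit_split (a : V) (x : RightAngledArtinGroup Γ) : unsplit Γ a (split Γ a x) = x := by
  have : (unsplit Γ a).comp (split Γ a) = MonoidHom.id _ := by
    refine hom_ext fun v => ?_
    by_cases hv : v = a
    · subst hv
      rw [MonoidHom.comp_apply, split_gen_self, unsplit, SemidirectProduct.lift_inl,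
        FreeGroup.lift_apply_of]
      change 1 * gen Γ v * 1⁻¹ = gen Γ v
      simp
    · simp [split, hv, unsplit]
  exact DFunLike.congr_fun this x

/-- The elements that commute with `aʲ k`, where `k` is in the subgroup generated by the link of
`a`, are the expected ones. -/
lemma exists_eq_zpow_mul_of_commute {a : V} {j : ℤ} (hj : j ≠ 0)
    {k x : RightAngledArtinGroup Γ} (hk : k ∈ link Γ a) (h : Commute x (gen Γ a ^ j * k)) :
    ∃ t : ℤ, ∃ y ∈ link Γ a, x = gen Γ a ^ t * y := by
  classical
  have h1 := (h.map (split Γ a)).eq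
  rw [map_mul, map_zpow, split_gen_self, split_of_mem_link hk, ← map_zpow] at h1
  set o : FreeGroup (RightAngledArtinGroup Γ ⧸ link Γ a) :=
    FreeGroup.of ((1 : RightAngledArtinGroup Γ) : _ ⧸ link Γ a) with ho
  set F := (split Γ a x).left
  set y := (split Γ a x).right
  have hk1 : (QuotientGroup.mk k : RightAngledArtinGroup Γ ⧸ link Γ a) =
      QuotientGroup.mk (1 : RightAngledArtinGroup Γ) :=
    QuotientGroup.eq.2 (by simpa using hk)
  have h2 := congrArg SemidirectProduct.left h1
  simp only [SemidirectProduct.mul_left, SemidirectProduct.mul_right, SemidirectProduct.left_inl,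
    SemidirectProduct.right_inl, SemidirectProduct.left_inr, map_one, mul_one, one_mul,
    SemidirectProduct.right_inr] at h2
  rw [map_zpow, ho, cosetAut_of, mul_one] at h2
  have hF : F = (split Γ a x).left := rfl
  have hy' : y = (split Γ a x).right := rfl
  rw [← hF, ← hy'] at h2
  -- Counting the occurrences of the basis element `o` shows that `y` fixes it.
  let c : FreeGroup (RightAngledArtinGroup Γ ⧸ link Γ a) →* Multiplicative ℤ :=
    FreeGroup.lift fun q => if q = QuotientGroup.mk (1 : RightAngledArtinGroup Γ) then
      Multiplicative.ofAdd 1 else 1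
  have hc : c (cosetAut Γ a k F) = c F := by
    have : c.comp (cosetAut Γ a k).toMonoidHom = c := by
      refine FreeGroup.ext_hom _ _ fun q => ?_
      induction q using QuotientGroup.induction_on with
      | H g =>
        simp only [MonoidHom.comp_apply, MulEquiv.coe_toMonoidHom, cosetAut_of, c,
          FreeGroup.lift_apply_of]
        congr 1
        rw [eq_iff_iff, QuotientGroup.eq, QuotientGroup.eq]
        simp only [mul_inv_rev, mul_one]
        exact Subgroup.mul_mem_cancel_right _ (inv_mem hk)
    exact DFunLike.congr_fun this F
  have hy : (QuotientGroup.mk y : RightAngledArtinGroup Γ ⧸ link Γ a) =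
      QuotientGroup.mk (1 : RightAngledArtinGroup Γ) := by
    by_contra hne
    have h3 := congrArg c h2
    rw [map_mul, map_mul, hc, map_zpow, map_zpow, mul_comm, mul_left_inj] at h3
    simp only [c, FreeGroup.lift_apply_of, if_neg hne, if_pos] at h3
    rw [one_zpow, ← ofAdd_zsmul] at h3
    simp at h3
    exact hj h3.symm
  rw [hy] at h2
  obtain ⟨t, ht⟩ := FreeGroup.exists_eq_zpow_of_mul_zpow_eq (MulAction.toPerm k)
    ((congrArg QuotientGroup.mk (mul_one k)).trans hk1) hj h2
  refine ⟨t, y, ?_, ?_⟩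
  · simpa using QuotientGroup.eq.1 hy
  · have h4 : split Γ a x = SemidirectProduct.inl F * SemidirectProduct.inr y :=
      (SemidirectProduct.inl_left_mul_inr_right _).symm
    rw [← unsplit_split a x, h4, ht, map_mul, map_zpow, ← split_gen_self, map_zpow, unsplit_split]
    simp [unsplit]

/-- An element that commutes with elements of the form `aʲ k` and `bⁱ k'` as above, where `a` and
`b` are adjacent, is a product of powers of `a` and `b`. -/
lemma exists_eq_zpow_mul_zpow (hΓ : Γ.CliqueFree 3) {a b : V} (hab : Γ.Adj a b) {i j : ℤ}
    (hi : i ≠ 0) (hj : j ≠ 0) {k k' x : RightAngledArtinGroup Γ} (hk : k ∈ link Γ a)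
    (hk' : k' ∈ link Γ b) (h : Commute x (gen Γ a ^ j * k)) (h' : Commute x (gen Γ b ^ i * k')) :
    ∃ p q : ℤ, x = gen Γ a ^ p * gen Γ b ^ q := by
  obtain ⟨p, y, hy, rfl⟩ := exists_eq_zpow_mul_of_commute hj hk h
  obtain ⟨q, z, hz, hyz⟩ := exists_eq_zpow_mul_of_commute hi hk' h'
  refine ⟨p, q, ?_⟩
  have hcomm : gen Γ a ^ p * gen Γ b ^ q = gen Γ b ^ q * gen Γ a ^ p :=
    ((gen_commute hab).zpow_zpow p q).eq
  have h1 : (gen Γ b ^ q)⁻¹ * y = (gen Γ a ^ p)⁻¹ * z := by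
    rw [eq_inv_mul_of_mul_eq hyz, ← mul_assoc, ← mul_inv_rev, hcomm]
    simp [mul_assoc]
  have h2 : (gen Γ b ^ q)⁻¹ * y = 1 := by
    refine eq_one_of_mem_link_of_mem_link hΓ hab ?_ ?_
    · exact mul_mem (inv_mem (zpow_mem (gen_mem_link hab) q)) hy
    · rw [h1]
      exact mul_mem (inv_mem (zpow_mem (gen_mem_link hab.symm) p)) hz
  rw [inv_mul_eq_one.1 h2]

end RightAngledArtinGroup

/-! ### Hyperplane systems -/

/-- The properties of the action of a diagram group on the hyperplanes of the universal cover of the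
Squier complex that restrict which right-angled Artin groups are diagram groups. -/
structure HyperplaneSystem (A : Type u) [Group A] where
  /-- The hyperplanes. -/
  Hyp : Type v
  /-- The stabilizer of a hyperplane. -/
  stab : Hyp → Subgroup A
  /-- The elements of the stabilizer that move only subwords to the left. -/
  left : Hyp → Subgroup A
  /-- The elements of the stabilizer that move only subwords to the right. -/
  right : Hyp → Subgroup A
  /-- Two hyperplanes cross, the first one being to the left of the second one. -/
  Precedes : Hyp → Hyp → Prop
  /-- An element moves the base vertex from one side of a hyperplane to the other one. -/
  Skewers : A → Hyp → Prop
  mem_stab_iff : ∀ {J h}, h ∈ stab J ↔ ∃ l ∈ left J, ∃ r ∈ right J, h = l * r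
  commute : ∀ {J l r}, l ∈ left J → r ∈ right J → Commute l r
  left_le : ∀ {J K}, Precedes J K → left J ≤ left K
  right_le : ∀ {J K}, Precedes J K → right K ≤ right J
  zpow_notMem_stab : ∀ {g J} {i : ℤ}, Skewers g J → i ≠ 0 → g ^ i ∉ stab J
  skewers_mul : ∀ {x y K}, Skewers x K → Commute x y → y ∈ stab K → Skewers (x * y) K
  skewers_zpow_iff : ∀ {x K} {m : ℤ}, m ≠ 0 → (Skewers (x ^ m) K ↔ Skewers x K)
  exists_mem_stab : ∀ {g a J}, Skewers g J → Commute a g →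
    ∃ i j : ℤ, i ≠ 0 ∧ a ^ i * g ^ j ∈ stab J
  precedes_or_precedes : ∀ {s s' J K}, Commute s s' → s ∈ stab J → s' ∈ stab K →
    Skewers s' J → Skewers s K → Precedes J K ∨ Precedes K J
  precedes_of_mem_right : ∀ {n J K}, n ∈ right J → Skewers n K → Precedes J K
  exists_leftmost : ∀ {g : A}, g ≠ 1 → ∃ J, Skewers g J ∧ ∀ l ∈ left J, Commute l g

namespace SemigroupPresentation

open Hyperplane PathGroup

variable {α : Type v} {P : SemigroupPresentation α}

/-- The hyperplane system of a diagram group. Only the hyperplanes in the component of the base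
vertex are considered, so that the subgroups `leftStab` and `rightStab` consist of closed paths. -/
def hyperplaneSystem {A : Type u} [Group A] (w : List α) (φ : A →* P.PathGroup)
    (hφ : Function.Injective φ) (hrange : φ.range = P.loops w) : HyperplaneSystem.{u, v} A where
  Hyp := {J : P.Hyperplane // ∃ k p r b, k ∈ P.Hom w (p ++ r.1.1 ++ b) ∧ J = Hyperplane.mk k p r b}
  stab J := (MulAction.stabilizer P.PathGroup J.1).comap φ
  left J := (leftStab J.1).comap φ
  right J := (rightStab J.1).comap φ
  Precedes J K := Precedes J.1 K.1
  Skewers g J := Skewers (φ g) J.1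
  mem_stab_iff := by
    rintro ⟨_, k, p, r, b, hk, rfl⟩ h
    refine (smul_eq_self_iff (h := φ h)).trans ⟨?_, ?_⟩
    · rintro ⟨l, hl, t, ht, h1⟩
      have hl' : l ∈ φ.range := by
        rw [hrange, mem_loops]
        obtain ⟨A, hA, rfl⟩ := mem_leftStab_mk.1 hl
        refine Hom.mul (Hom.mul hk ?_) (Hom.inv hk)
        simpa using Hom.whisker_right hA (r.1.1 ++ b)
      have ht' : t ∈ φ.range := by
        rw [hrange, mem_loops]
        obtain ⟨B, hB, rfl⟩ := mem_rightStab_mk.1 ht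
        exact Hom.mul (Hom.mul hk (Hom.whisker_left hB (p ++ r.1.1))) (Hom.inv hk)
      obtain ⟨l, rfl⟩ := hl'
      obtain ⟨t, rfl⟩ := ht'
      exact ⟨l, hl, t, ht, hφ (by rw [h1, map_mul])⟩
    · rintro ⟨l, hl, t, ht, rfl⟩
      exact ⟨_, hl, _, ht, map_mul _ _ _⟩
  commute hl hr := hφ (by
    rw [map_mul, map_mul]
    exact (commute_of_mem hl hr).eq)
  left_le h := Subgroup.comap_mono h.leftStab_le
  right_le h := Subgroup.comap_mono h.rightStab_le
  zpow_notMem_stab {g J i} h hi hmem := h.1 i hi (by rw [← map_zpow]; exact hmem)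
  skewers_mul {x y K} h hxy hy := by
    rw [map_mul]
    exact h.mul_of_smul_eq (hxy.map φ) hy
  skewers_zpow_iff {x K m} hm := by
    rw [map_zpow]
    exact Hyperplane.skewers_zpow_iff hm
  exists_mem_stab {g a J} h ha := by
    obtain ⟨i, j, hi, hij⟩ := h.exists_smul_eq (ha.map φ)
    refine ⟨i, j, hi, ?_⟩
    rw [← map_zpow, ← map_zpow, ← map_mul] at hij
    exact hij
  precedes_or_precedes hs hJ hK hsJ hsK :=
    Hyperplane.precedes_or_precedes (hs.map φ) hJ hK hsJ hsK
  precedes_of_mem_right hn h := h.precedes hn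
  exists_leftmost {g} hg := by
    have hmem : φ g ∈ P.loops w := by rw [← hrange]; exact ⟨g, rfl⟩
    obtain ⟨k, p, r, b, hk, hsk, hl⟩ := Hyperplane.exists_leftmost hmem
      ((map_ne_one_iff φ hφ).2 hg)
    refine ⟨⟨_, k, p, r, b, hk, rfl⟩, hsk, fun l hl' => hφ ?_⟩
    rw [map_mul, map_mul]
    exact (hl _ hl').eq

end SemigroupPresentation

/-- Every diagram group has a hyperplane system. -/
lemma IsDiagramGroup.nonempty_hyperplaneSystem {A : Type u} [Group A]
    (h : IsDiagramGroup.{u, v} A) : Nonempty (HyperplaneSystem.{u, v} A) := by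
  obtain ⟨α, P, w, ⟨e⟩⟩ := h
  let f : A ≃* P.loops w.word := e.trans (SemigroupPresentation.diagramGroupEquiv w)
  refine ⟨SemigroupPresentation.hyperplaneSystem w.word ((P.loops w.word).subtype.comp f) ?_ ?_⟩
  · exact Subtype.val_injective.comp f.injective
  · rw [MonoidHom.range_comp, MonoidHom.range_eq_top.2 f.surjective, ← MonoidHom.range_eq_map,
      Subgroup.range_subtype]

/-! ### Right-angled Artin groups of graphs with odd cycles -/

namespace HyperplaneSystem

open RightAngledArtinGroup

section

variable {A : Type u} [Group A] (S : HyperplaneSystem.{u, v} A)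

lemma left_le_stab (J : S.Hyp) : S.left J ≤ S.stab J := fun l hl =>
  S.mem_stab_iff.2 ⟨l, hl, 1, one_mem _, (mul_one l).symm⟩

lemma right_le_stab (J : S.Hyp) : S.right J ≤ S.stab J := fun r hr =>
  S.mem_stab_iff.2 ⟨1, one_mem _, r, hr, (one_mul r).symm⟩

variable {S}

lemma Skewers.eq_zero {g : A} {J : S.Hyp} (h : S.Skewers g J) {i : ℤ} (hi : g ^ i ∈ S.stab J) :
    i = 0 := by
  by_contra hne
  exact S.zpow_notMem_stab h hne hi

/-- Skewering depends only on an element up to the stabilizer and up to nonzero powers. -/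
lemma Skewers.of_zpow_eq {x y z : A} {K : S.Hyp} (h : S.Skewers x K) {m n : ℤ} (hm : m ≠ 0)
    (hn : n ≠ 0) (hz : z ∈ S.stab K) (hxz : Commute x z) (hy : x ^ m * z = y ^ n) :
    S.Skewers y K := by
  rw [← S.skewers_zpow_iff hn, ← hy]
  exact S.skewers_mul ((S.skewers_zpow_iff hm).2 h) (hxz.zpow_left m) hz

end

variable {V : Type u} {Γ : SimpleGraph V} {S : HyperplaneSystem.{u, v} (RightAngledArtinGroup Γ)}

lemma zpow_mul_zpow_mul_zpow {a b : V} (hab : Γ.Adj a b) (i j p q m n : ℤ) :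
    (gen Γ b ^ i * gen Γ a ^ j) ^ m * (gen Γ b ^ q * gen Γ a ^ p) ^ n =
      gen Γ b ^ (i * m + q * n) * gen Γ a ^ (j * m + p * n) := by
  have hc : ∀ i j : ℤ, Commute (gen Γ a ^ j) (gen Γ b ^ i) := fun i j =>
    (gen_commute hab).zpow_zpow j i
  rw [(hc i j).symm.mul_zpow, (hc q p).symm.mul_zpow]
  simp only [← zpow_mul]
  rw [zpow_add, zpow_add, mul_assoc, mul_assoc, ← mul_assoc (gen Γ a ^ (j * m)), (hc _ _).eq,
    mul_assoc]

/-- A leftmost hyperplane `J` of `a`: an element `bⁱ aʲ` of its stabilizer moves only subwords on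
one side of `J`, provided that `a` has a second neighbour `d`. -/
lemma mem_left_or_mem_right (hΓ : Γ.CliqueFree 3) {a b d : V} (hab : Γ.Adj a b)
    (had : Γ.Adj a d) (hbd : b ≠ d) {J : S.Hyp} (hJ : S.Skewers (gen Γ a) J)
    (hl : ∀ l ∈ S.left J, Commute l (gen Γ a)) {i j : ℤ} (hi : i ≠ 0)
    (hs : gen Γ b ^ i * gen Γ a ^ j ∈ S.stab J) :
    gen Γ b ^ i * gen Γ a ^ j ∈ S.left J ∨ gen Γ b ^ i * gen Γ a ^ j ∈ S.right J := by
  have hbd' : ¬ Γ.Adj b d := not_adj_of_adj_of_adj hΓ hab had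
  obtain ⟨l, hlJ, r, hrJ, hlr⟩ := S.mem_stab_iff.1 hs
  have hla := hl l hlJ
  have hls : Commute l (gen Γ b ^ i * gen Γ a ^ j) := by
    rw [hlr]
    exact (Commute.refl l).mul_right (S.commute hlJ hrJ)
  have hlb : Commute l (gen Γ b ^ i) := by
    have := hls.mul_right ((hla.zpow_right j).inv_right)
    rwa [mul_inv_cancel_right] at this
  obtain ⟨p, q, rfl⟩ := exists_eq_zpow_mul_zpow hΓ hab hi one_ne_zero (one_mem _) (one_mem _)
    (by simpa using hla) (by simpa using hlb)
  rw [((gen_commute hab).zpow_zpow p q).eq] at hlJ hlr hla hls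
  -- The stabilizer of `J` meets `⟨a, b⟩` in a cyclic group, which determines `p`.
  have hpq : p * i = j * q := by
    have h1 : (gen Γ b ^ i * gen Γ a ^ j) ^ (-q) * (gen Γ b ^ q * gen Γ a ^ p) ^ i ∈ S.stab J :=
      mul_mem (zpow_mem hs _) (zpow_mem (S.left_le_stab J hlJ) _)
    rw [zpow_mul_zpow_mul_zpow hab, show i * -q + q * i = 0 by ring, zpow_zero, one_mul] at h1
    have := hJ.eq_zero h1
    linarith
  obtain ⟨x, y, hx, hxy⟩ := S.exists_mem_stab hJ (gen_commute had.symm)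
  obtain ⟨l', hlJ', r', hrJ', hlr'⟩ := S.mem_stab_iff.1 hxy
  have h1 := expSum_mul_eq_of_commute hbd hbd' (S.commute hlJ hrJ')
  have h2 := expSum_mul_eq_of_commute hbd hbd' (S.commute hlJ' hrJ)
  have e1 := congrArg (expSum b) hlr
  have e2 := congrArg (expSum d) hlr
  have e3 := congrArg (expSum b) hlr'
  have e4 := congrArg (expSum d) hlr'
  simp only [expSum_mul, expSum_zpow, expSum_gen_self, expSum_gen_of_ne hab.ne,
    expSum_gen_of_ne had.ne, expSum_gen_of_ne hbd, expSum_gen_of_ne hbd.symm, mul_one, mul_zero,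
    add_zero, zero_add, zero_mul] at h1 h2 e1 e2 e3 e4
  have e5 : expSum d r = 0 := e2.symm
  rw [e5, mul_zero] at h2
  by_cases hq : q = 0
  · right
    have hp : p = 0 := by
      rw [hq, mul_zero] at hpq
      exact (mul_eq_zero.1 hpq).resolve_right hi
    rw [hlr, hq, hp]
    simpa using hrJ
  · left
    have h3 : expSum d r' = 0 := (mul_eq_zero.1 h1).resolve_left hq
    have h4 : expSum b r = 0 := by
      rcases mul_eq_zero.1 h2.symm with h | h
      · exact absurd (by rw [e4, h, h3, add_zero]) hx
      · exact h
    have hqi : q = i := by rw [e1, h4, add_zero]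
    subst hqi
    have hpj : p = j := mul_right_cancel₀ hi hpq
    rwa [← hpj]

/-- A leftmost hyperplane `J` of `a` is stabilized by a power of the neighbour `b` of `a`, provided
that both `a` and `b` have another neighbour. -/
lemma exists_zpow_mem_stab (hΓ : Γ.CliqueFree 3) {a b c d : V} (hab : Γ.Adj a b)
    (had : Γ.Adj a d) (hbc : Γ.Adj b c) (hbd : b ≠ d) (hac : a ≠ c) {J : S.Hyp}
    (hJ : S.Skewers (gen Γ a) J) (hl : ∀ l ∈ S.left J, Commute l (gen Γ a)) :
    ∃ i : ℤ, i ≠ 0 ∧ gen Γ b ^ i ∈ S.stab J := by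
  have hbd' : ¬ Γ.Adj b d := not_adj_of_adj_of_adj hΓ hab had
  have hac' : ¬ Γ.Adj a c := not_adj_of_adj_of_adj hΓ hab.symm hbc
  have hba := (gen_commute hab).symm
  obtain ⟨i, j, hi, hs⟩ := S.exists_mem_stab hJ hba
  by_cases hj : j = 0
  · exact ⟨i, hi, by simpa [hj] using hs⟩
  exfalso
  set s := gen Γ b ^ i * gen Γ a ^ j with hsdef
  have hs_a : Commute s (gen Γ a) :=
    (hba.zpow_left i).mul_left ((Commute.refl _).zpow_left j)
  have es_a : expSum a s = j := by simp [hsdef, expSum_gen_of_ne hab.ne']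
  have es_b : expSum b s = i := by simp [hsdef, expSum_gen_of_ne hab.ne]
  have es_c : expSum c s = 0 := by
    simp [hsdef, expSum_gen_of_ne hbc.ne, expSum_gen_of_ne hac]
  have es_d : expSum d s = 0 := by
    simp [hsdef, expSum_gen_of_ne had.ne, expSum_gen_of_ne hbd]
  -- The centralizer of `s` is generated by `a` and `b`.
  have hcent : ∀ x, Commute x s → ∃ p q : ℤ, x = gen Γ b ^ q * gen Γ a ^ p := by
    intro x hx
    obtain ⟨p, q, rfl⟩ := exists_eq_zpow_mul_zpow hΓ hab hi hj
      (zpow_mem (gen_mem_link hab) i) (zpow_mem (gen_mem_link hab.symm) j)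
      (by rwa [← (hba.zpow_zpow i j).eq]) hx
    exact ⟨p, q, (hba.symm.zpow_zpow p q).eq⟩
  rcases mem_left_or_mem_right hΓ hab had hbd hJ hl hi hs with hsl | hsr
  · -- `b` skewers `J` as well, and `c` yields an element of `left J` that does not commute with `a`.
    have hJb : S.Skewers (gen Γ b) J := by
      refine hJ.of_zpow_eq (m := -j) (n := i) (neg_ne_zero.2 hj) hi hs hs_a.symm ?_
      rw [hsdef, (hba.zpow_zpow i j).eq, zpow_neg, inv_mul_cancel_left]
    obtain ⟨m, n, hm, hmn⟩ := S.exists_mem_stab hJb (gen_commute hbc.symm)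
    obtain ⟨l, hlJ, r, hrJ, hlr⟩ := S.mem_stab_iff.1 hmn
    obtain ⟨p, q, rfl⟩ := hcent r (S.commute hsl hrJ).symm
    have h1 := expSum_mul_eq_of_commute hac hac' (hl l hlJ)
    have e1 := congrArg (expSum c) hlr
    simp [expSum_gen_of_ne hbc.ne, expSum_gen_of_ne hac] at h1 e1
    omega
  · -- Pass to a leftmost hyperplane `K` of `s`.
    have hs1 : s ≠ 1 := by
      intro h
      rw [h] at es_b
      simp [expSum] at es_b
      exact hi es_b.symm
    obtain ⟨K, hK, hlK⟩ := S.exists_leftmost hs1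
    have hJK := S.precedes_of_mem_right hsr hK
    obtain ⟨m, y, hm, hmy⟩ := S.exists_mem_stab hK hs_a.symm
    obtain ⟨l, hlJ, r, hrJ, hlr⟩ := S.mem_stab_iff.1 hmy
    obtain ⟨p, q, rfl⟩ := hcent l (hlK l hlJ)
    have hr : r = gen Γ b ^ (i * y - q) * gen Γ a ^ (j * y + m - p) := by
      have h1 := zpow_mul_zpow_mul_zpow hab q p (j * y + m) (i * y) (-1) 1
      have h2 : gen Γ a ^ m * s ^ y = gen Γ b ^ (i * y) * gen Γ a ^ (j * y + m) := by
        have := zpow_mul_zpow_mul_zpow hab i j 1 0 y m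
        rw [zpow_zero, one_mul, zpow_one, zero_mul, add_zero, one_mul] at this
        rw [← this]
        exact ((hs_a.zpow_left y).zpow_right m).eq.symm
      rw [zpow_one, zpow_neg_one, ← h2, hlr, inv_mul_cancel_left] at h1
      rw [h1]
      congr 2 <;> ring
    -- `right K` is contained in the stabilizer of `J`, which meets `⟨a, b⟩` in a cyclic group.
    have hrS : r ∈ S.stab J := S.right_le_stab J (S.right_le hJK hrJ)
    have hrK : r ∈ S.stab K := S.right_le_stab K hrJ
    obtain ⟨hq, hp⟩ : i * y - q = 0 ∧ j * y + m - p = 0 := by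
      generalize i * y - q = β at hr
      generalize j * y + m - p = γ at hr
      subst hr
      have h1 := zpow_mul_zpow_mul_zpow hab i j γ β (-β) i
      rw [show i * -β + β * i = 0 by ring, zpow_zero, one_mul] at h1
      have h2 : γ * i = j * β := by
        have h3 := hJ.eq_zero (h1 ▸ mul_mem (zpow_mem hs (-β)) (zpow_mem hrS i))
        linarith
      rw [h2, mul_neg, neg_add_cancel, zpow_zero, ← hsdef, zpow_neg, inv_mul_eq_one] at h1
      have h3 : β = 0 := hK.eq_zero (h1 ▸ zpow_mem hrK i)
      rw [h3, mul_zero] at h2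
      exact ⟨h3, (mul_eq_zero.1 h2).resolve_right hi⟩
    obtain rfl : q = i * y := by omega
    obtain rfl : p = j * y + m := by omega
    set l := gen Γ b ^ (i * y) * gen Γ a ^ (j * y + m) with hldef
    have hlS := S.left_le_stab K hlJ
    have hsl : Commute s l := (hlK l hlJ).symm
    by_cases hy : y = 0
    · subst hy
      have hKb : S.Skewers (gen Γ b) K := by
        refine hK.of_zpow_eq (m := m) (n := i * m) hm (mul_ne_zero hi hm) (zpow_mem hlS (-j))
          (hsl.zpow_right _) ?_
        rw [hsdef, hldef, zpow_mul_zpow_mul_zpow hab]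
        rw [show j * m + (j * 0 + m) * -j = 0 by ring, zpow_zero, mul_one]
        congr 1
        ring
      obtain ⟨x, z, hx, hxz⟩ := S.exists_mem_stab hKb (gen_commute hbc.symm)
      obtain ⟨l', hlJ', r', hrJ', hlr'⟩ := S.mem_stab_iff.1 hxz
      have h1 := expSum_mul_eq_of_commute hac hac' (S.commute hlJ hrJ')
      have h2 := expSum_mul_eq_of_commute hac hac' (hlK l' hlJ')
      have e1 := congrArg (expSum c) hlr'
      rw [es_a, es_c] at h2
      simp [hldef, expSum_gen_of_ne hbc.ne, expSum_gen_of_ne hac, hm, hj] at h1 h2 e1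
      omega
    · have hKa : S.Skewers (gen Γ a) K := by
        refine hK.of_zpow_eq (m := i * y) (n := -(m * i)) (mul_ne_zero hi hy)
          (neg_ne_zero.2 (mul_ne_zero hm hi)) (zpow_mem hlS (-i)) (hsl.zpow_right _) ?_
        rw [hsdef, hldef, zpow_mul_zpow_mul_zpow hab]
        rw [show i * (i * y) + i * y * -i = 0 by ring, zpow_zero, one_mul]
        congr 1
        ring
      obtain ⟨x, z, hx, hxz⟩ := S.exists_mem_stab hKa (gen_commute had.symm)
      obtain ⟨l', hlJ', r', hrJ', hlr'⟩ := S.mem_stab_iff.1 hxz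
      have h1 := expSum_mul_eq_of_commute hbd hbd' (S.commute hlJ hrJ')
      have h2 := expSum_mul_eq_of_commute hbd hbd' (hlK l' hlJ')
      have e1 := congrArg (expSum d) hlr'
      rw [es_b, es_d] at h2
      simp [hldef, expSum_gen_of_ne had.ne, expSum_gen_of_ne hbd, expSum_gen_of_ne hab.ne, hi, hy]
        at h1 h2 e1
      omega

/-- A leftmost hyperplane `J` of `a` is to the left of all neighbours of `a`, or to the right of all
of them, as far as the neighbours `b` and `d` are concerned. -/
lemma exists_zpow_mem_left_or_right (hΓ : Γ.CliqueFree 3) {a b c d e : V} (hab : Γ.Adj a b)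
    (had : Γ.Adj a d) (hbc : Γ.Adj b c) (hde : Γ.Adj d e) (hbd : b ≠ d) (hac : a ≠ c)
    (hae : a ≠ e) {J : S.Hyp} (hJ : S.Skewers (gen Γ a) J)
    (hl : ∀ l ∈ S.left J, Commute l (gen Γ a)) :
    ∃ i j : ℤ, i ≠ 0 ∧ j ≠ 0 ∧ ((gen Γ b ^ i ∈ S.left J ∧ gen Γ d ^ j ∈ S.left J) ∨
      (gen Γ b ^ i ∈ S.right J ∧ gen Γ d ^ j ∈ S.right J)) := by
  have hbd' : ¬ Γ.Adj b d := not_adj_of_adj_of_adj hΓ hab had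
  obtain ⟨i, hi, hbi⟩ := exists_zpow_mem_stab hΓ hab had hbc hbd hac hJ hl
  obtain ⟨j, hj, hdj⟩ := exists_zpow_mem_stab hΓ had hab hde hbd.symm hae hJ hl
  have h1 := mem_left_or_mem_right hΓ hab had hbd hJ hl (j := 0) hi (by simpa using hbi)
  have h2 := mem_left_or_mem_right hΓ had hab hbd.symm hJ hl (j := 0) hj (by simpa using hdj)
  rw [zpow_zero, mul_one] at h1 h2
  have hn : ¬ Commute (gen Γ b ^ i) (gen Γ d ^ j) := fun h => by
    have := expSum_mul_eq_of_commute hbd hbd' h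
    simp [expSum_gen_of_ne hbd, hi, hj] at this
  refine ⟨i, j, hi, hj, ?_⟩
  rcases h1 with h1 | h1 <;> rcases h2 with h2 | h2
  · exact Or.inl ⟨h1, h2⟩
  · exact absurd (S.commute h1 h2) hn
  · exact absurd (S.commute h2 h1).symm hn
  · exact Or.inr ⟨h1, h2⟩

/-- Leftmost hyperplanes of adjacent vertices `a` and `b` cross, which is impossible if they are on
the same side of each other. -/
lemma not_mem_left_and_mem_left {a b : V} (hab : Γ.Adj a b) {J K : S.Hyp}
    (hJ : S.Skewers (gen Γ a) J) (hK : S.Skewers (gen Γ b) K) {i m : ℤ} (hi : i ≠ 0) (hm : m ≠ 0)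
    (hiJ : gen Γ b ^ i ∈ S.left J) : ¬ gen Γ a ^ m ∈ S.left K := by
  intro hmK
  rcases S.precedes_or_precedes ((gen_commute hab).symm.zpow_zpow i m) (S.left_le_stab J hiJ)
    (S.left_le_stab K hmK) ((S.skewers_zpow_iff hm).2 hJ) ((S.skewers_zpow_iff hi).2 hK) with h | h
  · exact hi (hK.eq_zero (S.left_le_stab K (S.left_le h hiJ)))
  · exact hm (hJ.eq_zero (S.left_le_stab J (S.left_le h hmK)))

lemma not_mem_right_and_mem_right {a b : V} (hab : Γ.Adj a b) {J K : S.Hyp}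
    (hJ : S.Skewers (gen Γ a) J) (hK : S.Skewers (gen Γ b) K) {i m : ℤ} (hi : i ≠ 0) (hm : m ≠ 0)
    (hiJ : gen Γ b ^ i ∈ S.right J) : ¬ gen Γ a ^ m ∈ S.right K := by
  intro hmK
  rcases S.precedes_or_precedes ((gen_commute hab).symm.zpow_zpow i m) (S.right_le_stab J hiJ)
    (S.right_le_stab K hmK) ((S.skewers_zpow_iff hm).2 hJ) ((S.skewers_zpow_iff hi).2 hK) with h | h
  · exact hm (hJ.eq_zero (S.right_le_stab J (S.right_le h hmK)))
  · exact hi (hK.eq_zero (S.right_le_stab K (S.right_le h hiJ)))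

/-- The sides of the leftmost hyperplanes of the vertices of a cycle define a proper colouring of
the cycle with two colours. -/
lemma cycleGraph_colorable (S : HyperplaneSystem.{u, v} (RightAngledArtinGroup Γ))
    (hΓ : Γ.CliqueFree 3) {n : ℕ} (hn : 5 ≤ n) (f : SimpleGraph.cycleGraph n ↪g Γ) :
    (SimpleGraph.cycleGraph n).Colorable 2 := by
  classical
  obtain ⟨n, rfl⟩ := Nat.exists_eq_add_of_le' (show 2 ≤ n by omega)
  have hJ : ∀ k, ∃ J : S.Hyp, S.Skewers (gen Γ (f k)) J ∧
      ∀ l ∈ S.left J, Commute l (gen Γ (f k)) := fun k => S.exists_leftmost fun h => by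
    have := expSum_gen_self (Γ := Γ) (f k)
    rw [h] at this
    simp [expSum] at this
  choose J hJ hl using hJ
  have hadj : ∀ k, Γ.Adj (f k) (f (k + 1)) := fun k =>
    f.map_rel_iff.2 (SimpleGraph.cycleGraph_adj.2 (Or.inr (by simp)))
  have hside : ∀ k, ∃ i j : ℤ, i ≠ 0 ∧ j ≠ 0 ∧
      ((gen Γ (f (k + 1)) ^ i ∈ S.left (J k) ∧ gen Γ (f (k - 1)) ^ j ∈ S.left (J k)) ∨
      (gen Γ (f (k + 1)) ^ i ∈ S.right (J k) ∧ gen Γ (f (k - 1)) ^ j ∈ S.right (J k))) := by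
    intro k
    have h1 := hadj (k - 1)
    have h2 := hadj (k - 1 - 1)
    rw [sub_add_cancel] at h1 h2
    have h3 : ((1 : Fin (n + 2)) + 1) ≠ 0 := by
      intro h
      have := congrArg Fin.val h
      rw [Fin.val_add, Fin.val_one, Nat.mod_eq_of_lt (by omega)] at this
      simp at this
    refine exists_zpow_mem_left_or_right hΓ (hadj k) h1.symm (hadj (k + 1)) h2.symm ?_ ?_ ?_
      (hJ k) (hl k)
    · intro h
      have := f.injective h
      exact h3 (by rw [eq_sub_iff_add_eq, add_assoc] at this; simpa using this)
    · intro h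
      have := f.injective h
      exact h3 (by rw [add_assoc] at this; simpa using this.symm)
    · intro h
      have := f.injective h
      exact h3 (by rw [eq_sub_iff_add_eq, eq_sub_iff_add_eq, add_assoc] at this; simpa using this)
  choose i j hi hj hij using hside
  let C : Fin (n + 2) → Prop := fun k => gen Γ (f (k + 1)) ^ i k ∈ S.left (J k) ∧
    gen Γ (f (k - 1)) ^ j k ∈ S.left (J k)
  have hne : ∀ k, C k ↔ ¬ C (k + 1) := by
    intro k
    have h1 := hij k
    have h2 := hij (k + 1)
    have hk : f (k + 1 - 1) = f k := by rw [add_sub_cancel_right]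
    constructor
    · intro h3 h4
      exact not_mem_left_and_mem_left (hadj k) (hJ k) (hJ (k + 1)) (hi k) (hj (k + 1)) h3.1
        (hk ▸ h4.2)
    · intro h3
      by_contra h4
      exact not_mem_right_and_mem_right (hadj k) (hJ k) (hJ (k + 1)) (hi k) (hj (k + 1))
        (h1.resolve_left h4).1 (hk ▸ (h2.resolve_left h3).2)
  refine (SimpleGraph.Coloring.mk (G := SimpleGraph.cycleGraph (n + 2))
    (fun k => decide (C k)) ?_).colorable
  intro x y hxy h
  have h' : C x ↔ C y := by simpa using h
  rcases SimpleGraph.cycleGraph_adj.1 hxy with h1 | h1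
  · obtain rfl : x = y + 1 := by rw [← h1]; simp
    have := hne y
    tauto
  · obtain rfl : y = x + 1 := by rw [← h1]; simp
    have := hne x
    tauto

end HyperplaneSystem

theorem mainTheorem3 {V : Type u} (Γ : SimpleGraph V) (hΓ : Γ.CliqueFree 3)
    (n : ℕ) (hn : 5 ≤ n) (hodd : Odd n) (hcycle : (SimpleGraph.cycleGraph n).IsIndContained Γ) :
    ¬ IsDiagramGroup.{u, v} (RightAngledArtinGroup Γ) := by
  intro h
  obtain ⟨S⟩ := h.nonempty_hyperplaneSystem
  obtain ⟨f⟩ := hcycle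
  have h1 := (S.cycleGraph_colorable hΓ hn f).chromaticNumber_le
  rw [SimpleGraph.chromaticNumber_cycleGraph_of_odd n (by omega) hodd] at h1
  exact absurd h1 (by decide)
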